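/- **System model.** Nodes are clients or servers; ids are linearly ordered and a node can tell from an id $q$ whether $q$ is a client ($\mathrm{IsClient}(q)$). A node takes a finite or infinite sequence of steps at nondecreasing real times $\ge 0$ (unbounded if the sequence is infinite). A step is triggered by Enter, Leave, Receive$(m)$ or, for clients only, Crash, Read, Write$(v)$; it changes the state, sends messages to all servers (s-bcast) or to all clients (c-bcast), and may give a response (Joined, Return$(v)$, Ack). A node is in the system initially (from time $0$; these servers form the finite set $S_0$) or its first step is its only Enter; nothing follows Leave or Crash. A node is *present* at $t$ if it has entered (or was in the system initially) and has not left by time $t$, and *active* at $t$ if it is present and has not crashed before $t$. $NS(t)$ is the number of servers present at $t$. Let $D>0$, $\alpha>0$ be real, $f\ge 1$, $NS_{min}>0$ integers. In an *execution*: (A1) at all times $t\ge 0$ finitely many nodes are present and $NS(t)\ge NS_{min}$; (A2) every receipt has a matching sent message, and no node receives a sent message twice; (A3) a broadcast sent at $t$ is received by every addressed node active throughout $[t,t+D]$, and delays of received messages lie in $(0,D]$; (A4) a node receives messages of the same sender in the order in which they were sent; (A5) for all $t\ge 0$ at most $\alpha\,NS(t)$ servers' Enter and Leave events occur in $[t,t+D]$;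 (A6) all nodes except a set $F$ of at most $f$ (Byzantine) servers follow the code below. Byzantine servers behave arbitrarily and may send unicasts, but sender ids are authentic and node ids are protected by signatures: an entry $enter(q)$, $join(q)$ or $leave(q)$ (also one implicit in a joined-echo or leave-echo message about $q$) can be sent by a Byzantine server only if $q\in F$ and $q$ has entered, or the correct server $q$ has already put it in its own $Server\_Changes$; a writer id in a triple it sends is $\perp$ or the id of a node that has already invoked a write; (A7) reads and writes are invoked only at clients that have joined earlier or were in the system initially; (A8) a client invokes an operation only after all its previous operations have been responded to. **Algorithm ABCC** (parameters $f,\gamma,\beta$). Each node $p$ keeps a set $Server\_Changes$ (abbreviated $C_p$; initially $\{enter(q),join(q): q\in S_0\}$ if $p$ is in the system initially, else $\emptyset$); $is\_joined$ (initially true iff $p$ is in the system initially); counters $ec,ej$ and $join\_bound$ (initially $0$); $(val,num,w\_id)$ (initially $(\perp,0,\perp)$); sets $KW[q]$ of triples (initially empty). $Present=\{q: enter(q)\in C_p, leave(q)\notin C_p\}$, $Members=\{q: join(q)\in C_p, leave(q)\notin C_p\}$. Timestamps $(num,w\_id)$ are ordered lexicographically, with $\perp$ below all ids. *SetValue*: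 if some triple occurs in at least $f+1$ of the sets $KW[\cdot]$ and the one of these with latest timestamp has value $\ne\perp$ and timestamp $>(num,w\_id)$, then assign it to $(val,num,w\_id)$ and add it to $KW[p]$. *Join$(j)$*: increment $ec$; if $j$ is true and $join\_bound=0$, increment $ej$ and, if then $ej>f$, set $join\_bound:=\gamma|Present|$; finally, if $ec\ge join\_bound>0$, set $is\_joined:=$ true, and a client gives the response Joined, while a server adds $join(p)$ to $C_p$, s-bcasts "joined" and c-bcasts server-info$(C_p)$. *Validity*: of the message types marked $*$ below, a message from $r$ is processed only if it is the first of its type (with the same arguments $q$, $tag$, where present) from $r$ and, except for "leave" itself, $leave(r)\notin C_p$. Server $p$. On Enter (on Leave): add $enter(p)$ ($leave(p)$) to $C_p$, s-bcast "enter" ("leave"), c-bcast server-info$(C_p)$. On receipt from $r$ of: enter$^*$: add $enter(r)$, s-bcast enter-echo$(C_p,KW[p],is\_joined,r)$, c-bcast server-info$(C_p)$; enter-client, if $r$ is a client: c-bcast enter-client-echo$(C_p,KW[p],is\_joined,r)$; enter-echo$(C,K,j,q)^*$: add $C$ to $C_p$; if $j$, add $K$ to $KW[r]$; if $p$ is not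 joined and $p=q$, Join$(j)$; SetValue; joined$^*$: add $enter(r),join(r)$, s-bcast joined-echo$(r)$, c-bcast server-info$(C_p)$; leave$^*$: add $leave(r)$, s-bcast leave-echo$(r)$, c-bcast server-info$(C_p)$; joined-echo$(q)^*$ (leave-echo$(q)^*$): add $enter(q),join(q)$ ($leave(q)$), c-bcast server-info$(C_p)$; query$(t)$, if $p$ is joined and $r$ is a client: c-bcast reply$(KW[p],t,r)$; update$(x,t)$, if $r$ is a client: if the timestamp of $x$ exceeds $(num,w\_id)$, assign $x$ to $(val,num,w\_id)$ and add it to $KW[p]$; if joined, c-bcast ack$(t,r)$; s-bcast update-echo$(KW[p])$; update-echo$(K)$: add $K$ to $KW[r]$; SetValue. Client $p$. On Enter: s-bcast enter-client. On receipt of enter-client-echo$(C,K,j,q)^*$ from $r$ with $q=p$: as for enter-echo (on receipt of any enter-client-echo: SetValue). On receipt of server-info$(C)$: add $C$ to $C_p$. On Read, or on Write$(v)$ after setting $temp:=v$, the *read phase* starts: $tag$ is incremented, query$(tag)$ is s-bcast, $rw\_bound:=\beta|Members|$, $rw\_counter:=0$. On receipt of reply$(K,tag,p)^*$ from $r$ in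 the read phase: increment $rw\_counter$, add $K$ to $KW[r]$; if $rw\_counter\ge rw\_bound$, do SetValue, end the read phase and start the *write phase*: for a write set $(val,num,w\_id):=(temp,num+1,p)$, for a read set $temp:=val$; s-bcast update$((temp,num,w\_id),tag)$, $rw\_bound:=\beta|Members|$, $rw\_counter:=0$. On receipt of ack$(tag,p)^*$ in the write phase: increment $rw\_counter$; if $rw\_counter\ge rw\_bound$, end the write phase and respond with Return$(temp)$ (read) or Ack (write). **Theorem.** Suppose that, with $N=NS_{min}$, $$\alpha\le 1-2^{-1/4},\qquad 1\le(1-\alpha)^3N-2f,\qquad \frac{1+2f}{(1-\alpha)^3N}+\frac{(1+\alpha)^3}{(1-\alpha)^3}-1\le\gamma\le\frac{(1-\alpha)^3}{(1+\alpha)^3}-\frac{f}{(1+\alpha)^3N},$$ $$\beta\le\frac{(1-\alpha)^3}{(1+\alpha)^2}-\frac{f}{(1+\alpha)^2N},\qquad \beta>\frac{(1+\alpha)^5-1+2f/N}{(1-\alpha)^4-f/N},\qquad \beta>\frac{(1+\alpha)^3-(1-\alpha)^3+1+(1+3f)/N}{(2+2\alpha+\alpha^2)(1-\alpha)^2(1+\alpha)^{-2}-2f/N}.$$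 Then in every execution of ABCC, every read or write operation invoked by a client that remains active (never crashes or leaves) completes with a matching response. Moreover each of its two phases terminates within $2D$ time: if a phase starts at time $t$ and the client is active at time $t+2D$, then the phase ends by time $t+2D$, the end of the write phase being the completion of the operation. -/

import Mathlib

namespace ABCC

/-! ### Messages, events and local states -/

/-- An entry of a `Server_Changes` set: a statement, digitally signed by the server it is about,
that this server has entered, joined or left. -/
inductive Change (ID : Type*) where
  | enter (q : ID)
  | join (q : ID)
  | leave (q : ID)
  deriving DecidableEq

/-- The server that an entry is about (and that signed it). -/
def Change.node {ID : Type*} : Change ID → ID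
  | .enter q => q
  | .join q => q
  | .leave q => q

/-- A triple `(val, num, w_id)`. The undefined value and the undefined writer id are `none`, `⊥`. -/
abbrev Entry (ID V : Type*) := Option V × ℕ × WithBot ID

/-- The timestamp `(num, w_id)` of a triple, in the lexicographic order. -/
def Entry.stamp {ID V : Type*} (x : Entry ID V) : ℕ ×ₗ WithBot ID := toLex (x.2.1, x.2.2)

/-- Message contents. The sender's id is not part of the content: messages are authenticated, so it
is attached by the communication service (see `Trigger.receive`). -/
inductive Payload (ID V : Type*) where
  | enter
  | enterClient
  | enterEcho (C : Finset (Change ID)) (K : Finset (Entry ID V)) (j : Bool) (q : ID)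
  | enterClientEcho (C : Finset (Change ID)) (K : Finset (Entry ID V)) (j : Bool) (q : ID)
  | serverInfo (C : Finset (Change ID))
  | joined
  | joinedEcho (q : ID)
  | leave
  | leaveEcho (q : ID)
  | query (rt : ℕ)
  | reply (K : Finset (Entry ID V)) (rt : ℕ) (q : ID)
  | update (x : Entry ID V) (wt : ℕ)
  | ack (wt : ℕ) (q : ID)
  | updateEcho (K : Finset (Entry ID V))

/-- The types of those messages of which only the first from each sender is processed. -/
inductive Label (ID : Type*) where
  | enter
  | joined
  | leave
  | enterEcho (q : ID)
  | enterClientEcho (q : ID)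
  | joinedEcho (q : ID)
  | leaveEcho (q : ID)
  | reply (q : ID) (tag : ℕ)
  | ack (q : ID) (tag : ℕ)
  deriving DecidableEq

def Payload.label {ID V : Type*} : Payload ID V → Option (Label ID)
  | .enter => some .enter
  | .joined => some .joined
  | .leave => some .leave
  | .enterEcho _ _ _ q => some (.enterEcho q)
  | .enterClientEcho _ _ _ q => some (.enterClientEcho q)
  | .joinedEcho q => some (.joinedEcho q)
  | .leaveEcho q => some (.leaveEcho q)
  | .reply _ rt q => some (.reply q rt)
  | .ack wt q => some (.ack q wt)
  | _ => none

/-- Addressees: s-bcast, c-bcast, and a single node (only Byzantine servers send unicasts). -/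
inductive Dest (ID : Type*) where
  | servers
  | clients
  | node (q : ID)

/-- Triggering events. `receive r m` is the receipt of message `m` from the sender `r`. -/
inductive Trigger (ID V : Type*) where
  | enter
  | leave
  | crash
  | read
  | write (v : V)
  | receive (r : ID) (m : Payload ID V)

def Trigger.IsInvocation {ID V : Type*} (T : Trigger ID V) : Prop :=
  T = .read ∨ ∃ v, T = .write v

inductive Response (V : Type*) where
  | returned (v : Option V)
  | acked
  | joined

/-- `R` is a response to the invocation `T` of a read or a write. -/
def Matches {ID V : Type*} (T : Trigger ID V) (R : Response V) : Prop :=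
  (T = .read ∧ ∃ v, R = .returned v) ∨ ((∃ v, T = .write v) ∧ R = .acked)

/-- The local variables of a node (a server simply does not use the last block).
`known` is the map `Known_Writes`, stored as the finite set of all pairs `(q, x)` with
`x ∈ Known_Writes[q]`; `heard` records which types of messages were received from whom. -/
structure State (ID V : Type*) where
  changes : Finset (Change ID)
  joinBound : ℝ
  echoCounter : ℕ
  echoFromJoinedCounter : ℕ
  isJoined : Bool
  val : Option V
  num : ℕ
  wid : WithBot ID
  known : Finset (ID × Entry ID V)
  heard : Finset (ID × Label ID)
  temp : Option V
  tag : ℕ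
  rwBound : ℝ
  rwCounter : ℕ
  rpPending : Bool
  wpPending : Bool
  readPending : Bool
  writePending : Bool

/-- The result of a step: new state, messages sent (in this order), response. -/
structure Effect (ID V : Type*) where
  state : State ID V
  out : List (Dest ID × Payload ID V) := []
  resp : Option (Response V) := none

/-- What the code of the nodes may refer to: the built-in procedure `IsClient`, the bound `f` on
the number of Byzantine servers, and the fractions `γ` and `β`. -/
structure Params (ID : Type*) where
  isClient : ID → Bool
  f : ℕ
  γ : ℝ
  β : ℝ

section Algorithm

variable {ID V : Type*} [LinearOrder ID] [DecidableEq V]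

/-- Initial states. `S₀` is the set of the servers that are in the system initially; `initially`
tells whether the node itself is in the system initially (it then counts as joined). -/
def initState (S₀ : Finset ID) (initially : Bool) : State ID V where
  changes := if initially then S₀.image .enter ∪ S₀.image .join else ∅
  joinBound := 0
  echoCounter := 0
  echoFromJoinedCounter := 0
  isJoined := initially
  val := none
  num := 0
  wid := ⊥
  known := ∅
  heard := ∅
  temp := none
  tag := 0
  rwBound := 0
  rwCounter := 0
  rpPending := false
  wpPending := false
  readPending := false
  writePending := false

namespace State

/-- `Present = {q | enter(q) ∈ Server_Changes ∧ leave(q) ∉ Server_Changes}`. -/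
def present (s : State ID V) : Finset ID :=
  (s.changes.image Change.node).filter fun q => .enter q ∈ s.changes ∧ .leave q ∉ s.changes

/-- `Members = {q | join(q) ∈ Server_Changes ∧ leave(q) ∉ Server_Changes}`. -/
def members (s : State ID V) : Finset ID :=
  (s.changes.image Change.node).filter fun q => .join q ∈ s.changes ∧ .leave q ∉ s.changes

/-- `Known_Writes[q]`. -/
def knownOf (s : State ID V) (q : ID) : Finset (Entry ID V) :=
  (s.known.filter fun y => y.1 = q).image Prod.snd

def addChanges (s : State ID V) (C : Finset (Change ID)) : State ID V :=
  { s with changes := s.changes ∪ C }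

/-- `Known_Writes[q] := Known_Writes[q] ∪ K`. -/
def addKnown (s : State ID V) (q : ID) (K : Finset (Entry ID V)) : State ID V :=
  { s with known := s.known ∪ K.image fun x => (q, x) }

/-- The triples that occur in at least `f + 1` of the sets `Known_Writes[q]`. -/
def candidates (f : ℕ) (s : State ID V) : Finset (Entry ID V) :=
  (s.known.image Prod.snd).filter fun x => f + 1 ≤ (s.known.filter fun y => y.2 = x).card

open Classical in
/-- `valid_val`: a triple with latest timestamp among those that occur in at least `f + 1` of the
sets `Known_Writes[q]`, and `(⊥, 0, ⊥)` if there is none. -/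
noncomputable def validVal (f : ℕ) (s : State ID V) : Entry ID V :=
  if h : (s.candidates f).Nonempty then
    (Finset.exists_max_image (s.candidates f) Entry.stamp h).choose
  else (none, 0, ⊥)

/-- `(val, num, w_id) := x; Known_Writes[p] := Known_Writes[p] ∪ {x}`. -/
def store (p : ID) (s : State ID V) (x : Entry ID V) : State ID V :=
  { s with val := x.1, num := x.2.1, wid := x.2.2 }.addKnown p {x}

/-- Procedure SetValueTimestamp() at node `p`. -/
noncomputable def setValueTimestamp (f : ℕ) (p : ID) (s : State ID V) : State ID V :=
  if (s.validVal f).1 ≠ none ∧ toLex (s.num, s.wid) < (s.validVal f).stamp then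
    s.store p (s.validVal f)
  else s

/-- The procedures IsValidMessage(): `m` is the first message of its type from `r`, and `r` is not
known to have sent a leave message already. For the first leave message of `r` itself, the second
test is void. -/
def isValid (s : State ID V) (r : ID) (m : Payload ID V) : Bool :=
  match m.label with
  | none => true
  | some l => decide ((r, l) ∉ s.heard ∧ (l = .leave ∨ .leave r ∉ s.changes))

/-- Remember, for later calls of IsValidMessage(), that `m` has been received from `r`. -/
def note (s : State ID V) (r : ID) (m : Payload ID V) : State ID V :=
  match m.label with
  | none => s
  | some l => { s with heard := insert (r, l) s.heard }

/-- First half of procedure JoinProtocol(`j`): the counters and `join_bound`. -/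
noncomputable def countEcho (P : Params ID) (j : Bool) (s : State ID V) : State ID V :=
  let s₁ := { s with echoCounter := s.echoCounter + 1 }
  if j = true ∧ s₁.joinBound = 0 then
    let s₂ := { s₁ with echoFromJoinedCounter := s₁.echoFromJoinedCounter + 1 }
    if P.f < s₂.echoFromJoinedCounter then
      { s₂ with joinBound := P.γ * s₂.present.card }
    else s₂
  else s₁

/-- Procedure JoinProtocol(`j`) at node `p`. -/
noncomputable def joinProtocol (P : Params ID) (p : ID) (j : Bool) (s : State ID V) :
    Effect ID V :=
  let s₁ := s.countEcho P j
  if s₁.joinBound ≤ s₁.echoCounter ∧ 0 < s₁.joinBound then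
    let s₂ := { s₁ with isJoined := true }
    if P.isClient p then { state := s₂, resp := some .joined }
    else
      let s₃ := s₂.addChanges {.join p}
      { state := s₃, out := [(.servers, .joined), (.clients, .serverInfo s₃.changes)] }
  else { state := s₁ }

end State

open State

/-- The handling of a message `m` from `r` at server `p`. -/
noncomputable def serverReceive (P : Params ID) (p r : ID) (m : Payload ID V) (s₀ : State ID V) :
    Effect ID V :=
  let s := s₀.note r m
  if s₀.isValid r m = false then { state := s }
  else match m with
  | .enter =>
      let s₁ := s.addChanges {.enter r}
      { state := s₁
        out := [(.servers, .enterEcho s₁.changes (s₁.knownOf p) s₁.isJoined r),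
          (.clients, .serverInfo s₁.changes)] }
  | .enterClient =>
      if P.isClient r then
        { state := s
          out := [(.clients, .enterClientEcho s.changes (s.knownOf p) s.isJoined r)] }
      else { state := s }
  | .enterEcho C K j q =>
      let s₁ := s.addChanges C
      let s₂ := if j then s₁.addKnown r K else s₁
      let e : Effect ID V :=
        if s₂.isJoined = false ∧ p = q then s₂.joinProtocol P p j else { state := s₂ }
      { e with state := e.state.setValueTimestamp P.f p }
  | .joined =>
      let s₁ := s.addChanges {.enter r, .join r}
      { state := s₁
        out := [(.servers, .joinedEcho r), (.clients, .serverInfo s₁.changes)] }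
  | .joinedEcho q =>
      let s₁ := s.addChanges {.enter q, .join q}
      { state := s₁, out := [(.clients, .serverInfo s₁.changes)] }
  | .leave =>
      let s₁ := s.addChanges {.leave r}
      { state := s₁
        out := [(.servers, .leaveEcho r), (.clients, .serverInfo s₁.changes)] }
  | .leaveEcho q =>
      let s₁ := s.addChanges {.leave q}
      { state := s₁, out := [(.clients, .serverInfo s₁.changes)] }
  | .query rt =>
      if s.isJoined = true ∧ P.isClient r = true then
        { state := s, out := [(.clients, .reply (s.knownOf p) rt r)] }
      else { state := s }
  | .update x wt =>
      if P.isClient r then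
        let s₁ := if toLex (s.num, s.wid) < x.stamp then s.store p x else s
        { state := s₁
          out := (if s₁.isJoined then [(.clients, .ack wt r)] else []) ++
            [(.servers, .updateEcho (s₁.knownOf p))] }
      else { state := s }
  | .updateEcho K => { state := (s.addKnown r K).setValueTimestamp P.f p }
  | _ => { state := s }

/-- The code of server `p`. -/
noncomputable def serverStep (P : Params ID) (p : ID) (T : Trigger ID V) (s : State ID V) :
    Effect ID V :=
  match T with
  | .enter =>
      let s₁ := s.addChanges {.enter p}
      { state := s₁, out := [(.servers, .enter), (.clients, .serverInfo s₁.changes)] }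
  | .leave =>
      let s₁ := s.addChanges {.leave p}
      { state := s₁, out := [(.servers, .leave), (.clients, .serverInfo s₁.changes)] }
  | .receive r m => serverReceive P p r m s
  | _ => { state := s }

/-- Procedure BeginReadPhase(). -/
noncomputable def beginReadPhase (P : Params ID) (s : State ID V) : Effect ID V where
  state := { s with
    tag := s.tag + 1
    rwBound := P.β * s.members.card
    rwCounter := 0
    rpPending := true }
  out := [(.servers, .query (s.tag + 1))]

/-- Procedure BeginWritePhase() at client `p`. -/
noncomputable def beginWritePhase (P : Params ID) (p : ID) (s : State ID V) : Effect ID V :=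
  let s₁ := if s.writePending then
    { s with val := s.temp, num := s.num + 1, wid := (p : WithBot ID) } else s
  let s₂ := if s₁.readPending then { s₁ with temp := s₁.val } else s₁
  { state := { s₂ with
      rwBound := P.β * s₂.members.card
      rwCounter := 0
      wpPending := true }
    out := [(.servers, .update (s₂.temp, s₂.num, s₂.wid) s₂.tag)] }

/-- The handling of a message `m` from `r` at client `p`. -/
noncomputable def clientReceive (P : Params ID) (p r : ID) (m : Payload ID V) (s₀ : State ID V) :
    Effect ID V :=
  let s := s₀.note r m
  match m with
  | .enterClientEcho C K j q =>
      let e : Effect ID V :=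
        if s₀.isValid r m = true ∧ p = q then
          let s₁ := s.addChanges C
          let s₂ := if j then s₁.addKnown r K else s₁
          if s₂.isJoined = false then s₂.joinProtocol P p j else { state := s₂ }
        else { state := s }
      { e with state := e.state.setValueTimestamp P.f p }
  | .serverInfo C => { state := s.addChanges C }
  | .reply K rt q =>
      if s₀.isValid r m = true ∧ s.rpPending = true ∧ rt = s.tag ∧ q = p then
        let s₁ := { s with rwCounter := s.rwCounter + 1 }.addKnown r K
        if s₁.rwBound ≤ s₁.rwCounter then
          beginWritePhase P p { s₁.setValueTimestamp P.f p with rpPending := false }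
        else { state := s₁ }
      else { state := s }
  | .ack wt q =>
      if s₀.isValid r m = true ∧ s.wpPending = true ∧ wt = s.tag ∧ q = p then
        let s₁ := { s with rwCounter := s.rwCounter + 1 }
        if s₁.rwBound ≤ s₁.rwCounter then
          let s₂ := { s₁ with wpPending := false, readPending := false, writePending := false }
          { state := s₂
            resp := if s.readPending then some (.returned s.temp)
              else if s.writePending then some .acked else none }
        else { state := s₁ }
      else { state := s }
  | _ => { state := s }

/-- The code of client `p`. -/
noncomputable def clientStep (P : Params ID) (p : ID) (T : Trigger ID V) (s : State ID V) :
    Effect ID V :=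
  match T with
  | .enter => { state := s, out := [(.servers, .enterClient)] }
  | .leave => { state := s }
  | .crash => { state := s }
  | .read => beginReadPhase P { s with readPending := true }
  | .write v => beginReadPhase P { s with writePending := true, temp := some v }
  | .receive r m => clientReceive P p r m s

/-- The transition function of node `p`. -/
noncomputable def step (P : Params ID) (p : ID) (T : Trigger ID V) (s : State ID V) :
    Effect ID V :=
  if P.isClient p then clientStep P p T s else serverStep P p T s

end Algorithm

/-! ### Timed views and executions -/

/-- A finite or infinite sequence of timed steps. Step number `k` (for `k < len`) leads from
`state k` to `state (k + 1)`, is triggered by `trigger k`, sends `out k`, gives the response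
`resp k`, and takes place at time `time k`; entries beyond `len` are irrelevant. -/
structure View (ID V : Type*) where
  len : ℕ∞
  state : ℕ → State ID V
  trigger : ℕ → Trigger ID V
  out : ℕ → List (Dest ID × Payload ID V)
  resp : ℕ → Option (Response V)
  time : ℕ → ℝ

/-- A family of timed views. `S₀` and `C₀` are the servers and the clients that are in the system
initially, `F` is the set of Byzantine-faulty servers. If step `k` of node `q` is the receipt of a
message from `p`, and `source q k = (i, j)`, then what is received is entry number `j` of the list
of the messages that `p` sends in its step `i`. The view of a node that is never in the system has
no steps. -/
structure Run (ID V : Type*) where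
  S₀ : Finset ID
  C₀ : Set ID
  F : Finset ID
  view : ID → View ID V
  source : ID → ℕ → ℕ × ℕ

namespace Run

variable {ID V : Type*} [LinearOrder ID] [DecidableEq V]

def Initially (R : Run ID V) (p : ID) : Prop := p ∈ R.S₀ ∨ p ∈ R.C₀

/-- `k` is the number of a step of node `p`. -/
def HasStep (R : Run ID V) (p : ID) (k : ℕ) : Prop := (k : ℕ∞) < (R.view p).len

/-- Node `p` has a step triggered by `T` at time `t`. -/
def Occurs (R : Run ID V) (p : ID) (T : Trigger ID V) (t : ℝ) : Prop :=
  ∃ k, R.HasStep p k ∧ (R.view p).trigger k = T ∧ (R.view p).time k = t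

/-- `p` is in the system initially or enters by time `t`. -/
def EnteredBy (R : Run ID V) (p : ID) (t : ℝ) : Prop :=
  R.Initially p ∨ ∃ u ≤ t, R.Occurs p .enter u

/-- `p` has entered and has not left by time `t`. -/
def PresentAt (R : Run ID V) (p : ID) (t : ℝ) : Prop :=
  R.EnteredBy p t ∧ ¬ ∃ u ≤ t, R.Occurs p .leave u

/-- `p` is present at time `t` and has not crashed before time `t`. -/
def ActiveAt (R : Run ID V) (p : ID) (t : ℝ) : Prop :=
  R.PresentAt p t ∧ ¬ ∃ u < t, R.Occurs p .crash u

/-- The set of the servers that are present at time `t`. -/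
def serversAt (R : Run ID V) (P : Params ID) (t : ℝ) : Set ID :=
  {p | P.isClient p = false ∧ R.PresentAt p t}

/-- `NS(t)`, the number of servers present at time `t`. -/
noncomputable def NS (R : Run ID V) (P : Params ID) (t : ℝ) : ℕ := (R.serversAt P t).ncard

/-- The servers for which event `T` occurs during the time interval `[t, t + D]`. -/
def serversWith (R : Run ID V) (P : Params ID) (T : Trigger ID V) (t D : ℝ) : Set ID :=
  {p | P.isClient p = false ∧ ∃ u, t ≤ u ∧ u ≤ t + D ∧ R.Occurs p T u}

open Classical in
/-- The rules for the timed view of node `p`, correct or not. A node that is in the system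
initially is so from time `0` on; a node that enters later does so in its first step. -/
structure IsTimedView (R : Run ID V) (P : Params ID) (p : ID) : Prop where
  init : (R.view p).state 0 = initState R.S₀ (decide (R.Initially p))
  nonneg : ∀ k, R.HasStep p k → 0 ≤ (R.view p).time k
  mono : ∀ k l, k ≤ l → R.HasStep p l → (R.view p).time k ≤ (R.view p).time l
  unbounded : (R.view p).len = ⊤ → ∀ t, ∃ k, t < (R.view p).time k
  enter : ∀ k, R.HasStep p k → ((R.view p).trigger k = .enter ↔ k = 0 ∧ ¬ R.Initially p)
  halt : ∀ k, R.HasStep p k → ((R.view p).trigger k = .leave ∨ (R.view p).trigger k = .crash) →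
    (R.view p).len = k + 1
  server : P.isClient p = false → ∀ k, R.HasStep p k →
    (R.view p).trigger k ≠ .crash ∧ ¬ ((R.view p).trigger k).IsInvocation

/-- Every step of `p` is the one that its transition function determines. -/
def IsValidView (R : Run ID V) (P : Params ID) (p : ID) : Prop :=
  ∀ k, R.HasStep p k →
    (⟨(R.view p).state (k + 1), (R.view p).out k, (R.view p).resp k⟩ : Effect ID V) =
      step P p ((R.view p).trigger k) ((R.view p).state k)

/-- The entry `c` has been signed by time `t`: by a correct server, which does so by putting it
into its own `Server_Changes` set, or by a Byzantine server, which signs what it likes about itself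
from the time on when it is in the system. -/
def Signed (R : Run ID V) (c : Change ID) (t : ℝ) : Prop :=
  (c.node ∈ R.F ∧ R.EnteredBy c.node t) ∨
  (c.node ∉ R.F ∧ ∃ k : ℕ, (k : ℕ∞) ≤ (R.view c.node).len ∧
    (∀ i < k, (R.view c.node).time i ≤ t) ∧ c ∈ ((R.view c.node).state k).changes)

/-- The writer id `w` is `⊥` or the id of a node that has invoked a write by time `t`. -/
def SignedWriter (R : Run ID V) (w : WithBot ID) (t : ℝ) : Prop :=
  w = ⊥ ∨ ∃ q : ID, w = q ∧ ∃ v, ∃ u ≤ t, R.Occurs q (.write v) u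

/-- The completion of the operation that is invoked in step `k` of `p` by the response given in
step `n`: the response matches the invocation, and apart from receipts of messages nothing happens
at `p` in between. -/
def Completes (R : Run ID V) (p : ID) (k n : ℕ) : Prop :=
  k < n ∧ R.HasStep p n ∧ ((R.view p).trigger k).IsInvocation ∧
  (∃ A, (R.view p).resp n = some A ∧ Matches ((R.view p).trigger k) A) ∧
  (∀ i, k < i → i ≤ n → ∃ r m, (R.view p).trigger i = .receive r m) ∧
  (∀ i, k < i → i < n → (R.view p).resp i = none)

/-- The read phase of the operation invoked in step `k` of `p` ends in step `m`, in which the write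
phase begins. -/
def ReadPhase (R : Run ID V) (p : ID) (k m : ℕ) : Prop :=
  ((R.view p).trigger k).IsInvocation ∧ k < m ∧ R.HasStep p m ∧
  (∀ i, k < i → i ≤ m → ((R.view p).state i).rpPending = true) ∧
  ((R.view p).state (m + 1)).rpPending = false ∧ ((R.view p).state (m + 1)).wpPending = true

/-- The write phase that begins in step `m` of `p` ends in step `n`. -/
def WritePhase (R : Run ID V) (p : ID) (m n : ℕ) : Prop :=
  m < n ∧ R.HasStep p n ∧
  (∀ i, m < i → i ≤ n → ((R.view p).state i).wpPending = true) ∧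
  ((R.view p).state (n + 1)).wpPending = false

end Run

/-- The broadcast addressed to `d` goes to `q`. -/
def Dest.BroadcastTo {ID : Type*} (P : Params ID) (q : ID) : Dest ID → Prop
  | .servers => P.isClient q = false
  | .clients => P.isClient q = true
  | .node _ => False

/-- A message addressed to `d` may be received by `q`. -/
def Dest.Admits {ID : Type*} (P : Params ID) (q : ID) : Dest ID → Prop
  | .servers => P.isClient q = false
  | .clients => P.isClient q = true
  | .node q' => q' = q

/-- The entries about servers that a message contains or, for echoes, states; what a message says
about its own sender is left out. -/
def Payload.entries {ID V : Type*} [DecidableEq ID] : Payload ID V → Finset (Change ID)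
  | .enterEcho C _ _ _ => C
  | .enterClientEcho C _ _ _ => C
  | .serverInfo C => C
  | .joinedEcho q => {.enter q, .join q}
  | .leaveEcho q => {.leave q}
  | _ => ∅

/-- The triples that a message contains. -/
def Payload.writes {ID V : Type*} : Payload ID V → Finset (Entry ID V)
  | .enterEcho _ K _ _ => K
  | .enterClientEcho _ K _ _ => K
  | .reply K _ _ => K
  | .update x _ => {x}
  | .updateEcho K => K
  | _ => ∅

/-- `R` is an execution of the algorithm with parameters `P`, in a system with maximum message
delay `D`, churn rate `α` and minimum number `NSmin` of servers. -/
structure IsExecution {ID V : Type*} [LinearOrder ID] [DecidableEq V]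
    (P : Params ID) (D α : ℝ) (NSmin : ℕ) (R : Run ID V) : Prop where
  servers_initially : ∀ p ∈ R.S₀, P.isClient p = false
  clients_initially : ∀ p ∈ R.C₀, P.isClient p = true
  timedView : ∀ p, R.IsTimedView P p
  /-- The system is finite and has at least `NSmin` servers at all times. -/
  finite : ∀ t, 0 ≤ t → {p | R.PresentAt p t}.Finite
  minSize : ∀ t, 0 ≤ t → NSmin ≤ R.NS P t
  /-- What is received was sent, to the recipient, and is received with a delay in `(0, D]`. -/
  sent : ∀ q k r m, R.HasStep q k → (R.view q).trigger k = .receive r m →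
    R.HasStep r (R.source q k).1 ∧
    (∃ d, ((R.view r).out (R.source q k).1)[(R.source q k).2]? = some (d, m) ∧ d.Admits P q) ∧
    (R.view r).time (R.source q k).1 < (R.view q).time k ∧
    (R.view q).time k ≤ (R.view r).time (R.source q k).1 + D
  /-- Nothing is received twice, and messages from the same sender are received in the order in
  which they were sent. -/
  fifo : ∀ q k l r m m', k < l → R.HasStep q l → (R.view q).trigger k = .receive r m →
    (R.view q).trigger l = .receive r m' → toLex (R.source q k) < toLex (R.source q l)
  /-- A broadcast is received by every addressee that stays active for time `D`. -/
  delivered : ∀ p i j d m, R.HasStep p i → ((R.view p).out i)[j]? = some (d, m) →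
    ∀ q, d.BroadcastTo P q →
    (∀ t, (R.view p).time i ≤ t → t ≤ (R.view p).time i + D → R.ActiveAt q t) →
    ∃ k, R.HasStep q k ∧ (R.view q).trigger k = .receive p m ∧ R.source q k = (i, j)
  /-- The number of events of servers entering or leaving in `[t, t + D]` is at most `α * NS(t)`. -/
  churn : ∀ t, 0 ≤ t →
    (R.serversWith P .enter t D).Finite ∧ (R.serversWith P .leave t D).Finite ∧
    ((R.serversWith P .enter t D).ncard + (R.serversWith P .leave t D).ncard : ℝ) ≤ α * R.NS P t
  /-- At most `f` nodes are Byzantine, and they are servers; all others follow their code. -/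
  byzantine_card : R.F.card ≤ P.f
  byzantine_server : ∀ p ∈ R.F, P.isClient p = false
  valid : ∀ p, p ∉ R.F → R.IsValidView P p
  /-- Byzantine servers cannot forge node ids: what they send about other servers and about writers
  is signed by those. Otherwise their steps are arbitrary. -/
  unforgeable : ∀ p ∈ R.F, ∀ i, R.HasStep p i → ∀ x ∈ (R.view p).out i,
    (∀ c ∈ x.2.entries, R.Signed c ((R.view p).time i)) ∧
    (∀ y ∈ x.2.writes, R.SignedWriter y.2.2 ((R.view p).time i))
  /-- Operations are invoked only by clients that have joined or were in the system initially. -/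
  invoke_joined : ∀ p k, R.HasStep p k → ((R.view p).trigger k).IsInvocation →
    R.Initially p ∨ ∃ i < k, (R.view p).resp i = some .joined
  /-- A client invokes an operation only when its earlier ones have been responded to. -/
  invoke_sequential : ∀ p k l, k < l → R.HasStep p l → ((R.view p).trigger k).IsInvocation →
    ((R.view p).trigger l).IsInvocation → ∃ n < l, R.Completes p k n

/-- The constraints on the system parameters `α`, `f`, `NSmin` and the algorithm parameters
`γ`, `β`. -/
structure Constraints (α : ℝ) (f NSmin : ℕ) (γ β : ℝ) : Prop where
  c1 : α ≤ 1 - (2 : ℝ) ^ (-(1 / 4) : ℝ)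
  c2 : 1 ≤ (1 - α) ^ 3 * NSmin - 2 * f
  c3 : (1 + 2 * f) / ((1 - α) ^ 3 * NSmin) + (1 + α) ^ 3 / (1 - α) ^ 3 - 1 ≤ γ
  c4 : γ ≤ (1 - α) ^ 3 / (1 + α) ^ 3 - f / ((1 + α) ^ 3 * NSmin)
  c5 : β ≤ (1 - α) ^ 3 / (1 + α) ^ 2 - f / ((1 + α) ^ 2 * NSmin)
  c6 : ((1 + α) ^ 5 - 1 + 2 * f / NSmin) / ((1 - α) ^ 4 - f / NSmin) < β
  c7 : ((1 + α) ^ 3 - (1 - α) ^ 3 + 1 + (1 + 3 * f) / NSmin) /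
      ((2 + 2 * α + α ^ 2) * (1 - α) ^ 2 / (1 + α) ^ 2 - 2 * f / NSmin) < β

end ABCC

set_option linter.unusedSectionVars false

/-! Everything rests on a comparison that no node can make itself: between the set `Q` of correct
servers that are in the system before a window `[b, b + 4D]` and stay throughout it, and the servers
that a node may believe to be present. Four applications of the churn bound show that at most
`((1+α)^4 - 1) * NS(b)` enter and leave events of servers fall into the window. The parameter
constraints say (`Constraints.margins`) that this loss, together with `f` faults, is small. By
`exists_core` three things follow. `Q` has more than `f` elements. `γ * |Q|` exceeds the number of
servers that are Byzantine or enter or leave in the window. And `β * |X|` and `γ * |X|` are at most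
`|Q|` for every set `X` of servers that entered by the end of the window and of which no correct one
left before `b`. The window is used with `b = max 0 (t - 2D)`, so that it reaches from `2D` before a
moment `t` to at least `2D` after it: news older than `2D` is known at time `t`, and a request sent
at time `t` is answered by time `t + 2D`.

What nodes know is controlled by three facts. Entries are authentic (`genuine`): a correct node
never believes that a correct server has left before it has. Secondly (`informed`), a correct node
that was there initially, has joined, or has been there for more than `2D` knows every enter and
leave event of correct servers that is more than `2D` old, except for the entering of servers that
have left meanwhile. Thirdly (`isJoined_of_server`), a correct server that has been there for more
than `2D` has joined. These are proved by induction along the steps of servers in the order of time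
(`server_induction`), which is well founded because delays are positive and only finitely many
server steps happen by any given time.

The heart is `informed` for a node that entered after the event. Some correct server that stays in
the system from before the window has answered its enter message. Either that server knew the event
by induction or from the announcement itself and reported it in its answer, or it learned of the
event later and passed it on when the new node was already listening. For a node that joins early,
such a server exists because `join_bound` is at least `γ * |Q|`, more than churn and faults can
account for.

An operation then goes through. By `informed` and `genuine`, the members that the client counts at
the start of a phase form a set `X` as above, so `rw_bound` is at most `|Q|`. All servers in `Q`
have joined and stay, hence each answers within `2D` (`exists_quorum`, `exists_response`), and a
phase cannot survive the counting of all these answers (`exists_phase_end`). Tags ensure that only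
answers to the current operation are counted. -/

namespace ABCC

variable {ID V : Type*} [LinearOrder ID] [DecidableEq V]

/-! ### Local states: components that the procedures leave unchanged -/

namespace State

section Projections

variable (f : ℕ) (p r : ID) (m : Payload ID V) (s : State ID V)

@[simp] lemma setValueTimestamp_changes : (s.setValueTimestamp f p).changes = s.changes := by
  unfold setValueTimestamp store addKnown; split_ifs <;> rfl
@[simp] lemma setValueTimestamp_heard : (s.setValueTimestamp f p).heard = s.heard := by
  unfold setValueTimestamp store addKnown; split_ifs <;> rfl
@[simp] lemma setValueTimestamp_joinBound :
    (s.setValueTimestamp f p).joinBound = s.joinBound := by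
  unfold setValueTimestamp store addKnown; split_ifs <;> rfl
@[simp] lemma setValueTimestamp_echoCounter :
    (s.setValueTimestamp f p).echoCounter = s.echoCounter := by
  unfold setValueTimestamp store addKnown; split_ifs <;> rfl
@[simp] lemma setValueTimestamp_echoFromJoinedCounter :
    (s.setValueTimestamp f p).echoFromJoinedCounter = s.echoFromJoinedCounter := by
  unfold setValueTimestamp store addKnown; split_ifs <;> rfl
@[simp] lemma setValueTimestamp_isJoined : (s.setValueTimestamp f p).isJoined = s.isJoined := by
  unfold setValueTimestamp store addKnown; split_ifs <;> rfl
@[simp] lemma setValueTimestamp_tag : (s.setValueTimestamp f p).tag = s.tag := by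
  unfold setValueTimestamp store addKnown; split_ifs <;> rfl
@[simp] lemma setValueTimestamp_rwBound : (s.setValueTimestamp f p).rwBound = s.rwBound := by
  unfold setValueTimestamp store addKnown; split_ifs <;> rfl
@[simp] lemma setValueTimestamp_rwCounter :
    (s.setValueTimestamp f p).rwCounter = s.rwCounter := by
  unfold setValueTimestamp store addKnown; split_ifs <;> rfl
@[simp] lemma setValueTimestamp_rpPending :
    (s.setValueTimestamp f p).rpPending = s.rpPending := by
  unfold setValueTimestamp store addKnown; split_ifs <;> rfl
@[simp] lemma setValueTimestamp_wpPending :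
    (s.setValueTimestamp f p).wpPending = s.wpPending := by
  unfold setValueTimestamp store addKnown; split_ifs <;> rfl
@[simp] lemma setValueTimestamp_readPending :
    (s.setValueTimestamp f p).readPending = s.readPending := by
  unfold setValueTimestamp store addKnown; split_ifs <;> rfl
@[simp] lemma setValueTimestamp_writePending :
    (s.setValueTimestamp f p).writePending = s.writePending := by
  unfold setValueTimestamp store addKnown; split_ifs <;> rfl

lemma mem_note_heard {x : ID × Label ID} :
    x ∈ (s.note r m).heard ↔ x ∈ s.heard ∨ x.1 = r ∧ m.label = some x.2 := by
  unfold note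
  split
  · rename_i h; simp [h]
  · rename_i l h
    rcases x with ⟨a, b⟩
    simp only [h, Finset.mem_insert, Prod.mk.injEq, Option.some.injEq]
    constructor
    · rintro (⟨rfl, rfl⟩ | h)
      exacts [.inr ⟨rfl, rfl⟩, .inl h]
    · rintro (h | ⟨rfl, rfl⟩)
      exacts [.inr h, .inl ⟨rfl, rfl⟩]

@[simp] lemma note_changes : (s.note r m).changes = s.changes := by unfold note; split <;> rfl
@[simp] lemma note_joinBound : (s.note r m).joinBound = s.joinBound := by
  unfold note; split <;> rfl
@[simp] lemma note_echoCounter : (s.note r m).echoCounter = s.echoCounter := by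
  unfold note; split <;> rfl
@[simp] lemma note_echoFromJoinedCounter :
    (s.note r m).echoFromJoinedCounter = s.echoFromJoinedCounter := by unfold note; split <;> rfl
@[simp] lemma note_isJoined : (s.note r m).isJoined = s.isJoined := by unfold note; split <;> rfl
@[simp] lemma note_tag : (s.note r m).tag = s.tag := by unfold note; split <;> rfl
@[simp] lemma note_rwBound : (s.note r m).rwBound = s.rwBound := by unfold note; split <;> rfl
@[simp] lemma note_rwCounter : (s.note r m).rwCounter = s.rwCounter := by
  unfold note; split <;> rfl
@[simp] lemma note_rpPending : (s.note r m).rpPending = s.rpPending := by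
  unfold note; split <;> rfl
@[simp] lemma note_wpPending : (s.note r m).wpPending = s.wpPending := by
  unfold note; split <;> rfl
@[simp] lemma note_readPending : (s.note r m).readPending = s.readPending := by
  unfold note; split <;> rfl
@[simp] lemma note_writePending : (s.note r m).writePending = s.writePending := by
  unfold note; split <;> rfl
@[simp] lemma note_temp : (s.note r m).temp = s.temp := by unfold note; split <;> rfl

end Projections

lemma isValid_of_label {s : State ID V} {r : ID} {m : Payload ID V} {l : Label ID}
    (h : m.label = some l) :
    s.isValid r m = true ↔ (r, l) ∉ s.heard ∧ (l = .leave ∨ .leave r ∉ s.changes) := by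
  unfold isValid; rw [h]; simp

end State

open State

/-- The servers that a set of entries reports to have entered and not to have left. -/
def presentIn (C : Finset (Change ID)) : Finset ID :=
  (C.image Change.node).filter fun q => .enter q ∈ C ∧ .leave q ∉ C

lemma State.present_eq (s : State ID V) : s.present = presentIn s.changes := rfl

lemma mem_presentIn {C : Finset (Change ID)} {q : ID} :
    q ∈ presentIn C ↔ .enter q ∈ C ∧ .leave q ∉ C := by
  simp only [presentIn, Finset.mem_filter, Finset.mem_image, and_iff_right_iff_imp]
  exact fun h => ⟨_, h.1, rfl⟩

lemma State.mem_members {s : State ID V} {q : ID} :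
    q ∈ s.members ↔ .join q ∈ s.changes ∧ .leave q ∉ s.changes := by
  simp only [State.members, Finset.mem_filter, Finset.mem_image, and_iff_right_iff_imp]
  exact fun h => ⟨_, h.1, rfl⟩

section Projections

variable (P : Params ID) (p r : ID) (s : State ID V) (K : Finset (Entry ID V)) (x : Entry ID V)

@[simp] lemma addKnown_changes : (s.addKnown r K).changes = s.changes := rfl
@[simp] lemma addKnown_heard : (s.addKnown r K).heard = s.heard := rfl
@[simp] lemma addKnown_joinBound : (s.addKnown r K).joinBound = s.joinBound := rfl
@[simp] lemma addKnown_echoCounter : (s.addKnown r K).echoCounter = s.echoCounter := rfl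
@[simp] lemma addKnown_echoFromJoinedCounter : (s.addKnown r K).echoFromJoinedCounter = s.echoFromJoinedCounter := rfl
@[simp] lemma addKnown_isJoined : (s.addKnown r K).isJoined = s.isJoined := rfl
@[simp] lemma addKnown_tag : (s.addKnown r K).tag = s.tag := rfl
@[simp] lemma addKnown_rwBound : (s.addKnown r K).rwBound = s.rwBound := rfl
@[simp] lemma addKnown_rwCounter : (s.addKnown r K).rwCounter = s.rwCounter := rfl
@[simp] lemma addKnown_rpPending : (s.addKnown r K).rpPending = s.rpPending := rfl
@[simp] lemma addKnown_wpPending : (s.addKnown r K).wpPending = s.wpPending := rfl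
@[simp] lemma addKnown_readPending : (s.addKnown r K).readPending = s.readPending := rfl
@[simp] lemma addKnown_writePending : (s.addKnown r K).writePending = s.writePending := rfl

@[simp] lemma store_changes : (s.store p x).changes = s.changes := rfl
@[simp] lemma store_heard : (s.store p x).heard = s.heard := rfl
@[simp] lemma store_joinBound : (s.store p x).joinBound = s.joinBound := rfl
@[simp] lemma store_echoCounter : (s.store p x).echoCounter = s.echoCounter := rfl
@[simp] lemma store_echoFromJoinedCounter : (s.store p x).echoFromJoinedCounter = s.echoFromJoinedCounter := rfl
@[simp] lemma store_isJoined : (s.store p x).isJoined = s.isJoined := rfl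

@[simp] lemma beginWritePhase_changes :
    (beginWritePhase P p s).state.changes = s.changes := by
  unfold beginWritePhase; dsimp only; split_ifs <;> rfl
@[simp] lemma beginWritePhase_heard :
    (beginWritePhase P p s).state.heard = s.heard := by
  unfold beginWritePhase; dsimp only; split_ifs <;> rfl
@[simp] lemma beginWritePhase_joinBound :
    (beginWritePhase P p s).state.joinBound = s.joinBound := by
  unfold beginWritePhase; dsimp only; split_ifs <;> rfl
@[simp] lemma beginWritePhase_echoCounter :
    (beginWritePhase P p s).state.echoCounter = s.echoCounter := by
  unfold beginWritePhase; dsimp only; split_ifs <;> rfl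
@[simp] lemma beginWritePhase_echoFromJoinedCounter :
    (beginWritePhase P p s).state.echoFromJoinedCounter = s.echoFromJoinedCounter := by
  unfold beginWritePhase; dsimp only; split_ifs <;> rfl
@[simp] lemma beginWritePhase_isJoined :
    (beginWritePhase P p s).state.isJoined = s.isJoined := by
  unfold beginWritePhase; dsimp only; split_ifs <;> rfl
@[simp] lemma beginWritePhase_tag :
    (beginWritePhase P p s).state.tag = s.tag := by
  unfold beginWritePhase; dsimp only; split_ifs <;> rfl
@[simp] lemma beginWritePhase_rpPending :
    (beginWritePhase P p s).state.rpPending = s.rpPending := by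
  unfold beginWritePhase; dsimp only; split_ifs <;> rfl
@[simp] lemma beginWritePhase_readPending :
    (beginWritePhase P p s).state.readPending = s.readPending := by
  unfold beginWritePhase; dsimp only; split_ifs <;> rfl
@[simp] lemma beginWritePhase_writePending :
    (beginWritePhase P p s).state.writePending = s.writePending := by
  unfold beginWritePhase; dsimp only; split_ifs <;> rfl
@[simp] lemma beginWritePhase_wpPending : (beginWritePhase P p s).state.wpPending = true := rfl
@[simp] lemma beginWritePhase_rwCounter : (beginWritePhase P p s).state.rwCounter = 0 := rfl
@[simp] lemma beginWritePhase_rwBound :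
    (beginWritePhase P p s).state.rwBound = P.β * s.members.card := by
  unfold beginWritePhase; dsimp only; split_ifs <;> rfl
lemma beginWritePhase_out :
    ∃ x, (beginWritePhase P p s).out = [(.servers, .update x s.tag)] := by
  unfold beginWritePhase; dsimp only; split_ifs <;> exact ⟨_, rfl⟩
@[simp] lemma beginWritePhase_resp : (beginWritePhase P p s).resp = none := rfl

end Projections

/-- The entries `C` and, if `j`, the triples `K` of an echo message from `r` are taken over. -/
def State.absorb (s : State ID V) (r : ID) (C : Finset (Change ID)) (K : Finset (Entry ID V))
    (j : Bool) : State ID V :=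
  if j then (s.addChanges C).addKnown r K else s.addChanges C

section Absorb

variable (s : State ID V) (r : ID) (C : Finset (Change ID)) (K : Finset (Entry ID V)) (j : Bool)

@[simp] lemma absorb_changes : (s.absorb r C K j).changes = s.changes ∪ C := by
  unfold absorb; split_ifs <;> rfl
@[simp] lemma absorb_heard : (s.absorb r C K j).heard = s.heard := by
  unfold absorb; split_ifs <;> rfl
@[simp] lemma absorb_joinBound : (s.absorb r C K j).joinBound = s.joinBound := by
  unfold absorb; split_ifs <;> rfl
@[simp] lemma absorb_echoCounter : (s.absorb r C K j).echoCounter = s.echoCounter := by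
  unfold absorb; split_ifs <;> rfl
@[simp] lemma absorb_echoFromJoinedCounter :
    (s.absorb r C K j).echoFromJoinedCounter = s.echoFromJoinedCounter := by
  unfold absorb; split_ifs <;> rfl
@[simp] lemma absorb_isJoined : (s.absorb r C K j).isJoined = s.isJoined := by
  unfold absorb; split_ifs <;> rfl
@[simp] lemma absorb_tag : (s.absorb r C K j).tag = s.tag := by
  unfold absorb; split_ifs <;> rfl
@[simp] lemma absorb_rwBound : (s.absorb r C K j).rwBound = s.rwBound := by
  unfold absorb; split_ifs <;> rfl
@[simp] lemma absorb_rwCounter : (s.absorb r C K j).rwCounter = s.rwCounter := by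
  unfold absorb; split_ifs <;> rfl
@[simp] lemma absorb_rpPending : (s.absorb r C K j).rpPending = s.rpPending := by
  unfold absorb; split_ifs <;> rfl
@[simp] lemma absorb_wpPending : (s.absorb r C K j).wpPending = s.wpPending := by
  unfold absorb; split_ifs <;> rfl
@[simp] lemma absorb_readPending : (s.absorb r C K j).readPending = s.readPending := by
  unfold absorb; split_ifs <;> rfl
@[simp] lemma absorb_writePending : (s.absorb r C K j).writePending = s.writePending := by
  unfold absorb; split_ifs <;> rfl

end Absorb

/-- The echo by which a server answers the enter or enter-client message of `p`. -/
def echoMsg (P : Params ID) (p : ID) (C : Finset (Change ID)) (K : Finset (Entry ID V))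
    (j : Bool) : Payload ID V :=
  if P.isClient p then .enterClientEcho C K j p else .enterEcho C K j p

/-- The processing of an echo that is addressed to its recipient. -/
noncomputable def echoEffect (P : Params ID) (p : ID) (j : Bool) (s : State ID V) : Effect ID V :=
  { (if s.isJoined = false then s.joinProtocol P p j else { state := s } : Effect ID V) with
    state := (if s.isJoined = false then s.joinProtocol P p j
      else { state := s } : Effect ID V).state.setValueTimestamp P.f p }

/-- Clients and servers run the same join code on differently named messages. With this equation the
later arguments about joining need no distinction between the two. -/
lemma step_echoMsg {P : Params ID} {p r : ID} {C : Finset (Change ID)} {K : Finset (Entry ID V)}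
    {j : Bool} {s : State ID V} (hv : s.isValid r (echoMsg P p C K j) = true) :
    step P p (.receive r (echoMsg P p C K j)) s =
      echoEffect P p j ((s.note r (echoMsg P p C K j)).absorb r C K j) := by
  by_cases hp : P.isClient p = true
  · simp only [echoMsg, hp, if_true] at hv ⊢
    simp only [step, hp, if_true, clientStep, clientReceive, hv, and_self, echoEffect, absorb]
    split_ifs <;> rfl
  · simp only [echoMsg, hp] at hv ⊢
    simp only [Bool.false_eq_true, if_false] at hv ⊢
    simp only [step, hp, Bool.false_eq_true, if_false, serverStep, serverReceive, hv, and_true,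
      echoEffect, absorb, Bool.true_eq_false]
    split_ifs <;> rfl

lemma step_enterEcho_ne {P : Params ID} {p r q : ID} {C : Finset (Change ID)}
    {K : Finset (Entry ID V)} {j : Bool} {s : State ID V} (hp : P.isClient p = false)
    (hv : s.isValid r (.enterEcho C K j q) = true) (hq : p ≠ q) :
    step P p (.receive r (.enterEcho C K j q)) s =
      { state := ((s.note r (.enterEcho C K j q)).absorb r C K j).setValueTimestamp P.f p } := by
  simp only [step, hp, serverStep, serverReceive, hv, hq, and_false, absorb, Bool.true_eq_false,
    Bool.false_eq_true, if_false]

/-! ### The effect of one step on `Server_Changes` -/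

lemma changes_countEcho (P : Params ID) (j : Bool) (s : State ID V) :
    (s.countEcho P j).changes = s.changes := by
  unfold countEcho; dsimp only; split_ifs <;> rfl

lemma changes_joinProtocol (P : Params ID) (p : ID) (j : Bool) (s : State ID V) :
    (s.joinProtocol P p j).state.changes = s.changes ∨
      P.isClient p = false ∧
        (s.joinProtocol P p j).state.changes = s.changes ∪ {.join p} := by
  have h := changes_countEcho P j s
  unfold joinProtocol addChanges
  dsimp only
  split_ifs with h1 h2
  · exact .inl h
  · exact .inr ⟨by simpa using h2, by simp [h]⟩
  · exact .inl h

lemma changes_echoEffect (P : Params ID) (p : ID) (j : Bool) (s : State ID V) :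
    (echoEffect P p j s).state.changes = s.changes ∨
      P.isClient p = false ∧ (echoEffect P p j s).state.changes = s.changes ∪ {.join p} := by
  unfold echoEffect
  simp only [setValueTimestamp_changes]
  split_ifs
  · exact changes_joinProtocol P p j s
  · exact .inl rfl

/-- What the receipt of `m` from `r` tells. -/
def Payload.news (r : ID) : Payload ID V → Finset (Change ID)
  | .enter => {.enter r}
  | .joined => {.enter r, .join r}
  | .leave => {.leave r}
  | m => m.entries

/-- Messages with contents that the recipient takes over: those from servers to servers and to
clients, respectively. -/
def Payload.Informs (P : Params ID) (p : ID) : Payload ID V → Prop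
  | .serverInfo _ => P.isClient p = true
  | .enterClientEcho _ _ _ q => P.isClient p = true ∧ p = q
  | .enter | .joined | .leave | .enterEcho _ _ _ _ | .joinedEcho _ | .leaveEcho _ =>
    P.isClient p = false
  | _ => False

/-- The negation in the first alternative makes one case analysis serve in both directions: nothing
but `m.news r` and `join p` gets in (`mem_changes_step`), and a valid message with contents for `p`
gets in completely (`news_subset_step`). -/
lemma changes_step_receive (P : Params ID) (p r : ID) (m : Payload ID V) (s : State ID V) :
    ((step P p (.receive r m) s).state.changes = s.changes ∧
      ¬ (m.Informs P p ∧ s.isValid r m = true)) ∨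
    (step P p (.receive r m) s).state.changes = s.changes ∪ m.news r ∨
      P.isClient p = false ∧
        (step P p (.receive r m) s).state.changes = s.changes ∪ m.news r ∪ {.join p} := by
  by_cases hp : P.isClient p = true
  · by_cases hm : m.Informs P p ∧ s.isValid r m = true
    · obtain ⟨hm, hv⟩ := hm
      cases m with
      | enterClientEcho C K j q =>
        obtain ⟨-, rfl⟩ := hm
        have he : echoMsg P p C K j = .enterClientEcho C K j p := by simp [echoMsg, hp]
        rw [← he] at hv ⊢
        rw [step_echoMsg hv]
        refine .inr ?_
        rw [he]
        simpa [Payload.news, Payload.entries] using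
          changes_echoEffect P p j ((s.note r (.enterClientEcho C K j p)).absorb r C K j)
      | serverInfo C =>
        simp [step, hp, clientStep, clientReceive, addChanges, Payload.news, Payload.entries]
      | _ => simp [Payload.Informs, hp] at hm
    · refine .inl ⟨?_, hm⟩
      rw [not_and'] at hm
      cases m with
      | enterClientEcho C K j q =>
        have : ¬ (s.isValid r (.enterClientEcho C K j q) = true ∧ p = q) := fun h =>
          hm h.1 ⟨hp, h.2⟩
        simp [step, hp, clientStep, clientReceive, this]
      | serverInfo C => exact absurd hp (hm rfl)
      | reply K t q =>
        simp only [step, hp, if_true, clientStep, clientReceive]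
        split_ifs <;> simp
      | ack t q =>
        simp only [step, hp, if_true, clientStep, clientReceive]
        split_ifs <;> simp
      | _ => simp [step, hp, clientStep, clientReceive]
  · simp only [Bool.not_eq_true] at hp
    by_cases hv : s.isValid r m = true
    · have hv' : ¬ s.isValid r m = false := by simp [hv]
      cases m with
      | enterEcho C K j q =>
        refine .inr ?_
        by_cases hq : p = q
        · subst hq
          have he : echoMsg P p C K j = .enterEcho C K j p := by simp [echoMsg, hp]
          rw [← he] at hv ⊢
          rw [step_echoMsg hv, he]
          simpa [Payload.news, Payload.entries] using
            changes_echoEffect P p j ((s.note r (.enterEcho C K j p)).absorb r C K j)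
        · rw [step_enterEcho_ne hp hv hq]
          simp [Payload.news, Payload.entries]
      | update x t =>
        refine .inl ⟨?_, fun h => h.1.elim⟩
        simp only [step, hp, serverStep, serverReceive, hv', Bool.false_eq_true, if_false]
        split_ifs <;> simp
      | enterClient | query =>
        refine .inl ⟨?_, fun h => h.1.elim⟩
        simp only [step, hp, serverStep, serverReceive, hv', Bool.false_eq_true, if_false]
        split_ifs <;> simp
      | serverInfo C | enterClientEcho C K j q | reply | ack | updateEcho =>
        refine .inl ⟨?_, by simp [Payload.Informs, hp]⟩
        simp [step, hp, serverStep, serverReceive, hv']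
      | _ =>
        refine .inr (.inl ?_)
        simp [step, hp, serverStep, serverReceive, hv', addChanges, Payload.news, Payload.entries]
    · refine .inl ⟨?_, fun h => hv h.2⟩
      simp only [Bool.not_eq_true] at hv
      simp [step, hp, serverStep, serverReceive, hv]

lemma changes_step_of_not_receive (P : Params ID) (p : ID) (T : Trigger ID V) (s : State ID V)
    (hT : ∀ r m, T ≠ .receive r m) :
    (step P p T s).state.changes = s.changes ∨
    P.isClient p = false ∧ T = .enter ∧ (step P p T s).state.changes = s.changes ∪ {.enter p} ∨
    P.isClient p = false ∧ T = .leave ∧ (step P p T s).state.changes = s.changes ∪ {.leave p} := by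
  cases hp : P.isClient p <;> cases T <;>
    first
    | exact absurd rfl (hT _ _)
    | simp [step, hp, serverStep, clientStep, beginReadPhase, addChanges]

lemma changes_subset_step (P : Params ID) (p : ID) (T : Trigger ID V) (s : State ID V) :
    s.changes ⊆ (step P p T s).state.changes := by
  by_cases hT : ∃ r m, T = .receive r m
  · obtain ⟨r, m, rfl⟩ := hT
    rcases changes_step_receive P p r m s with ⟨h, -⟩ | h | ⟨-, h⟩ <;> rw [h]
    · exact Finset.subset_union_left
    · exact Finset.subset_union_left.trans Finset.subset_union_left
  · rcases changes_step_of_not_receive P p T s (by simpa using hT) with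
      h | ⟨-, -, h⟩ | ⟨-, -, h⟩ <;> rw [h]
    exacts [Finset.subset_union_left, Finset.subset_union_left]

lemma news_subset_step {P : Params ID} {p r : ID} {m : Payload ID V} {s : State ID V}
    (hm : m.Informs P p) (hv : s.isValid r m = true) :
    m.news r ⊆ (step P p (.receive r m) s).state.changes := by
  rcases changes_step_receive P p r m s with ⟨-, h⟩ | h | ⟨-, h⟩
  · exact absurd ⟨hm, hv⟩ h
  · rw [h]; exact Finset.subset_union_right
  · rw [h]; exact Finset.subset_union_right.trans Finset.subset_union_left

lemma mem_changes_step {P : Params ID} {p : ID} {T : Trigger ID V} {s : State ID V}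
    {c : Change ID} (hc : c ∈ (step P p T s).state.changes) :
    c ∈ s.changes ∨
      P.isClient p = false ∧ (T = .enter ∧ c = .enter p ∨ T = .leave ∧ c = .leave p ∨
        c = .join p) ∨
      ∃ r m, T = .receive r m ∧ c ∈ m.news r := by
  by_cases hT : ∃ r m, T = .receive r m
  · obtain ⟨r, m, rfl⟩ := hT
    rcases changes_step_receive P p r m s with ⟨h, -⟩ | h | ⟨h', h⟩ <;> rw [h] at hc
    · exact .inl hc
    · rcases Finset.mem_union.1 hc with hc | hc
      exacts [.inl hc, .inr (.inr ⟨r, m, rfl, hc⟩)]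
    · rcases Finset.mem_union.1 hc with hc | hc
      · rcases Finset.mem_union.1 hc with hc | hc
        exacts [.inl hc, .inr (.inr ⟨r, m, rfl, hc⟩)]
      · exact .inr (.inl ⟨h', .inr (.inr (Finset.mem_singleton.1 hc))⟩)
  · rcases changes_step_of_not_receive P p T s (by simpa using hT) with
      h | ⟨h1, h2, h⟩ | ⟨h1, h2, h⟩ <;> rw [h] at hc
    · exact .inl hc
    · rcases Finset.mem_union.1 hc with hc | hc
      exacts [.inl hc, .inr (.inl ⟨h1, .inl ⟨h2, Finset.mem_singleton.1 hc⟩⟩)]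
    · rcases Finset.mem_union.1 hc with hc | hc
      exacts [.inl hc, .inr (.inl ⟨h1, .inr (.inl ⟨h2, Finset.mem_singleton.1 hc⟩)⟩)]

/-! ### The record of received message types -/

lemma heard_joinProtocol (P : Params ID) (p : ID) (j : Bool) (s : State ID V) :
    (s.joinProtocol P p j).state.heard = s.heard := by
  unfold joinProtocol countEcho addChanges
  dsimp only
  split_ifs <;> rfl

lemma heard_echoEffect (P : Params ID) (p : ID) (j : Bool) (s : State ID V) :
    (echoEffect P p j s).state.heard = s.heard := by
  unfold echoEffect
  simp only [setValueTimestamp_heard]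
  split_ifs
  · exact heard_joinProtocol P p j s
  · rfl

lemma step_client_not_echo {P : Params ID} {p r q : ID} {C : Finset (Change ID)}
    {K : Finset (Entry ID V)} {j : Bool} {s : State ID V} (hp : P.isClient p = true)
    (h : ¬ (s.isValid r (.enterClientEcho C K j q) = true ∧ p = q)) :
    step P p (.receive r (.enterClientEcho C K j q)) s =
      { state := (s.note r (.enterClientEcho C K j q)).setValueTimestamp P.f p } := by
  simp only [step, hp, if_true, clientStep, clientReceive, h, if_false]

lemma step_server_invalid {P : Params ID} {p r : ID} {m : Payload ID V} {s : State ID V}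
    (hp : P.isClient p = false) (h : s.isValid r m = false) :
    step P p (.receive r m) s = { state := s.note r m } := by
  simp only [step, hp, serverStep, serverReceive, h, if_true, Bool.false_eq_true, if_false]

/-- A type is recorded even if the message is invalid or concerns another node. Therefore `heard` is
exactly the history of receipts (`mem_heard_iff`). -/
lemma heard_step_receive (P : Params ID) (p r : ID) (m : Payload ID V) (s : State ID V) :
    (step P p (.receive r m) s).state.heard = (s.note r m).heard := by
  by_cases hp : P.isClient p = true
  · cases m with
    | enterClientEcho C K j q =>
      by_cases h : s.isValid r (.enterClientEcho C K j q) = true ∧ p = q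
      · obtain ⟨hv, rfl⟩ := h
        have he : echoMsg P p C K j = .enterClientEcho C K j p := by simp [echoMsg, hp]
        rw [← he] at hv ⊢
        rw [step_echoMsg hv, heard_echoEffect, absorb_heard]
      · rw [step_client_not_echo hp h, setValueTimestamp_heard]
    | reply K t q =>
      simp only [step, hp, if_true, clientStep, clientReceive]
      split_ifs <;> simp
    | ack t q =>
      simp only [step, hp, if_true, clientStep, clientReceive]
      split_ifs <;> rfl
    | _ => simp [step, hp, clientStep, clientReceive, addChanges]
  · simp only [Bool.not_eq_true] at hp
    by_cases hv : s.isValid r m = true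
    · have hv' : ¬ s.isValid r m = false := by simp [hv]
      cases m with
      | enterEcho C K j q =>
        by_cases hq : p = q
        · subst hq
          have he : echoMsg P p C K j = .enterEcho C K j p := by simp [echoMsg, hp]
          rw [← he] at hv ⊢
          rw [step_echoMsg hv, heard_echoEffect, absorb_heard]
        · rw [step_enterEcho_ne hp hv hq, setValueTimestamp_heard, absorb_heard]
      | update x t =>
        simp only [step, hp, serverStep, serverReceive, hv, Bool.true_eq_false, Bool.false_eq_true,
            if_false]
        split_ifs <;> simp
      | enterClient | query =>
        simp only [step, hp, serverStep, serverReceive, hv, Bool.true_eq_false, Bool.false_eq_true,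
            if_false]
        split_ifs <;> simp
      | _ => simp [step, hp, serverStep, serverReceive, hv', addChanges]
    · simp only [Bool.not_eq_true] at hv
      rw [step_server_invalid hp hv]

lemma heard_step_of_not_receive (P : Params ID) (p : ID) (T : Trigger ID V) (s : State ID V)
    (hT : ∀ r m, T ≠ .receive r m) : (step P p T s).state.heard = s.heard := by
  cases hp : P.isClient p <;> cases T <;>
    first
    | exact absurd rfl (hT _ _)
    | simp [step, hp, serverStep, clientStep, beginReadPhase, addChanges]

/-- When a correct node sends a message: `s` and `s'` are its states before and after the step, and
`T` is the trigger. -/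
def Payload.Origin (P : Params ID) (p : ID) (T : Trigger ID V) (s s' : State ID V) :
    Payload ID V → Prop
  | .enter => P.isClient p = false ∧ T = .enter
  | .enterClient => T = .enter
  | .enterEcho C _ j q => P.isClient p = false ∧ T = .receive q .enter ∧ C = s'.changes ∧
      j = s.isJoined ∧ .enter q ∈ C
  | .enterClientEcho C _ j q => P.isClient p = false ∧ T = .receive q .enterClient ∧
      C = s'.changes ∧ j = s.isJoined
  | .serverInfo C => P.isClient p = false ∧ C = s'.changes
  | .joined => P.isClient p = false
  | .joinedEcho q => P.isClient p = false ∧ T = .receive q .joined ∧ .enter q ∈ s'.changes ∧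
      .join q ∈ s'.changes
  | .leave => P.isClient p = false ∧ T = .leave
  | .leaveEcho q => P.isClient p = false ∧ T = .receive q .leave ∧ .leave q ∈ s'.changes
  | .query rt => P.isClient p = true ∧ T.IsInvocation ∧ rt = s.tag + 1
  | .reply _ rt q => T = .receive q (.query rt)
  | .update _ wt => P.isClient p = true ∧ s.rpPending = true ∧ s'.rpPending = false ∧ wt = s.tag ∧
      ¬ T.IsInvocation
  | .ack wt q => ∃ x, T = .receive q (.update x wt)
  | .updateEcho _ => True

/-! ### Which messages are sent, and when -/

lemma joinProtocol_out (P : Params ID) (p : ID) (j : Bool) (s : State ID V) :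
    (s.joinProtocol P p j).out = [] ∨ P.isClient p = false ∧
      (s.joinProtocol P p j).out =
        [(.servers, .joined), (.clients, .serverInfo (s.joinProtocol P p j).state.changes)] := by
  unfold joinProtocol
  dsimp only
  split_ifs with h1 h2
  · exact .inl rfl
  · exact .inr ⟨by simpa using h2, rfl⟩
  · exact .inl rfl

lemma echoEffect_out (P : Params ID) (p : ID) (j : Bool) (s : State ID V) :
    (echoEffect P p j s).out = [] ∨ P.isClient p = false ∧
      (echoEffect P p j s).out =
        [(.servers, .joined), (.clients, .serverInfo (echoEffect P p j s).state.changes)] := by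
  unfold echoEffect
  simp only [setValueTimestamp_changes]
  split_ifs
  · exact joinProtocol_out P p j s
  · exact .inl rfl

/-- `s₁` arises from `s` by processing a reply with the triples `K` from `r`, up to what follows the
counting. -/
noncomputable def State.countReply (s : State ID V) (r : ID) (m : Payload ID V)
    (K : Finset (Entry ID V)) : State ID V :=
  { s.note r m with rwCounter := s.rwCounter + 1 }.addKnown r K

lemma step_reply {P : Params ID} {p r : ID} {K : Finset (Entry ID V)} {s : State ID V}
    (hp : P.isClient p = true) (hv : s.isValid r (.reply K s.tag p) = true)
    (hr : s.rpPending = true) :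
    step P p (.receive r (.reply K s.tag p)) s =
      if s.rwBound ≤ (s.rwCounter + 1 : ℕ) then
        beginWritePhase P p
          { (s.countReply r (.reply K s.tag p) K).setValueTimestamp P.f p with rpPending := false }
      else { state := s.countReply r (.reply K s.tag p) K } := by
  simp only [step, hp, if_true, clientStep, clientReceive, hv, note_rpPending, hr, note_tag,
    and_self, countReply, addKnown_rwBound, addKnown_rwCounter, note_rwCounter, note_rwBound]

lemma step_reply_ignored {P : Params ID} {p r q : ID} {K : Finset (Entry ID V)} {rt : ℕ}
    {s : State ID V} (hp : P.isClient p = true)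
    (h : ¬ (s.isValid r (.reply K rt q) = true ∧ s.rpPending = true ∧ rt = s.tag ∧ q = p)) :
    step P p (.receive r (.reply K rt q)) s = { state := s.note r (.reply K rt q) } := by
  simp only [step, hp, if_true, clientStep, clientReceive, note_rpPending, note_tag, h, if_false]

/-- Inverts the code: from a message in the output to what its correct sender was doing. Together
with authenticated senders this traces a receipt back to its cause (`receive_origin`). -/
lemma origin_of_mem_out {P : Params ID} {p : ID} {T : Trigger ID V} {s : State ID V}
    {x : Dest ID × Payload ID V} (hx : x ∈ (step P p T s).out) :
    x.2.Origin P p T s (step P p T s).state := by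
  have echo : ∀ r C (K : Finset (Entry ID V)) j, T = .receive r (echoMsg P p C K j) →
      s.isValid r (echoMsg P p C K j) = true → x.2.Origin P p T s (step P p T s).state := by
    rintro r C K j rfl hv
    rw [step_echoMsg hv] at hx ⊢
    rcases echoEffect_out P p j ((s.note r (echoMsg P p C K j)).absorb r C K j) with h | ⟨hp, h⟩
    · simp [h] at hx
    · rw [h] at hx
      simp only [List.mem_cons, List.not_mem_nil, or_false] at hx
      rcases hx with rfl | rfl
      exacts [hp, ⟨hp, rfl⟩]
  by_cases hp : P.isClient p = true
  · cases T with
    | receive r m =>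
      cases m with
      | enterClientEcho C K j q =>
        by_cases h : s.isValid r (.enterClientEcho C K j q) = true ∧ p = q
        · obtain ⟨hv, rfl⟩ := h
          have he : echoMsg P p C K j = .enterClientEcho C K j p := by simp [echoMsg, hp]
          exact echo r C K j (by rw [he]) (by rw [he]; exact hv)
        · rw [step_client_not_echo hp h] at hx
          simp at hx
      | reply K t q =>
        by_cases h : s.isValid r (.reply K t q) = true ∧ s.rpPending = true ∧ t = s.tag ∧ q = p
        · obtain ⟨hv, hr, rfl, rfl⟩ := h
          rw [step_reply hp hv hr] at hx ⊢
          split_ifs at hx ⊢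
          · obtain ⟨y, hy⟩ := beginWritePhase_out P q
              { (s.countReply r (.reply K s.tag q) K).setValueTimestamp P.f q with
                rpPending := false }
            rw [hy] at hx
            simp only [List.mem_cons, List.not_mem_nil, or_false] at hx
            subst hx
            exact ⟨hp, hr, beginWritePhase_rpPending _ _ _,
              by simp [countReply], by simp [Trigger.IsInvocation]⟩
          · simp at hx
        · rw [step_reply_ignored hp h] at hx
          simp at hx
      | ack t q =>
        simp only [step, hp, if_true, clientStep, clientReceive] at hx
        split_ifs at hx <;> simp at hx
      | _ => simp [step, hp, clientStep, clientReceive] at hx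
    | enter =>
      simp only [step, hp, if_true, clientStep, List.mem_cons, List.not_mem_nil, or_false] at hx
      subst hx
      simp [Payload.Origin]
    | read =>
      simp only [step, hp, if_true, clientStep, beginReadPhase, List.mem_cons, List.not_mem_nil,
        or_false] at hx
      subst hx
      simp [Payload.Origin, hp, Trigger.IsInvocation]
    | write v =>
      simp only [step, hp, if_true, clientStep, beginReadPhase, List.mem_cons, List.not_mem_nil,
        or_false] at hx
      subst hx
      simp [Payload.Origin, hp, Trigger.IsInvocation]
    | _ => simp [step, hp, clientStep] at hx
  · simp only [Bool.not_eq_true] at hp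
    cases T with
    | receive r m =>
      by_cases hv : s.isValid r m = true
      · have hv' : ¬ s.isValid r m = false := by simp [hv]
        cases m with
        | enterEcho C K j q =>
          by_cases hq : p = q
          · subst hq
            have he : echoMsg P p C K j = .enterEcho C K j p := by simp [echoMsg, hp]
            exact echo r C K j (by rw [he]) (by rw [he]; exact hv)
          · rw [step_enterEcho_ne hp hv hq] at hx
            simp at hx
        | update y t =>
          simp only [step, hp, serverStep, serverReceive, hv, Bool.true_eq_false, Bool.false_eq_true,
            if_false] at hx
          split_ifs at hx
          all_goals
            simp only [List.nil_append, List.cons_append, List.mem_cons, List.not_mem_nil,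
              or_false] at hx
          all_goals first
            | exact hx.elim
            | (rcases hx with rfl | rfl <;> simp [Payload.Origin])
        | enterClient | query =>
          simp only [step, hp, serverStep, serverReceive, hv, Bool.true_eq_false, Bool.false_eq_true,
            if_false]
            at hx ⊢
          split_ifs at hx ⊢
          · simp only [List.mem_cons, List.not_mem_nil, or_false] at hx
            subst hx
            simp [Payload.Origin, hp]
          · simp at hx
        | _ =>
          simp only [step, hp, serverStep, serverReceive, hv, Bool.true_eq_false, Bool.false_eq_true,
            if_false,
            List.mem_cons, List.not_mem_nil, or_false] at hx ⊢
          try (rcases hx with rfl | rfl)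
          all_goals first
            | exact hx.elim
            | simp [Payload.Origin, hp, addChanges]
      · simp only [Bool.not_eq_true] at hv
        rw [step_server_invalid hp hv] at hx
        simp at hx
    | enter | leave =>
      simp only [step, hp, serverStep, Bool.false_eq_true, if_false, List.mem_cons,
        List.not_mem_nil, or_false] at hx ⊢
      rcases hx with rfl | rfl <;> simp [Payload.Origin, hp]
    | _ => simp [step, hp, serverStep] at hx

/-- Messages of correct nodes report only what the sender knows. -/
lemma entries_subset_of_origin {P : Params ID} {p : ID} {T : Trigger ID V} {s s' : State ID V}
    {m : Payload ID V} (h : m.Origin P p T s s') : m.entries ⊆ s'.changes := by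
  cases m <;> simp only [Payload.Origin] at h <;> intro c hc <;>
    simp only [Payload.entries, Finset.notMem_empty] at hc
  case enterEcho => rw [← h.2.2.1]; exact hc
  case enterClientEcho => rw [← h.2.2.1]; exact hc
  case serverInfo => rw [← h.2]; exact hc
  case joinedEcho =>
    simp only [Finset.mem_insert, Finset.mem_singleton] at hc
    rcases hc with rfl | rfl
    exacts [h.2.2.1, h.2.2.2]
  case leaveEcho => rw [Finset.mem_singleton.1 hc]; exact h.2.2

/-! ### Answers that the code is bound to give -/

section Sends

variable {P : Params ID} {p r : ID} {s : State ID V}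

lemma server_enter_out (hp : P.isClient p = false) :
    (.servers, .enter) ∈ (step P p .enter s).out ∧
    (.clients, .serverInfo (step P p .enter s).state.changes) ∈ (step P p .enter s).out ∧
    .enter p ∈ (step P p .enter s).state.changes := by
  simp [step, hp, serverStep, addChanges]

lemma server_leave_out (hp : P.isClient p = false) :
    (.servers, .leave) ∈ (step P p .leave s).out ∧
    (.clients, .serverInfo (step P p .leave s).state.changes) ∈ (step P p .leave s).out ∧
    .leave p ∈ (step P p .leave s).state.changes := by
  simp [step, hp, serverStep, addChanges]

lemma server_receive_enter_out (hp : P.isClient p = false) (hv : s.isValid r .enter = true) :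
    (∃ C K, (.servers, .enterEcho C K s.isJoined r) ∈ (step P p (.receive r .enter) s).out) ∧
    (.clients, .serverInfo (step P p (.receive r .enter) s).state.changes) ∈
      (step P p (.receive r .enter) s).out := by
  simp [step, hp, serverStep, serverReceive, hv, addChanges]

lemma server_receive_leave_out (hp : P.isClient p = false) (hv : s.isValid r .leave = true) :
    (.servers, .leaveEcho r) ∈ (step P p (.receive r .leave) s).out ∧
    (.clients, .serverInfo (step P p (.receive r .leave) s).state.changes) ∈
      (step P p (.receive r .leave) s).out := by
  simp [step, hp, serverStep, serverReceive, hv, addChanges]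

lemma server_receive_enterClient_out (hp : P.isClient p = false) (hr : P.isClient r = true) :
    ∃ C K, (.clients, .enterClientEcho C K s.isJoined r) ∈
      (step P p (.receive r .enterClient) s).out := by
  simp [step, hp, serverStep, serverReceive, hr, isValid, Payload.label]

lemma server_receive_query_out {rt : ℕ} (hp : P.isClient p = false) (hr : P.isClient r = true)
    (hj : s.isJoined = true) :
    ∃ K, (.clients, .reply K rt r) ∈ (step P p (.receive r (.query rt)) s).out := by
  simp [step, hp, serverStep, serverReceive, hr, isValid, Payload.label, hj]

lemma server_receive_update_out {x : Entry ID V} {wt : ℕ} (hp : P.isClient p = false)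
    (hr : P.isClient r = true) (hj : s.isJoined = true) :
    (.clients, .ack wt r) ∈ (step P p (.receive r (.update x wt)) s).out := by
  simp only [step, hp, serverStep, serverReceive, hr, isValid, Payload.label, Bool.false_eq_true,
    if_false, if_true, Bool.true_eq_false]
  split_ifs with h1 h2 <;> simp_all

lemma client_enter_out (hp : P.isClient p = true) :
    (.servers, .enterClient) ∈ (step P p .enter s).out := by
  simp [step, hp, clientStep]

end Sends

/-! ### The join protocol -/

/-- The effect of counting an echo with joined-flag `j` on the counters of the join protocol. -/
def CountsEcho (P : Params ID) (j : Bool) (C : Finset (Change ID)) (s s' : State ID V) : Prop :=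
  s'.echoCounter = s.echoCounter + 1 ∧
  (if j = true ∧ s.joinBound = 0 then
    s'.echoFromJoinedCounter = s.echoFromJoinedCounter + 1 ∧
      s'.joinBound =
        if P.f < s.echoFromJoinedCounter + 1 then P.γ * (presentIn C).card else 0
  else s'.echoFromJoinedCounter = s.echoFromJoinedCounter ∧ s'.joinBound = s.joinBound) ∧
  (s'.isJoined = true ↔ s'.joinBound ≤ s'.echoCounter ∧ 0 < s'.joinBound)

lemma countsEcho_joinProtocol (P : Params ID) (p : ID) (j : Bool) (s : State ID V)
    (hs : s.isJoined = false) : CountsEcho P j s.changes s (s.joinProtocol P p j).state := by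
  have key : ∀ s₁ : State ID V, s₁ = s.countEcho P j →
      (s.joinProtocol P p j).state.echoCounter = s₁.echoCounter ∧
      (s.joinProtocol P p j).state.echoFromJoinedCounter = s₁.echoFromJoinedCounter ∧
      (s.joinProtocol P p j).state.joinBound = s₁.joinBound ∧
      ((s.joinProtocol P p j).state.isJoined = true ↔
        s₁.joinBound ≤ s₁.echoCounter ∧ 0 < s₁.joinBound ∨ s₁.isJoined = true) := by
    rintro s₁ rfl
    unfold joinProtocol addChanges
    dsimp only
    split_ifs with h1 h2 <;> simp [h1]
  obtain ⟨h1, h2, h3, h4⟩ := key _ rfl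
  have h5 : (s.countEcho P j).isJoined = false := by
    rw [← hs]; unfold countEcho; dsimp only; split_ifs <;> rfl
  refine ⟨?_, ?_, ?_⟩
  · rw [h1]; unfold countEcho; dsimp only; split_ifs <;> rfl
  · rw [h2, h3]; unfold countEcho; dsimp only
    split_ifs with h h' <;> simp_all [State.present_eq]
  · rw [h4, h1, h3, h5]; simp

/-- `Present` is evaluated after the entries of the echo have been merged, hence the set `s.changes
∪ C`. -/
lemma countsEcho_step {P : Params ID} {p r : ID} {C : Finset (Change ID)}
    {K : Finset (Entry ID V)} {j : Bool} {s : State ID V}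
    (hv : s.isValid r (echoMsg P p C K j) = true) (hs : s.isJoined = false) :
    CountsEcho P j (s.changes ∪ C) s (step P p (.receive r (echoMsg P p C K j)) s).state := by
  rw [step_echoMsg hv]
  have := countsEcho_joinProtocol P p j ((s.note r (echoMsg P p C K j)).absorb r C K j)
    (by simpa using hs)
  simpa [CountsEcho, echoEffect, hs] using this

/-- The step is the processing of an echo that counts for the join protocol. -/
def IsEcho (P : Params ID) (p : ID) (T : Trigger ID V) (s : State ID V) (r : ID)
    (C : Finset (Change ID)) (j : Bool) : Prop :=
  ∃ K, T = .receive r (echoMsg P p C K j) ∧ s.isValid r (echoMsg P p C K j) = true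

lemma step_not_echo {P : Params ID} {p : ID} {T : Trigger ID V} {s : State ID V}
    (h : ∀ r C j, ¬ IsEcho P p T s r C j) :
    (step P p T s).state.echoCounter = s.echoCounter ∧
    (step P p T s).state.echoFromJoinedCounter = s.echoFromJoinedCounter ∧
    (step P p T s).state.joinBound = s.joinBound ∧
    (step P p T s).state.isJoined = s.isJoined ∧ (step P p T s).resp ≠ some .joined := by
  have h' : ∀ r C (K : Finset (Entry ID V)) j, T = .receive r (echoMsg P p C K j) →
      ¬ s.isValid r (echoMsg P p C K j) = true := fun r C K j h1 h2 => h r C j ⟨K, h1, h2⟩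
  by_cases hp : P.isClient p = true
  · cases T with
    | receive r m =>
      cases m with
      | enterClientEcho C K j q =>
        have : ¬ (s.isValid r (.enterClientEcho C K j q) = true ∧ p = q) := by
          rintro ⟨hv, rfl⟩
          have he : echoMsg P p C K j = .enterClientEcho C K j p := by simp [echoMsg, hp]
          exact h' r C K j (by rw [he]) (by rw [he]; exact hv)
        simp [step_client_not_echo hp this]
      | reply K t q =>
        by_cases h : s.isValid r (.reply K t q) = true ∧ s.rpPending = true ∧ t = s.tag ∧ q = p
        · obtain ⟨hv, hr, rfl, rfl⟩ := h
          rw [step_reply hp hv hr]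
          split_ifs <;> simp [countReply]
        · simp [step_reply_ignored hp h]
      | ack t q =>
        simp only [step, hp, if_true, clientStep, clientReceive]
        split_ifs <;> simp
      | _ => simp [step, hp, clientStep, clientReceive, addChanges]
    | _ => simp [step, hp, clientStep, beginReadPhase]
  · simp only [Bool.not_eq_true] at hp
    cases T with
    | receive r m =>
      by_cases hv : s.isValid r m = true
      · cases m with
        | enterEcho C K j q =>
          by_cases hq : p = q
          · subst hq
            have he : echoMsg P p C K j = .enterEcho C K j p := by simp [echoMsg, hp]
            exact absurd (by rw [he]; exact hv) (h' r C K j (by rw [he]))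
          · simp [step_enterEcho_ne hp hv hq]
        | update y t =>
          simp only [step, hp, serverStep, serverReceive, hv, Bool.true_eq_false,
            Bool.false_eq_true, if_false]
          split_ifs <;> simp
        | enterClient | query =>
          simp only [step, hp, serverStep, serverReceive, hv, Bool.true_eq_false,
            Bool.false_eq_true, if_false]
          split_ifs <;> simp
        | _ => simp [step, hp, serverStep, serverReceive, hv, addChanges]
      · simp only [Bool.not_eq_true] at hv
        simp [step_server_invalid hp hv]
    | _ => simp [step, hp, serverStep, addChanges]

lemma echoEffect_of_joined {P : Params ID} {p : ID} {j : Bool} {s : State ID V}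
    (hs : s.isJoined = true) :
    echoEffect P p j s = { state := s.setValueTimestamp P.f p } := by
  simp [echoEffect, hs]

/-- The second half excludes a late Joined response in the middle of an operation. -/
lemma isJoined_step_of_isJoined {P : Params ID} {p : ID} {T : Trigger ID V} {s : State ID V}
    (hs : s.isJoined = true) :
    (step P p T s).state.isJoined = true ∧ (step P p T s).resp ≠ some .joined := by
  by_cases h : ∃ r C j, IsEcho P p T s r C j
  · obtain ⟨r, C, j, K, rfl, hv⟩ := h
    rw [step_echoMsg hv, echoEffect_of_joined (by simpa using hs)]
    simpa using hs
  · push Not at h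
    obtain ⟨-, -, -, h1, h2⟩ := step_not_echo h
    exact ⟨h1.trans hs, h2⟩

lemma joinProtocol_resp (P : Params ID) (p : ID) (j : Bool) (s : State ID V) :
    (s.joinProtocol P p j).resp = none ∨
      (s.joinProtocol P p j).resp = some .joined ∧
        (s.joinProtocol P p j).state.isJoined = true := by
  unfold joinProtocol addChanges
  dsimp only
  split_ifs <;> simp

lemma isJoined_of_resp {P : Params ID} {p : ID} {T : Trigger ID V} {s : State ID V}
    (h : (step P p T s).resp = some .joined) : (step P p T s).state.isJoined = true := by
  by_cases he : ∃ r C j, IsEcho P p T s r C j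
  · obtain ⟨r, C, j, K, rfl, hv⟩ := he
    rw [step_echoMsg hv] at h ⊢
    unfold echoEffect at h ⊢
    simp only [setValueTimestamp_isJoined] at h ⊢
    split_ifs at h ⊢
    rcases joinProtocol_resp P p j
      ((s.note r (echoMsg P p C K j)).absorb r C K j) with h' | h'
    · rw [h'] at h; simp at h
    · exact h'.2
  · push Not at he
    exact absurd h (step_not_echo he).2.2.2.2

/-! ### Read and write operations at a client -/

/-- The two states agree in what concerns the pending operation, except for the phase. -/
structure SameOp (s s' : State ID V) : Prop where
  tag : s'.tag = s.tag
  read : s'.readPending = s.readPending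
  write : s'.writePending = s.writePending

/-- The two states agree in what concerns the pending operation. -/
structure SamePhase (s s' : State ID V) : Prop extends SameOp s s' where
  rp : s'.rpPending = s.rpPending
  wp : s'.wpPending = s.wpPending
  rwBound : s'.rwBound = s.rwBound
  rwCounter : s'.rwCounter = s.rwCounter

/-- The step counts a reply from `r`. -/
def CountsReply (p : ID) (T : Trigger ID V) (s : State ID V) (r : ID) : Prop :=
  ∃ K, T = .receive r (.reply K s.tag p) ∧ s.isValid r (.reply K s.tag p : Payload ID V) = true ∧
    s.rpPending = true

/-- The step counts an ack from `r`. -/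
def CountsAck (p : ID) (T : Trigger ID V) (s : State ID V) (r : ID) : Prop :=
  T = .receive r (.ack s.tag p) ∧ s.isValid r (.ack s.tag p : Payload ID V) = true ∧
    s.wpPending = true

section Client

variable {P : Params ID} {p r : ID} {T : Trigger ID V} {s : State ID V}

lemma client_invocation (hp : P.isClient p = true) (hT : T.IsInvocation) :
    (step P p T s).state.tag = s.tag + 1 ∧
    (step P p T s).state.rpPending = true ∧
    (step P p T s).state.wpPending = s.wpPending ∧
    (step P p T s).state.rwCounter = 0 ∧
    (step P p T s).state.rwBound = P.β * s.members.card ∧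
    (.servers, .query (s.tag + 1)) ∈ (step P p T s).out ∧
    (T = .read ∧ (step P p T s).state.readPending = true ∧
        (step P p T s).state.writePending = s.writePending ∨
      (∃ v, T = .write v) ∧ (step P p T s).state.readPending = s.readPending ∧
        (step P p T s).state.writePending = true) := by
  rcases hT with rfl | ⟨v, rfl⟩ <;>
    simp [step, hp, clientStep, beginReadPhase, State.members]

lemma client_countsReply (hp : P.isClient p = true) (h : CountsReply p T s r) :
    SameOp s (step P p T s).state ∧ (step P p T s).resp = none ∧
    (if s.rwBound ≤ (s.rwCounter + 1 : ℕ) then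
      (step P p T s).state.rpPending = false ∧ (step P p T s).state.wpPending = true ∧
      (step P p T s).state.rwCounter = 0 ∧
      (step P p T s).state.rwBound = P.β * s.members.card ∧
      ∃ x, (.servers, .update x s.tag) ∈ (step P p T s).out
    else
      (step P p T s).state.rpPending = true ∧
      (step P p T s).state.wpPending = s.wpPending ∧
      (step P p T s).state.rwCounter = s.rwCounter + 1 ∧
      (step P p T s).state.rwBound = s.rwBound) := by
  obtain ⟨K, rfl, hv, hr⟩ := h
  rw [step_reply hp hv hr]
  split_ifs with hb
  · obtain ⟨y, hy⟩ := beginWritePhase_out P p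
      { (s.countReply r (.reply K s.tag p) K).setValueTimestamp P.f p with rpPending := false }
    refine ⟨⟨by simp [countReply], by simp [countReply], by simp [countReply]⟩, rfl, by simp,
      by simp, by simp, ?_, y, ?_⟩
    · simp [State.members, countReply]
    · rw [hy]; simp [countReply]
  · refine ⟨⟨by simp [countReply], by simp [countReply], by simp [countReply]⟩, rfl, ?_, ?_, ?_, ?_⟩
    all_goals simp [countReply, hr]

lemma client_countsAck (hp : P.isClient p = true) (h : CountsAck p T s r) :
    (step P p T s).state.tag = s.tag ∧ (step P p T s).state.rpPending = s.rpPending ∧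
    (if s.rwBound ≤ (s.rwCounter + 1 : ℕ) then
      (step P p T s).state.wpPending = false ∧ (step P p T s).state.readPending = false ∧
      (step P p T s).state.writePending = false ∧
      (step P p T s).resp = (if s.readPending then some (.returned s.temp)
        else if s.writePending then some .acked else none)
    else
      SameOp s (step P p T s).state ∧ (step P p T s).resp = none ∧
      (step P p T s).state.wpPending = true ∧
      (step P p T s).state.rwCounter = s.rwCounter + 1 ∧
      (step P p T s).state.rwBound = s.rwBound) := by
  obtain ⟨rfl, hv, hr⟩ := h
  simp only [step, hp, if_true, clientStep, clientReceive, hv, note_wpPending, hr, note_tag,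
    and_self, note_rwBound, note_rwCounter]
  split_ifs with hb
  all_goals simp_all
  exact ⟨by simp, by simp, by simp⟩

/-- Only invocations, counted replies and counted acks touch the variables of an operation. Joined
remains a possible response because the join protocol runs independently of them. -/
lemma client_other (hp : P.isClient p = true) (hT : ¬ T.IsInvocation)
    (h1 : ∀ r, ¬ CountsReply p T s r) (h2 : ∀ r, ¬ CountsAck p T s r) :
    SamePhase s (step P p T s).state ∧
      ((step P p T s).resp = none ∨ (step P p T s).resp = some .joined) := by
  by_cases h : ∃ r C j, IsEcho P p T s r C j
  · obtain ⟨r, C, j, K, rfl, hv⟩ := h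
    rw [step_echoMsg hv]
    have key : ∀ s₁ : State ID V, SamePhase s₁ (s₁.joinProtocol P p j).state := by
      intro s₁
      unfold joinProtocol countEcho addChanges
      dsimp only
      split_ifs <;> exact ⟨⟨rfl, rfl, rfl⟩, rfl, rfl, rfl, rfl⟩
    have := key ((s.note r (echoMsg P p C K j)).absorb r C K j)
    unfold echoEffect
    constructor
    · split_ifs
      · exact ⟨⟨by simpa using this.tag, by simpa using this.read, by simpa using this.write⟩,
          by simpa using this.rp, by simpa using this.wp, by simpa using this.rwBound,
          by simpa using this.rwCounter⟩
      · constructor <;> simp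
        constructor <;> simp
    · dsimp only
      split_ifs
      · rcases joinProtocol_resp P p j ((s.note r (echoMsg P p C K j)).absorb r C K j) with h | h
        exacts [.inl h, .inr h.1]
      · exact .inl rfl
  · have refl : ∀ s₁ : State ID V, s₁.tag = s.tag → s₁.readPending = s.readPending →
        s₁.writePending = s.writePending → s₁.rpPending = s.rpPending →
        s₁.wpPending = s.wpPending → s₁.rwBound = s.rwBound → s₁.rwCounter = s.rwCounter →
        SamePhase s s₁ := fun s₁ h1 h2 h3 h4 h5 h6 h7 => ⟨⟨h1, h2, h3⟩, h4, h5, h6, h7⟩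
    cases T with
    | receive r m =>
      cases m with
      | enterClientEcho C K j q =>
        have : ¬ (s.isValid r (.enterClientEcho C K j q) = true ∧ p = q) := by
          rintro ⟨hv, rfl⟩
          have he : echoMsg P p C K j = .enterClientEcho C K j p := by simp [echoMsg, hp]
          exact h ⟨r, C, j, K, by rw [he], by rw [he]; exact hv⟩
        rw [step_client_not_echo hp this]
        exact ⟨by apply refl <;> simp, .inl rfl⟩
      | reply K t q =>
        rw [step_reply_ignored hp]
        · exact ⟨by apply refl <;> simp, .inl rfl⟩
        · rintro ⟨hv, hr, rfl, rfl⟩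
          exact h1 r ⟨K, rfl, hv, hr⟩
      | ack t q =>
        have : ¬ (s.isValid r (.ack t q : Payload ID V) = true ∧ s.wpPending = true ∧ t = s.tag ∧
            q = p) := by
          rintro ⟨hv, hr, rfl, rfl⟩
          exact h2 r ⟨rfl, hv, hr⟩
        simp only [step, hp, if_true, clientStep, clientReceive, note_wpPending, note_tag, this,
          if_false]
        exact ⟨by apply refl <;> simp, .inl trivial⟩
      | _ =>
        simp only [step, hp, if_true, clientStep, clientReceive]
        exact ⟨by apply refl <;> simp [addChanges], .inl trivial⟩
    | read => exact absurd (.inl rfl) hT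
    | write v => exact absurd (.inr ⟨v, rfl⟩) hT
    | _ =>
      simp only [step, hp, if_true, clientStep]
      exact ⟨by apply refl <;> simp, .inl trivial⟩

end Client

/-! ### Presence, delivery and the course of a single view -/

namespace Run

/-- `p` is in the system initially or enters before time `b`. -/
def InBefore (R : Run ID V) (p : ID) (b : ℝ) : Prop :=
  R.Initially p ∨ ∃ u < b, R.Occurs p .enter u

/-- `p` leaves by time `t`. -/
def LeftBy (R : Run ID V) (p : ID) (t : ℝ) : Prop := ∃ u ≤ t, R.Occurs p .leave u

lemma InBefore.enteredBy {R : Run ID V} {p : ID} {b : ℝ} (h : R.InBefore p b) :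
    R.EnteredBy p b :=
  h.imp_right fun ⟨u, hu, h⟩ => ⟨u, hu.le, h⟩

lemma EnteredBy.mono {R : Run ID V} {p : ID} {t u : ℝ} (h : R.EnteredBy p t) (htu : t ≤ u) :
    R.EnteredBy p u :=
  h.imp_right fun ⟨v, hv, h⟩ => ⟨v, hv.trans htu, h⟩

lemma LeftBy.mono {R : Run ID V} {p : ID} {t u : ℝ} (h : R.LeftBy p t) (htu : t ≤ u) :
    R.LeftBy p u :=
  let ⟨v, hv, h⟩ := h
  ⟨v, hv.trans htu, h⟩

lemma HasStep.of_le {R : Run ID V} {p : ID} {i k : ℕ} (h : R.HasStep p k) (hik : i ≤ k) :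
    R.HasStep p i :=
  lt_of_le_of_lt (by exact_mod_cast hik) h

end Run

section Execution

variable {P : Params ID} {D α : ℝ} {NSmin : ℕ} {R : Run ID V} (hR : IsExecution P D α NSmin R)
include hR

open Run

lemma time_le {p : ID} {i k : ℕ} (h : R.HasStep p k) (hik : i ≤ k) :
    (R.view p).time i ≤ (R.view p).time k := (hR.timedView p).mono i k hik h

lemma lt_of_time_lt {p : ID} {i k : ℕ} (h : R.HasStep p i)
    (ht : (R.view p).time i < (R.view p).time k) : i < k := by
  by_contra hc
  exact absurd (time_le hR h (not_lt.1 hc)) (not_le.2 ht)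

lemma occurs_nonneg {p : ID} {T : Trigger ID V} {u : ℝ} (h : R.Occurs p T u) : 0 ≤ u := by
  obtain ⟨k, hk, -, rfl⟩ := h
  exact (hR.timedView p).nonneg k hk

lemma initially_server {p : ID} (hp : P.isClient p = false) : R.Initially p ↔ p ∈ R.S₀ := by
  refine ⟨fun h => h.resolve_right fun h' => ?_, .inl⟩
  rw [hR.clients_initially p h'] at hp
  simp at hp

lemma occurs_enter_iff {p : ID} {k : ℕ} (hk : R.HasStep p k) :
    (R.view p).trigger k = .enter ↔ k = 0 ∧ ¬ R.Initially p := (hR.timedView p).enter k hk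

lemma enteredBy_time {p : ID} {k : ℕ} (hk : R.HasStep p k) :
    R.EnteredBy p ((R.view p).time k) := by
  by_cases h : R.Initially p
  · exact .inl h
  · exact .inr ⟨(R.view p).time 0, time_le hR hk (Nat.zero_le k), 0, hk.of_le (Nat.zero_le k),
      (occurs_enter_iff hR (hk.of_le (Nat.zero_le k))).2 ⟨rfl, h⟩, rfl⟩

lemma le_of_halt {p : ID} {j k : ℕ} (hk : R.HasStep p k) (hj : R.HasStep p j)
    (hT : (R.view p).trigger j = .leave ∨ (R.view p).trigger j = .crash) : k ≤ j := by
  have h := (hR.timedView p).halt j hj hT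
  rw [HasStep, h] at hk
  exact Nat.lt_succ_iff.1 (by exact_mod_cast hk)

lemma not_leave_of_step {p : ID} {k : ℕ} (hk : R.HasStep p k) {u : ℝ}
    (hu : u < (R.view p).time k) : ¬ R.LeftBy p u := by
  rintro ⟨v, hv, j, hj, hT, rfl⟩
  exact absurd (time_le hR hj (le_of_halt hR hk hj (.inl hT))) (by linarith)

lemma not_crash_of_step {p : ID} {k : ℕ} (hk : R.HasStep p k) {u : ℝ}
    (hu : u < (R.view p).time k) : ¬ R.Occurs p .crash u := by
  rintro ⟨j, hj, hT, rfl⟩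
  exact absurd (time_le hR hj (le_of_halt hR hk hj (.inr hT))) (by linarith)

lemma activeAt_of_step {p : ID} {k : ℕ} (hk : R.HasStep p k) {u : ℝ} (he : R.EnteredBy p u)
    (hu : u < (R.view p).time k) : R.ActiveAt p u :=
  ⟨⟨he, not_leave_of_step hR hk hu⟩, fun ⟨_, hv, h⟩ =>
    not_crash_of_step hR hk (hv.trans hu) h⟩

lemma activeAt_server {p : ID} (hp : P.isClient p = false) {u : ℝ} (he : R.EnteredBy p u)
    (hl : ¬ R.LeftBy p u) : R.ActiveAt p u :=
  ⟨⟨he, hl⟩, fun ⟨_, _, k, hk, hT, _⟩ => ((hR.timedView p).server hp k hk).1 hT⟩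

lemma state_succ {p : ID} (hp : p ∉ R.F) {k : ℕ} (hk : R.HasStep p k) :
    (R.view p).state (k + 1) =
      (step P p ((R.view p).trigger k) ((R.view p).state k)).state := by
  rw [← hR.valid p hp k hk]

lemma out_eq {p : ID} (hp : p ∉ R.F) {k : ℕ} (hk : R.HasStep p k) :
    (R.view p).out k = (step P p ((R.view p).trigger k) ((R.view p).state k)).out := by
  rw [← hR.valid p hp k hk]

lemma resp_eq {p : ID} (hp : p ∉ R.F) {k : ℕ} (hk : R.HasStep p k) :
    (R.view p).resp k = (step P p ((R.view p).trigger k) ((R.view p).state k)).resp := by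
  rw [← hR.valid p hp k hk]

lemma client_correct {p : ID} (hp : P.isClient p = true) : p ∉ R.F := fun h => by
  rw [hR.byzantine_server p h] at hp
  simp at hp

lemma receive_sent {q r : ID} {k : ℕ} {m : Payload ID V} (hk : R.HasStep q k)
    (hT : (R.view q).trigger k = .receive r m) :
    ∃ i d, R.HasStep r i ∧ (d, m) ∈ (R.view r).out i ∧ d.Admits P q ∧
      (R.view r).time i < (R.view q).time k ∧ (R.view q).time k ≤ (R.view r).time i + D := by
  obtain ⟨h1, ⟨d, h2, h3⟩, h4, h5⟩ := hR.sent q k r m hk hT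
  exact ⟨_, d, h1, List.mem_of_getElem? h2, h3, h4, h5⟩

lemma receive_origin {q r : ID} {k : ℕ} {m : Payload ID V} (hr : r ∉ R.F) (hk : R.HasStep q k)
    (hT : (R.view q).trigger k = .receive r m) :
    ∃ i, R.HasStep r i ∧
      m.Origin P r ((R.view r).trigger i) ((R.view r).state i) ((R.view r).state (i + 1)) ∧
      (R.view r).time i < (R.view q).time k ∧ (R.view q).time k ≤ (R.view r).time i + D := by
  obtain ⟨i, d, h1, h2, -, h3, h4⟩ := receive_sent hR hk hT
  refine ⟨i, h1, ?_, h3, h4⟩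
  rw [out_eq hR hr h1] at h2
  rw [state_succ hR hr h1]
  exact origin_of_mem_out h2

lemma exists_receive {p q : ID} {i : ℕ} {d : Dest ID} {m : Payload ID V} (hi : R.HasStep p i)
    (hm : (d, m) ∈ (R.view p).out i) (hq : d.BroadcastTo P q)
    (ha : ∀ t, (R.view p).time i ≤ t → t ≤ (R.view p).time i + D → R.ActiveAt q t) :
    ∃ k, R.HasStep q k ∧ (R.view q).trigger k = .receive p m ∧
      (R.view p).time i < (R.view q).time k ∧ (R.view q).time k ≤ (R.view p).time i + D := by
  obtain ⟨j, hj⟩ := List.mem_iff_getElem?.1 hm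
  obtain ⟨k, h1, h2, h3⟩ := hR.delivered p i j d m hi hj q hq ha
  have h4 := hR.sent q k p m h1 h2
  rw [h3] at h4
  exact ⟨k, h1, h2, h4.2.2.1, h4.2.2.2⟩

/-- The order of receipts is strict in the source index, so no sent message accounts for two
receipts. -/
lemma eq_of_source {q r : ID} {k l : ℕ} {m m' : Payload ID V} (hk : R.HasStep q k)
    (hl : R.HasStep q l) (hT : (R.view q).trigger k = .receive r m)
    (hT' : (R.view q).trigger l = .receive r m') (h : R.source q k = R.source q l) : k = l := by
  rcases lt_trichotomy k l with hkl | hkl | hkl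
  · exact absurd (hR.fifo q k l r m m' hkl hl hT hT') (by rw [h]; exact lt_irrefl _)
  · exact hkl
  · exact absurd (hR.fifo q l k r m' m hkl hk hT' hT) (by rw [h]; exact lt_irrefl _)

/-- A correct node announces its entering only once. -/
lemma receive_enter_unique {q r : ID} {k l : ℕ} (hr : r ∉ R.F) {m : Payload ID V}
    (hm : m = .enter ∨ m = .enterClient) (hk : R.HasStep q k) (hl : R.HasStep q l)
    (hT : (R.view q).trigger k = .receive r m) (hT' : (R.view q).trigger l = .receive r m) :
    k = l := by
  -- A node enters only in its step `0`, and the announcement is the first message of that step, so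
  -- every receipt has source `(0, 0)`.
  have key : ∀ k, R.HasStep q k → (R.view q).trigger k = .receive r m →
      R.source q k = (0, 0) := by
    intro k hk hT
    obtain ⟨h1, ⟨d, h2, -⟩, -⟩ := hR.sent q k r m hk hT
    set i := (R.source q k).1 with hi
    have h3 := List.mem_of_getElem? h2
    rw [out_eq hR hr h1] at h2 h3
    have h4 : (R.view r).trigger i = .enter := by
      have := origin_of_mem_out h3
      rcases hm with rfl | rfl
      exacts [this.2, this]
    obtain ⟨h5, -⟩ := (occurs_enter_iff hR h1).1 h4
    refine Prod.ext h5 ?_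
    rw [h4] at h2
    generalize (R.source q k).2 = j at h2
    cases hc : P.isClient r <;> rcases hm with rfl | rfl <;>
      simp only [step, hc, Bool.false_eq_true, if_false, if_true, serverStep, clientStep] at h2 <;>
      rcases j with _ | _ | j <;> simp at h2 ⊢
  exact eq_of_source hR hk hl hT hT' ((key k hk hT).trans (key l hl hT').symm)

/-! ### Monotonicity along a view -/

lemma changes_mono {p : ID} (hp : p ∉ R.F) {i k : ℕ} (hik : i ≤ k)
    (hk : (k : ℕ∞) ≤ (R.view p).len) :
    ((R.view p).state i).changes ⊆ ((R.view p).state k).changes := by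
  induction k, hik using Nat.le_induction with
  | base => exact subset_rfl
  | succ k _ ih =>
    have hk' : R.HasStep p k := lt_of_lt_of_le (by exact_mod_cast Nat.lt_succ_self k) hk
    rw [state_succ hR hp hk']
    exact (ih hk'.le).trans (changes_subset_step _ _ _ _)

lemma isJoined_mono {p : ID} (hp : p ∉ R.F) {i k : ℕ} (hik : i ≤ k)
    (hk : (k : ℕ∞) ≤ (R.view p).len) (hi : ((R.view p).state i).isJoined = true) :
    ((R.view p).state k).isJoined = true := by
  induction k, hik using Nat.le_induction with
  | base => exact hi
  | succ k _ ih =>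
    have hk' : R.HasStep p k := lt_of_lt_of_le (by exact_mod_cast Nat.lt_succ_self k) hk
    rw [state_succ hR hp hk']
    exact (isJoined_step_of_isJoined (ih hk'.le)).1

omit hR in
lemma hasStep_succ_le {p : ID} {k : ℕ} (hk : R.HasStep p k) :
    ((k + 1 : ℕ) : ℕ∞) ≤ (R.view p).len := by
  have := Order.add_one_le_of_lt hk
  exact_mod_cast this

lemma isJoined_of_initially {p : ID} (hp : p ∉ R.F) (hi : R.Initially p) {k : ℕ}
    (hk : (k : ℕ∞) ≤ (R.view p).len) : ((R.view p).state k).isJoined = true := by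
  refine isJoined_mono hR hp (Nat.zero_le k) hk ?_
  rw [(hR.timedView p).init]
  simp [initState, hi]

lemma mem_heard_iff {p : ID} (hp : p ∉ R.F) {k : ℕ} (hk : (k : ℕ∞) ≤ (R.view p).len)
    {r : ID} {l : Label ID} :
    (r, l) ∈ ((R.view p).state k).heard ↔
      ∃ j < k, ∃ m, (R.view p).trigger j = .receive r m ∧ m.label = some l := by
  induction k with
  | zero => rw [(hR.timedView p).init]; simp [initState]
  | succ k ih =>
    have hk' : R.HasStep p k := lt_of_lt_of_le (by exact_mod_cast Nat.lt_succ_self k) hk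
    have hor : (∃ j < k + 1, ∃ m, (R.view p).trigger j = .receive r m ∧ m.label = some l) ↔
        (∃ j < k, ∃ m, (R.view p).trigger j = .receive r m ∧ m.label = some l) ∨
          ∃ m, (R.view p).trigger k = .receive r m ∧ m.label = some l := by
      constructor
      · rintro ⟨j, hj, h⟩
        rcases Nat.lt_succ_iff_lt_or_eq.1 hj with hj | rfl
        exacts [.inl ⟨j, hj, h⟩, .inr h]
      · rintro (⟨j, hj, h⟩ | h)
        exacts [⟨j, hj.trans (Nat.lt_succ_self k), h⟩, ⟨k, Nat.lt_succ_self k, h⟩]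
    rw [hor, ← ih hk'.le, state_succ hR hp hk']
    by_cases hT : ∃ r' m', (R.view p).trigger k = .receive r' m'
    · obtain ⟨r', m', hT⟩ := hT
      rw [hT, heard_step_receive, mem_note_heard]
      simp only [Trigger.receive.injEq]
      constructor
      · rintro (h | ⟨rfl, h⟩)
        exacts [.inl h, .inr ⟨m', ⟨rfl, rfl⟩, h⟩]
      · rintro (h | ⟨m, ⟨rfl, rfl⟩, h⟩)
        exacts [.inl h, .inr ⟨rfl, h⟩]
    · push Not at hT
      rw [heard_step_of_not_receive _ _ _ _ hT]
      constructor
      · exact .inl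
      · rintro (h | ⟨m, h, -⟩)
        exacts [h, absurd h (hT _ _)]

/-- The first message of its type from `r` is valid unless `r` is known to have left. -/
lemma exists_valid_receive {p r : ID} {m : Payload ID V} {l : Label ID} {k : ℕ} (hp : p ∉ R.F)
    (hk : R.HasStep p k) (hT : (R.view p).trigger k = .receive r m) (hm : m.label = some l)
    (hl : l = .leave ∨ .leave r ∉ ((R.view p).state k).changes) :
    ∃ j ≤ k, ∃ m', (R.view p).trigger j = .receive r m' ∧ m'.label = some l ∧
      ((R.view p).state j).isValid r m' = true := by
  classical
  -- The receipt in step `k` may be a repetition. The earliest receipt with the same label is valid;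
  -- its contents may differ, which is why only the label of `m'` is retained.
  have hex : ∃ j, ∃ m', (R.view p).trigger j = .receive r m' ∧ m'.label = some l :=
    ⟨k, m, hT, hm⟩
  obtain ⟨m', h1, h2⟩ := Nat.find_spec hex
  have hjk : Nat.find hex ≤ k := Nat.find_min' hex ⟨m, hT, hm⟩
  refine ⟨Nat.find hex, hjk, m', h1, h2, ?_⟩
  rw [isValid_of_label h2, mem_heard_iff hR hp (hk.of_le hjk).le]
  refine ⟨?_, hl.imp_right fun h hc => h (changes_mono hR hp hjk hk.le hc)⟩
  rintro ⟨j, hj, h⟩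
  exact Nat.find_min hex hj h

omit hR in
lemma exists_first_change {p : ID} {c : Change ID} {k : ℕ}
    (hc : c ∈ ((R.view p).state k).changes) :
    c ∈ ((R.view p).state 0).changes ∨
      ∃ j < k, c ∉ ((R.view p).state j).changes ∧ c ∈ ((R.view p).state (j + 1)).changes := by
  induction k with
  | zero => exact .inl hc
  | succ k ih =>
    by_cases h : c ∈ ((R.view p).state k).changes
    · exact (ih h).imp_right fun ⟨j, hj, h⟩ => ⟨j, hj.trans (Nat.lt_succ_self k), h⟩
    · exact .inr ⟨k, Nat.lt_succ_self k, h, hc⟩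

end Execution

/-! ### Arithmetic of the parameter constraints -/

/-- The consequences of the constraints that the proof uses. -/
structure Margins (α f N γ β : ℝ) : Prop where
  beta_le : β ≤ 1 - ((1 + α) ^ 4 - 1) - f / N
  gamma_le : γ ≤ 1 - ((1 + α) ^ 4 - 1) - f / N
  gamma_pos : 0 < γ
  lt_gamma_mul : ((1 + α) ^ 4 - 1) + f / N < γ * (1 - ((1 + α) ^ 4 - 1) - f / N)
  quorum : f + 1 ≤ (1 - ((1 + α) ^ 4 - 1) - f / N) * N

/-- The lower and the upper bound on `γ` are compatible only if churn is low and faults are few. In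
this and the next two lemmas `a` stands for `α`, `φ` for `f / NSmin` and `ψ` for `1 / NSmin`. -/
lemma coarse_of_ratio {a φ ψ γ : ℝ} (ha : 0 < a) (hψ : 0 < ψ) (hφ : 0 < φ) (ha1 : a < 1)
    (h3 : (ψ + 2 * φ) / (1 - a) ^ 3 + (1 + a) ^ 3 / (1 - a) ^ 3 - 1 ≤ γ)
    (h4 : γ ≤ (1 - a) ^ 3 / (1 + a) ^ 3 - φ / (1 + a) ^ 3) :
    a < 1 / 10 ∧ φ ≤ 37 / 100 := by
  have hu : 0 < 1 - a := by linarith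
  have hu3 : 0 < (1 - a) ^ 3 := by positivity
  have hv3 : 0 < (1 + a) ^ 3 := by positivity
  have h34 : (ψ + 2 * φ) * (1 + a) ^ 3 + (1 + a) ^ 6 ≤
      ((1 - a) * (1 + a)) ^ 3 + ((1 - a) ^ 3 - φ) * (1 - a) ^ 3 := by
    have h := h3.trans h4
    have e1 : (ψ + 2 * φ) / (1 - a) ^ 3 + (1 + a) ^ 3 / (1 - a) ^ 3 - 1 =
        ((ψ + 2 * φ) + (1 + a) ^ 3 - (1 - a) ^ 3) / (1 - a) ^ 3 := by
      rw [← add_div, div_sub_one hu3.ne']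
    rw [e1, ← sub_div, div_le_div_iff₀ hu3 hv3] at h
    linarith
  have hv6 : (1 : ℝ) ≤ (1 + a) ^ 6 := one_le_pow₀ (by linarith)
  have hv3' : (1 : ℝ) ≤ (1 + a) ^ 3 := one_le_pow₀ (by linarith)
  have hu3' : (1 - a) ^ 3 ≤ 1 := pow_le_one₀ hu.le (by linarith)
  -- If `a ≥ 1/10`, the left side of `h34` is at least `1.1^6 > 1.77`, while the right side is at
  -- most `0.99^3 + 0.9^6 < 1.51`.
  have haa : a < 1 / 10 := by
    by_contra hc
    push Not at hc
    have i1 : (11 / 10 : ℝ) ^ 6 ≤ (1 + a) ^ 6 := pow_le_pow_left₀ (by norm_num) (by linarith) 6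
    have i2 : ((1 - a) * (1 + a)) ^ 3 ≤ (99 / 100 : ℝ) ^ 3 :=
      pow_le_pow_left₀ (by positivity) (by nlinarith) 3
    have i3 : (1 - a) ^ 3 ≤ (9 / 10 : ℝ) ^ 3 := pow_le_pow_left₀ hu.le (by linarith) 3
    have i4 : ((1 - a) ^ 3 - φ) * (1 - a) ^ 3 ≤ (9 / 10 : ℝ) ^ 3 * (9 / 10 : ℝ) ^ 3 :=
      mul_le_mul (by linarith) i3 hu3.le (by norm_num)
    have i5 : 0 ≤ (ψ + 2 * φ) * (1 + a) ^ 3 := by positivity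
    norm_num at i1 i2 i4
    linarith
  refine ⟨haa, ?_⟩
  have i1 : (9 / 10 : ℝ) ^ 3 ≤ (1 - a) ^ 3 := pow_le_pow_left₀ (by norm_num) (by linarith) 3
  have i2 : ((1 - a) * (1 + a)) ^ 3 ≤ 1 := pow_le_one₀ (by positivity) (by nlinarith)
  have i3 : 2 * φ * 1 ≤ (ψ + 2 * φ) * (1 + a) ^ 3 :=
    mul_le_mul (by linarith) hv3' (by norm_num) (by positivity)
  have i4 : (1 - a) ^ 3 * (1 - a) ^ 3 ≤ 1 := mul_le_one₀ hu3' hu3.le hu3'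
  have i5 : (9 / 10 : ℝ) ^ 3 * φ ≤ (1 - a) ^ 3 * φ := mul_le_mul_of_nonneg_right i1 hφ.le
  norm_num at i5
  linarith

/-- Compatibility of two bounds on `β`: to first order, the cleared inequality says `1 + 10a + 3φ <
2 - 8a - 4φ`, that is `18a + 7φ < 1`. One `φ` is given up to absorb the quadratic term `2φ^2`. -/
lemma sharp_of_ratio {a φ ψ β : ℝ} (ha : 0 < a) (hψ : 0 < ψ) (hφ : 0 < φ)
    (haa : a < 1 / 10) (hφ' : φ ≤ 37 / 100) (h2 : ψ + 2 * φ ≤ (1 - a) ^ 3)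
    (h5 : β ≤ (1 - a) ^ 3 / (1 + a) ^ 2 - φ / (1 + a) ^ 2)
    (h7 : ((1 + a) ^ 3 - (1 - a) ^ 3 + 1 + (ψ + 3 * φ)) /
      ((2 + 2 * a + a ^ 2) * (1 - a) ^ 2 / (1 + a) ^ 2 - 2 * φ) < β) :
    18 * a + 6 * φ ≤ 1 := by
  have hv2 : 0 < (1 + a) ^ 2 := by positivity
  have a2 := pow_pos ha 2
  have a3 := pow_pos ha 3
  have hφa := mul_pos hφ ha
  have hφa2 := mul_pos hφ a2
  -- The coarse bounds make this denominator positive, so that `h7` can be multiplied out.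
  have hden : 0 < (2 + 2 * a + a ^ 2) * (1 - a) ^ 2 / (1 + a) ^ 2 - 2 * φ := by
    rw [sub_pos, lt_div_iff₀ hv2]
    have i1 : (81 / 100 : ℝ) ≤ (1 - a) ^ 2 := by nlinarith
    have i2 : (1 + a) ^ 2 ≤ 121 / 100 := by nlinarith
    have i3 : 2 * (81 / 100 : ℝ) ≤ (2 + 2 * a + a ^ 2) * (1 - a) ^ 2 :=
      mul_le_mul (by linarith) i1 (by norm_num) (by positivity)
    have i4 : 2 * φ * (1 + a) ^ 2 ≤ 2 * (37 / 100) * (121 / 100) :=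
      mul_le_mul (by linarith) i2 hv2.le (by norm_num)
    linarith
  rw [div_lt_iff₀ hden] at h7
  have i1 := mul_le_mul_of_nonneg_right h5 hden.le
  have i2 : ((1 + a) ^ 3 - (1 - a) ^ 3 + 1 + (ψ + 3 * φ)) * (1 + a) ^ 4 <
      ((1 - a) ^ 3 - φ) * ((2 + 2 * a + a ^ 2) * (1 - a) ^ 2 - 2 * φ * (1 + a) ^ 2) := by
    have e : ((1 - a) ^ 3 / (1 + a) ^ 2 - φ / (1 + a) ^ 2) *
        ((2 + 2 * a + a ^ 2) * (1 - a) ^ 2 / (1 + a) ^ 2 - 2 * φ) =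
        ((1 - a) ^ 3 - φ) * ((2 + 2 * a + a ^ 2) * (1 - a) ^ 2 - 2 * φ * (1 + a) ^ 2) /
          (1 + a) ^ 4 := by
      field_simp
    rw [e] at i1
    exact (lt_div_iff₀ (by positivity)).1 (h7.trans_le i1)
  have i3 : (1 + 6 * a + 3 * φ) * (1 + 4 * a) ≤
      ((1 + a) ^ 3 - (1 - a) ^ 3 + 1 + (ψ + 3 * φ)) * (1 + a) ^ 4 := by
    have e1 : (1 + a) ^ 3 - (1 - a) ^ 3 = 6 * a + 2 * a ^ 3 := by ring
    have e2 : (1 + a) ^ 4 = 1 + 4 * a + (6 * a ^ 2 + 4 * a ^ 3 + a ^ 4) := by ring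
    refine mul_le_mul (by linarith) ?_ (by positivity) (by rw [e1]; positivity)
    rw [e2]
    have : 0 ≤ 6 * a ^ 2 + 4 * a ^ 3 + a ^ 4 := by positivity
    linarith
  have i4 : (2 + 2 * a + a ^ 2) * (1 - a) ^ 2 - 2 * φ * (1 + a) ^ 2 ≤ 2 - 2 * a - 2 * φ := by
    have e : (2 + 2 * a + a ^ 2) * (1 - a) ^ 2 - 2 * φ * (1 + a) ^ 2 =
      2 - 2 * a - 2 * φ - (a ^ 2 * (1 - a ^ 2) + 4 * (φ * a) + 2 * (φ * a ^ 2)) := by ring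
    have : 0 ≤ a ^ 2 * (1 - a ^ 2) := mul_nonneg a2.le (by nlinarith)
    linarith
  have i5 : (1 - a) ^ 3 - φ ≤ 1 - 3 * a + 3 * a ^ 2 - φ := by
    have e : (1 - a) ^ 3 = 1 - 3 * a + 3 * a ^ 2 - a ^ 3 := by ring
    linarith
  have i6 : 0 < (1 - a) ^ 3 - φ := by linarith
  have i7 := (i3.trans_lt i2).trans_le ((mul_le_mul_of_nonneg_left i4 i6.le).trans
      (mul_le_mul_of_nonneg_right i5 (by linarith)))
  have e : (1 - 3 * a + 3 * a ^ 2 - φ) * (2 - 2 * a - 2 * φ) =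
    2 - 8 * a + 12 * a ^ 2 - 4 * φ + 8 * (φ * a) + 2 * φ ^ 2 - 6 * a ^ 3 - 6 * (φ * a ^ 2) := by
    ring
  have e' : (1 + 6 * a + 3 * φ) * (1 + 4 * a) =
    1 + 10 * a + 24 * a ^ 2 + 3 * φ + 12 * (φ * a) := by ring
  have i8 : φ ^ 2 ≤ 37 / 100 * φ := by nlinarith
  linarith

/-- All five claims come down to the linear inequality `18a + 6φ ≤ 1` of `sharp_of_ratio`, with
`(1+a)^4 - 1` replaced by a multiple of `a` and `γ` bounded below by `6a + 2φ`. -/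
lemma margins_of_ratio {a φ ψ γ β : ℝ} (ha : 0 < a) (hψ : 0 < ψ) (hψφ : ψ ≤ φ)
    (h2 : ψ + 2 * φ ≤ (1 - a) ^ 3)
    (h3 : (ψ + 2 * φ) / (1 - a) ^ 3 + (1 + a) ^ 3 / (1 - a) ^ 3 - 1 ≤ γ)
    (h4 : γ ≤ (1 - a) ^ 3 / (1 + a) ^ 3 - φ / (1 + a) ^ 3)
    (h5 : β ≤ (1 - a) ^ 3 / (1 + a) ^ 2 - φ / (1 + a) ^ 2)
    (h7 : ((1 + a) ^ 3 - (1 - a) ^ 3 + 1 + (ψ + 3 * φ)) /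
      ((2 + 2 * a + a ^ 2) * (1 - a) ^ 2 / (1 + a) ^ 2 - 2 * φ) < β) :
    β ≤ 1 - ((1 + a) ^ 4 - 1) - φ ∧ γ ≤ 1 - ((1 + a) ^ 4 - 1) - φ ∧ 0 < γ ∧
    ((1 + a) ^ 4 - 1) + φ < γ * (1 - ((1 + a) ^ 4 - 1) - φ) ∧
    φ + ψ ≤ 1 - ((1 + a) ^ 4 - 1) - φ := by
  have hφ : 0 < φ := hψ.trans_le hψφ
  have hu3 : 0 < (1 - a) ^ 3 := by linarith
  have ha1 : a < 1 := by
    have : 0 < 1 - a := by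
      by_contra h
      have : 0 ≤ (a - 1) ^ 3 := pow_nonneg (by linarith) 3
      have e : (a - 1) ^ 3 = - (1 - a) ^ 3 := by ring
      linarith
    linarith
  have hv2 : 0 < (1 + a) ^ 2 := by positivity
  have hu3' : (1 - a) ^ 3 ≤ 1 := pow_le_one₀ (by linarith) (by linarith)
  obtain ⟨haa, hφ'⟩ := coarse_of_ratio ha hψ hφ ha1 h3 h4
  have hs := sharp_of_ratio ha hψ hφ haa hφ' h2 h5 h7
  have ha18 : a ≤ 1 / 18 := by linarith
  have p2 := pow_pos ha 2
  have p3 := pow_pos ha 3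
  have p4 := pow_pos ha 4
  have p5 := pow_pos ha 5
  have a2 : a ^ 2 ≤ a / 18 := by nlinarith
  have a3 : a ^ 3 ≤ a ^ 2 / 18 := by nlinarith
  have a4 : a ^ 4 ≤ a ^ 3 / 18 := by nlinarith
  have a5 : a ^ 5 ≤ a ^ 4 / 18 := by nlinarith
  have hχ' : (1 + a) ^ 4 = 1 + 4 * a + 6 * a ^ 2 + 4 * a ^ 3 + a ^ 4 := by ring
  -- With `a ≤ 1/18` the terms `6a^2 + 4a^3 + a^4` are at most `0.36 * a`.
  have hχ : (1 + a) ^ 4 - 1 ≤ 4.36 * a := by rw [hχ']; linarith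
  have hφa := mul_pos hφ ha
  have hB : (1 - a) ^ 3 / (1 + a) ^ 2 - φ / (1 + a) ^ 2 ≤ 1 - ((1 + a) ^ 4 - 1) - φ := by
    rw [← sub_div, div_le_iff₀ hv2]
    have h1 : 0 ≤ 1 - 16 * a - 19 * a ^ 2 - 15 * a ^ 3 - 6 * a ^ 4 - a ^ 5 - φ * (2 + a) := by
      have : φ * a ≤ φ / 18 := by nlinarith
      linarith
    have h2 := mul_nonneg ha.le h1
    have e : (1 - ((1 + a) ^ 4 - 1) - φ) * (1 + a) ^ 2 - ((1 - a) ^ 3 - φ) =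
      a * (1 - 16 * a - 19 * a ^ 2 - 15 * a ^ 3 - 6 * a ^ 4 - a ^ 5 - φ * (2 + a)) := by ring
    linarith
  have hγ : 6 * a + 2 * φ ≤ γ := by
    refine le_trans ?_ h3
    have e1 : (ψ + 2 * φ) / (1 - a) ^ 3 + (1 + a) ^ 3 / (1 - a) ^ 3 - 1 =
        ((ψ + 2 * φ) + ((1 + a) ^ 3 - (1 - a) ^ 3)) / (1 - a) ^ 3 := by
      rw [← add_div, div_sub_one hu3.ne']; congr 1; ring
    have e2 : (1 + a) ^ 3 - (1 - a) ^ 3 = 6 * a + 2 * a ^ 3 := by ring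
    rw [e1, le_div_iff₀ hu3, e2]
    have : (6 * a + 2 * φ) * (1 - a) ^ 3 ≤ (6 * a + 2 * φ) * 1 :=
      mul_le_mul_of_nonneg_left hu3' (by positivity)
    linarith
  have hκ : 0 < 1 - ((1 + a) ^ 4 - 1) - φ := by linarith
  refine ⟨h5.trans hB, h4.trans (le_trans ?_ hB), by linarith, ?_, by linarith⟩
  · rw [← sub_div, ← sub_div]
    refine div_le_div_of_nonneg_left (by linarith) hv2 ?_
    exact pow_le_pow_right₀ (by linarith) (by norm_num)
  -- After expansion it remains to see that `1.64a + φ` exceeds `26.16a^2 + 14.72φa + 2φ^2`. The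
  -- term in `a` dominates `a^2` because `a ≤ 1/18`, and `φ * (18a + 6φ) ≤ φ` covers the rest.
  · refine lt_of_lt_of_le ?_ (mul_le_mul_of_nonneg_right hγ hκ.le)
    have h1 : (6 * a + 2 * φ) * (1 - 4.36 * a - φ) ≤
        (6 * a + 2 * φ) * (1 - ((1 + a) ^ 4 - 1) - φ) :=
      mul_le_mul_of_nonneg_left (by linarith) (by positivity)
    have h2 : (6 * a + 2 * φ) * (1 - 4.36 * a - φ) =
        6 * a + 2 * φ - 26.16 * a ^ 2 - 14.72 * (φ * a) - 2 * φ ^ 2 := by ring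
    have h3 : 0 ≤ φ * (1 - 18 * a - 6 * φ) := mul_nonneg hφ.le (by linarith)
    have h4 : φ * (1 - 18 * a - 6 * φ) = φ - 18 * (φ * a) - 6 * φ ^ 2 := by ring
    have h5 := pow_pos hφ 2
    linarith

lemma Constraints.margins {α γ β : ℝ} {f N : ℕ} (h : Constraints α f N γ β) (hα : 0 < α)
    (hf : 1 ≤ f) (hN : 0 < N) : Margins α f N γ β := by
  have hN' : (0 : ℝ) < N := by exact_mod_cast hN
  have hf' : (1 : ℝ) ≤ f := by exact_mod_cast hf
  have e : ∀ x c : ℝ, x / (c * N) = x / N / c := fun x c => by rw [mul_comm, div_div]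
  have e1 : (1 + 2 * f : ℝ) / ((1 - α) ^ 3 * N) = (1 / N + 2 * (f / N)) / (1 - α) ^ 3 := by
    rw [e]; congr 1; ring
  obtain ⟨h1, h2, h3, h4, h5⟩ := margins_of_ratio (a := α) (φ := f / N) (ψ := 1 / N) (γ := γ)
    (β := β) hα (by positivity) (by gcongr)
    (by
      have := h.c2
      have e3 : (1 : ℝ) / N + 2 * (f / N) = (1 + 2 * f) / N := by ring
      rw [e3, div_le_iff₀ hN']; linarith)
    (by rw [← e1]; exact h.c3) (by rw [← e]; exact h.c4) (by rw [← e]; exact h.c5)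
    (by
      refine lt_of_eq_of_lt ?_ h.c7
      congr 1 <;> ring)
  refine ⟨h1, h2, h3, h4, ?_⟩
  have := mul_le_mul_of_nonneg_right h5 hN'.le
  refine le_trans (le_of_eq ?_) this
  field_simp

/-! ### Churn over several delays and the stable core -/

section Churn

variable {P : Params ID} {D α : ℝ} {NSmin : ℕ} {R : Run ID V} (hR : IsExecution P D α NSmin R)
  (hD : 0 < D) (hα : 0 < α)
include hR

open Run

lemma finite_serversAt {t : ℝ} (ht : 0 ≤ t) : (R.serversAt P t).Finite :=
  (hR.finite t ht).subset fun _ h => h.2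

omit hR in
lemma serversAt_add_subset {t L : ℝ} (hL : 0 ≤ L) :
    R.serversAt P (t + L) ⊆ R.serversAt P t ∪ R.serversWith P .enter t L := by
  rintro p ⟨hp, he, hl⟩
  have hl' : ¬ R.LeftBy p t := fun h => hl (h.mono (by linarith))
  by_cases h : R.EnteredBy p t
  · exact .inl ⟨hp, h, hl'⟩
  · rcases he with he | ⟨v, hv, h'⟩
    · exact absurd (.inl he) h
    · refine .inr ⟨hp, v, ?_, hv, h'⟩
      by_contra hc
      exact h (.inr ⟨v, by linarith, h'⟩)

omit hR in
lemma serversWith_add_subset {T : Trigger ID V} {t L L' : ℝ} :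
    R.serversWith P T t (L + L') ⊆ R.serversWith P T t L ∪ R.serversWith P T (t + L) L' := by
  rintro p ⟨hp, u, h1, h2, h3⟩
  rcases le_total u (t + L) with h | h
  · exact .inl ⟨hp, u, h1, h, h3⟩
  · exact .inr ⟨hp, u, h, by linarith, h3⟩

include hD hα in
/-- The number of events of servers entering or leaving in a window of length `j * D`. -/
lemma churn_window {t : ℝ} (ht : 0 ≤ t) {j : ℕ} (hj : 1 ≤ j) :
    (R.serversWith P .enter t (j * D)).Finite ∧ (R.serversWith P .leave t (j * D)).Finite ∧
    ((R.serversWith P .enter t (j * D)).ncard + (R.serversWith P .leave t (j * D)).ncard : ℝ) ≤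
      ((1 + α) ^ j - 1) * R.NS P t := by
  induction j, hj using Nat.le_induction with
  | base => simpa using hR.churn t ht
  | succ j _ ih =>
    obtain ⟨h1, h2, h3⟩ := ih
    have hjD : 0 ≤ (j : ℝ) * D := by positivity
    obtain ⟨g1, g2, g3⟩ := hR.churn (t + j * D) (by linarith)
    have e : ((j + 1 : ℕ) : ℝ) * D = j * D + D := by push_cast; ring
    rw [e]
    -- The bound on the events so far also bounds the growth of the system, on which the next use of
    -- `churn` depends.
    have hNS : (R.NS P (t + j * D) : ℝ) ≤ (1 + α) ^ j * R.NS P t := by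
      have i1 : R.NS P (t + j * D) ≤ R.NS P t + (R.serversWith P .enter t (j * D)).ncard :=
        (Set.ncard_le_ncard (serversAt_add_subset hjD)
          ((finite_serversAt hR ht).union h1)).trans (Set.ncard_union_le _ _)
      have i2 : (R.NS P (t + j * D) : ℝ) ≤
          R.NS P t + (R.serversWith P .enter t (j * D)).ncard := by exact_mod_cast i1
      have i3 : (0 : ℝ) ≤ (R.serversWith P .leave t (j * D)).ncard := by positivity
      linarith
    have k1 : ∀ T : Trigger ID V, (R.serversWith P T t (j * D)).Finite →
        (R.serversWith P T (t + j * D) D).Finite →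
        ((R.serversWith P T t (j * D + D)).ncard : ℝ) ≤
          (R.serversWith P T t (j * D)).ncard + (R.serversWith P T (t + j * D) D).ncard := by
      intro T a1 a2
      exact_mod_cast (Set.ncard_le_ncard serversWith_add_subset (a1.union a2)).trans
        (Set.ncard_union_le _ _)
    refine ⟨(h1.union g1).subset serversWith_add_subset,
      (h2.union g2).subset serversWith_add_subset, ?_⟩
    have k2 := k1 .enter h1 g1
    have k3 := k1 .leave h2 g2
    have k4 := mul_le_mul_of_nonneg_left hNS hα.le
    have k5 : ((1 + α) ^ (j + 1) - 1) * (R.NS P t : ℝ) =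
      ((1 + α) ^ j - 1) * R.NS P t + α * ((1 + α) ^ j * R.NS P t) := by ring
    linarith

/-- The correct servers that are in the system before `b` and do not leave by `b + 4 * D`. -/
def coreSet (P : Params ID) (D : ℝ) (R : Run ID V) (b : ℝ) : Set ID :=
  {s | P.isClient s = false ∧ s ∉ R.F ∧ R.InBefore s b ∧ ¬ R.LeftBy s (b + 4 * D)}

include hD hα in
/-- The core of the system around the window `[b, b + 4 * D]`: `Q` consists of the correct servers
that are in the system before the window and stay throughout it, `W` contains the servers that enter
or leave in it. -/
lemma exists_core (hN : 0 < NSmin) (hM : Margins α P.f NSmin P.γ P.β) {b : ℝ} (hb : 0 ≤ b) :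
    ∃ Q W : Finset ID, (∀ s, s ∈ Q ↔ s ∈ coreSet P D R b) ∧
      (∀ s u, P.isClient s = false → b ≤ u → u ≤ b + 4 * D →
        (R.Occurs s .enter u ∨ R.Occurs s .leave u) → s ∈ W) ∧
      P.f + 1 ≤ Q.card ∧ (W.card + P.f : ℝ) < P.γ * Q.card ∧
      ∀ X : Finset ID, (∀ s ∈ X, P.isClient s = false ∧ R.EnteredBy s (b + 4 * D) ∧
          (s ∉ R.F → ¬ ∃ u < b, R.Occurs s .leave u)) →
        P.β * X.card ≤ Q.card ∧ P.γ * X.card ≤ Q.card := by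
  classical
  obtain ⟨h1, h2, h3⟩ := churn_window (j := 4) hR hD hα hb (by norm_num)
  simp only [Nat.cast_ofNat] at h1 h2 h3
  set n : ℝ := (R.NS P b : ℝ) with hn
  set χ : ℝ := (1 + α) ^ 4 - 1 with hχ
  have hnN : (NSmin : ℝ) ≤ n := by rw [hn]; exact_mod_cast hR.minSize b hb
  have hN' : (0 : ℝ) < NSmin := by exact_mod_cast hN
  have hχ0 : 0 ≤ χ := sub_nonneg.2 (one_le_pow₀ (by linarith))
  have hfn : (P.f : ℝ) ≤ P.f / NSmin * n := by
    rw [div_mul_eq_mul_div, le_div_iff₀ hN']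
    exact mul_le_mul_of_nonneg_left hnN (by positivity)
  set W : Finset ID := h1.toFinset ∪ h2.toFinset with hW
  have hWcard : (W.card : ℝ) ≤ χ * n := by
    refine le_trans ?_ h3
    rw [Set.ncard_eq_toFinset_card _ h1, Set.ncard_eq_toFinset_card _ h2]
    exact_mod_cast Finset.card_union_le _ _
  have hWmem : ∀ s u, P.isClient s = false → b ≤ u → u ≤ b + 4 * D →
      (R.Occurs s .enter u ∨ R.Occurs s .leave u) → s ∈ W := by
    intro s u hs hu hu' h
    rw [hW, Finset.mem_union, Set.Finite.mem_toFinset, Set.Finite.mem_toFinset]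
    exact h.imp (fun h => ⟨hs, u, hu, hu', h⟩) (fun h => ⟨hs, u, hu, hu', h⟩)
  have hbD : b ≤ b + 4 * D := by linarith
  set A : Finset ID := (finite_serversAt hR hb).toFinset with hA
  have hAcard : (A.card : ℝ) = n := by
    rw [hn, NS, Set.ncard_eq_toFinset_card _ (finite_serversAt hR hb)]
  have hmemA : ∀ s, s ∈ A ↔ P.isClient s = false ∧ R.PresentAt s b := fun s => by
    rw [hA, Set.Finite.mem_toFinset]; rfl
  have inBefore : ∀ s, P.isClient s = false → s ∉ W → R.EnteredBy s (b + 4 * D) →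
      R.InBefore s b := by
    rintro s hs hsW (h | ⟨u, hu, h⟩)
    · exact .inl h
    · refine .inr ⟨u, ?_, h⟩
      by_contra hc
      exact hsW (hWmem s u hs (not_lt.1 hc) hu (.inl h))
  have hQfin : (coreSet P D R b).Finite :=
    (A.finite_toSet).subset fun s ⟨hs, _, hi, hl⟩ =>
      (hmemA s).2 ⟨hs, hi.enteredBy, fun h => hl (LeftBy.mono h hbD)⟩
  set Q : Finset ID := hQfin.toFinset with hQ
  have hmemQ : ∀ s, s ∈ Q ↔ s ∈ coreSet P D R b := fun s => by rw [hQ, Set.Finite.mem_toFinset]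
  -- Here `y` counts the Byzantine servers that left before `b`, which `X` may still contain, and
  -- `m` counts the other servers in `X` together with all those present at `b`. A server counted by
  -- `m` is in `Q`, in `W`, or one of the at most `f - y` remaining Byzantine servers; so no fault
  -- is charged twice. Including the servers present at `b` secures `n ≤ m`, by which the loss `χ *
  -- n` is compared with `m`.
  have main : ∀ X : Finset ID, (∀ s ∈ X, P.isClient s = false ∧ R.EnteredBy s (b + 4 * D) ∧
      (s ∉ R.F → ¬ ∃ u < b, R.Occurs s .leave u)) →
      ∃ m y : ℝ, X.card ≤ m + y ∧ n ≤ m ∧ 0 ≤ y ∧ y ≤ P.f ∧ m ≤ Q.card + (P.f - y) + χ * n := by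
    intro X hX
    set G : ID → Prop := fun s => ∃ u < b, R.Occurs s .leave u with hG
    set M : Finset ID := X.filter (fun s => ¬ G s) ∪ A with hMdef
    have hFc := Finset.card_filter_add_card_filter_not (s := R.F) (p := G)
    have hF := hR.byzantine_card
    refine ⟨M.card, (R.F.filter G).card, ?_, ?_, by positivity, ?_, ?_⟩
    · have : X ⊆ M ∪ R.F.filter G := by
        intro s hs
        by_cases hsG : G s
        · refine Finset.mem_union_right _ (Finset.mem_filter.2 ⟨?_, hsG⟩)
          by_contra hsF
          exact (hX s hs).2.2 hsF hsG
        · exact Finset.mem_union_left _ (Finset.mem_union_left _ (Finset.mem_filter.2 ⟨hs, hsG⟩))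
      exact_mod_cast (Finset.card_le_card this).trans (Finset.card_union_le _ _)
    · rw [← hAcard]
      exact_mod_cast Finset.card_le_card Finset.subset_union_right
    · have : (R.F.filter G).card ≤ P.f := by omega
      exact_mod_cast this
    · have hsub : M ⊆ Q ∪ R.F.filter (fun s => ¬ G s) ∪ W := by
        intro s hs
        have hs' : P.isClient s = false ∧ R.EnteredBy s (b + 4 * D) ∧ ¬ G s := by
          rcases Finset.mem_union.1 hs with hs | hs
          · obtain ⟨hsX, hsG⟩ := Finset.mem_filter.1 hs
            exact ⟨(hX s hsX).1, (hX s hsX).2.1, hsG⟩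
          · obtain ⟨h1, h2, h3⟩ := (hmemA s).1 hs
            exact ⟨h1, h2.mono hbD, fun ⟨u, hu, h⟩ => h3 ⟨u, hu.le, h⟩⟩
        obtain ⟨hsc, hse, hsG⟩ := hs'
        by_cases hsW : s ∈ W
        · exact Finset.mem_union_right _ hsW
        refine Finset.mem_union_left _ ?_
        by_cases hsF : s ∈ R.F
        · exact Finset.mem_union_right _ (Finset.mem_filter.2 ⟨hsF, hsG⟩)
        · refine Finset.mem_union_left _ ((hmemQ s).2 ⟨hsc, hsF, inBefore s hsc hsW hse, ?_⟩)
          rintro ⟨u, hu, h⟩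
          rcases lt_or_ge u b with hub | hub
          · exact hsG ⟨u, hub, h⟩
          · exact hsW (hWmem s u hsc hub hu (.inr h))
      have hcard : M.card ≤ Q.card + (R.F.filter (fun s => ¬ G s)).card + W.card :=
        (Finset.card_le_card hsub).trans ((Finset.card_union_le _ _).trans
          (Nat.add_le_add_right (Finset.card_union_le _ _) _))
      have hc' : (M.card : ℝ) ≤ Q.card + (R.F.filter (fun s => ¬ G s)).card + W.card := by
        exact_mod_cast hcard
      have hF' : ((R.F.filter G).card : ℝ) + (R.F.filter (fun s => ¬ G s)).card ≤ P.f := by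
        exact_mod_cast hFc.trans_le hF
      linarith
  -- For empty `X` the estimate `main` is a lower bound on the core itself.
  have hQn : (1 - χ - P.f / NSmin) * n ≤ Q.card := by
    obtain ⟨m, y, -, h2, h3, h4, h5⟩ := main ∅ (by simp)
    linarith
  have hκ : 0 ≤ 1 - χ - P.f / (NSmin : ℝ) := hM.gamma_pos.le.trans hM.gamma_le
  refine ⟨Q, W, hmemQ, hWmem, ?_, ?_, ?_⟩
  · have h := hM.quorum.trans ((mul_le_mul_of_nonneg_left hnN hκ).trans hQn)
    exact_mod_cast h
  · have h1 := mul_le_mul_of_nonneg_left hQn hM.gamma_pos.le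
    have h2 := mul_lt_mul_of_pos_right hM.lt_gamma_mul (hN'.trans_le hnN)
    have h3 : (χ + P.f / NSmin) * n = χ * n + P.f / NSmin * n := by ring
    have h4 : P.γ * (1 - χ - P.f / NSmin) * n = P.γ * ((1 - χ - P.f / NSmin) * n) := by ring
    rw [h3, h4] at h2
    linarith
  · intro X hX
    obtain ⟨m, y, h1, h2, h3, h4, h5⟩ := main X hX
    -- By `main`, `|Q| ≥ m + y - f - χ * n`. Since `(1 - θ) * m ≥ (1 - θ) * n ≥ χ * n + f`, this is
    -- at least `θ * m + y`, hence at least `θ * (m + y)`.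
    have key : ∀ θ : ℝ, θ ≤ 1 - χ - P.f / NSmin → θ * X.card ≤ Q.card := by
      intro θ hθ
      have hf0 : (0 : ℝ) ≤ P.f / NSmin := by positivity
      rcases le_total θ 0 with h0 | h0
      · exact (mul_nonpos_of_nonpos_of_nonneg h0 (by positivity)).trans (by positivity)
      · have i1 : θ * X.card ≤ θ * (m + y) := mul_le_mul_of_nonneg_left h1 h0
        have i2 : (χ + P.f / NSmin) * n ≤ (1 - θ) * n :=
          mul_le_mul_of_nonneg_right (by linarith) (hN'.le.trans hnN)
        have i3 : (1 - θ) * n ≤ (1 - θ) * m := mul_le_mul_of_nonneg_left h2 (by linarith)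
        have i4 : 0 ≤ (1 - θ) * y := mul_nonneg (by linarith) h3
        linarith
    exact ⟨key _ hM.beta_le, key _ hM.gamma_le⟩

end Churn

/-- What the entry `c` states is true at time `t`, as far as correct servers are concerned. -/
structure Genuine (P : Params ID) (R : Run ID V) (c : Change ID) (t : ℝ) : Prop where
  server : P.isClient c.node = false
  entered : R.EnteredBy c.node t
  left : ∀ q, c = .leave q → q ∉ R.F → R.LeftBy q t

lemma Genuine.mono {P : Params ID} {R : Run ID V} {c : Change ID} {t u : ℝ}
    (h : Genuine P R c t) (htu : t ≤ u) : Genuine P R c u :=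
  ⟨h.server, h.entered.mono htu, fun q hq hF => (h.left q hq hF).mono htu⟩

/-! ### Induction along time, and authenticity of entries -/

section Authenticity

variable {P : Params ID} {D α : ℝ} {NSmin : ℕ} {R : Run ID V} (hR : IsExecution P D α NSmin R)
include hR

open Run

lemma finite_steps (p : ID) (T : ℝ) : {k | R.HasStep p k ∧ (R.view p).time k ≤ T}.Finite := by
  by_cases h : (R.view p).len = ⊤
  · obtain ⟨k₀, hk₀⟩ := (hR.timedView p).unbounded h T
    refine (Set.finite_Iio k₀).subset fun k ⟨hk, hT⟩ => ?_
    by_contra hc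
    have hk₀' : R.HasStep p k₀ := hk.of_le (not_lt.1 hc)
    exact absurd (time_le hR hk (not_lt.1 hc)) (by linarith)
  · obtain ⟨n, hn⟩ := ENat.ne_top_iff_exists.1 h
    refine (Set.finite_Iio n).subset fun k ⟨hk, _⟩ => ?_
    rw [HasStep, ← hn] at hk
    exact_mod_cast hk

variable (hD : 0 < D) (hα : 0 < α)
include hD hα

/-- The churn bound limits how many servers have entered by time `T`, and infinite views have
unbounded times. Clients are left out because no churn bound limits how many of them come and go;
this is why the induction below runs over server steps only. -/
lemma finite_serverSteps (T : ℝ) :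
    {x : ID × ℕ | P.isClient x.1 = false ∧ R.HasStep x.1 x.2 ∧
      (R.view x.1).time x.2 ≤ T}.Finite := by
  obtain ⟨j, hj⟩ := exists_nat_ge (T / D)
  have hfin : ({p | P.isClient p = false ∧ R.EnteredBy p T} : Set ID).Finite := by
    refine ((R.S₀.finite_toSet).union
      (churn_window hR hD hα le_rfl (j := j + 1) (by omega)).1).subset ?_
    rintro p ⟨hp, h | ⟨u, hu, h⟩⟩
    · exact .inl ((initially_server hR hp).1 h)
    · refine .inr ⟨hp, u, occurs_nonneg hR h, ?_, h⟩
      have : T ≤ j * D := (div_le_iff₀ hD).1 hj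
      push_cast
      linarith
  refine (hfin.biUnion (t := fun p => {x : ID × ℕ | x.1 = p ∧ R.HasStep p x.2 ∧
    (R.view p).time x.2 ≤ T}) fun p _ => ?_).subset ?_
  · refine ((finite_steps hR p T).image fun k => (p, k)).subset ?_
    rintro ⟨q, k⟩ ⟨rfl, h⟩
    exact ⟨k, h, rfl⟩
  · rintro ⟨p, k⟩ ⟨hp, hk, ht⟩
    exact Set.mem_biUnion (x := p) ⟨hp, (enteredBy_time hR hk).mono ht⟩ ⟨rfl, hk, ht⟩

/-- Induction along the steps of the servers in the order of time. -/
lemma server_induction {motive : ID → ℕ → Prop}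
    (h : ∀ p k, P.isClient p = false → R.HasStep p k →
      (∀ q j, P.isClient q = false → R.HasStep q j → (R.view q).time j < (R.view p).time k →
        motive q j) → motive p k) :
    ∀ p k, P.isClient p = false → R.HasStep p k → motive p k := by
  -- The measure of a step is the number of server steps at strictly earlier times.
  set S : ID → ℕ → Set (ID × ℕ) := fun p k => {x | P.isClient x.1 = false ∧ R.HasStep x.1 x.2 ∧
    (R.view x.1).time x.2 < (R.view p).time k} with hS
  have hfin : ∀ p k, (S p k).Finite := fun p k =>
    (finite_serverSteps hR hD hα ((R.view p).time k)).subset fun x hx => ⟨hx.1, hx.2.1, hx.2.2.le⟩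
  have key : ∀ n p k, (S p k).ncard = n → P.isClient p = false → R.HasStep p k → motive p k := by
    intro n
    induction n using Nat.strong_induction_on with
    | _ n ih =>
      rintro p k rfl hp hk
      refine h p k hp hk fun q j hq hj hlt => ih _ ?_ q j rfl hq hj
      refine Set.ncard_lt_ncard ⟨fun x hx => ⟨hx.1, hx.2.1, hx.2.2.trans hlt⟩, fun hsub => ?_⟩
        (hfin p k)
      exact absurd (hsub (show (q, j) ∈ S p k from ⟨hq, hj, hlt⟩)).2.2 (lt_irrefl _)
  exact fun p k => key _ p k rfl

omit hD hα in
-- A new entry is either about the node itself, and then records its own event, or comes with a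
-- message sent strictly earlier. What a message says about its own sender is covered by
-- authenticated sender ids, the rest by the assumption on earlier messages.
lemma genuine_of_added {T : ℝ}
    (ih : ∀ r i, P.isClient r = false → R.HasStep r i → (R.view r).time i < T →
      ∀ x ∈ (R.view r).out i, ∀ c ∈ x.2.entries, Genuine P R c ((R.view r).time i))
    {q : ID} {j : ℕ} (hq : q ∉ R.F) (hj : R.HasStep q j) (hT : (R.view q).time j ≤ T)
    {c : Change ID} (hc : c ∈ ((R.view q).state (j + 1)).changes)
    (hc' : c ∉ ((R.view q).state j).changes) : Genuine P R c ((R.view q).time j) := by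
  rw [state_succ hR hq hj] at hc
  have hent := enteredBy_time hR hj
  rcases mem_changes_step hc with h | ⟨hs, ⟨hTr, rfl⟩ | ⟨hTr, rfl⟩ | rfl⟩ | ⟨r, m, hTr, hm⟩
  · exact absurd h hc'
  · exact ⟨hs, hent, by simp⟩
  · refine ⟨hs, hent, fun q' hq' _ => ?_⟩
    rw [← Change.leave.inj hq']
    exact ⟨_, le_rfl, j, hj, hTr, rfl⟩
  · exact ⟨hs, hent, by simp⟩
  · obtain ⟨i, d, hi, hmo, -, hlt, -⟩ := receive_sent hR hj hTr
    have horig : r ∉ R.F → m.Origin P r ((R.view r).trigger i) ((R.view r).state i)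
        ((R.view r).state (i + 1)) := by
      intro hr
      rw [out_eq hR hr hi] at hmo
      rw [state_succ hR hr hi]
      exact origin_of_mem_out hmo
    -- Clients follow their code, and none of their messages carries news.
    have hrs : P.isClient r = false := by
      by_contra hrc
      simp only [Bool.not_eq_false] at hrc
      have := horig (client_correct hR hrc)
      cases m <;> simp [Payload.Origin, hrc, Payload.news, Payload.entries] at this hm
    have hre := (enteredBy_time hR hi).mono hlt.le
    have hentries : c ∈ m.entries → Genuine P R c ((R.view q).time j) := fun h =>
      (ih r i hrs hi (hlt.trans_le hT) _ hmo c h).mono hlt.le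
    cases m with
    | enter =>
      rw [Payload.news, Finset.mem_singleton] at hm
      subst hm
      exact ⟨hrs, hre, by simp⟩
    | joined =>
      simp only [Payload.news, Finset.mem_insert, Finset.mem_singleton] at hm
      rcases hm with rfl | rfl <;> exact ⟨hrs, hre, by simp⟩
    | leave =>
      rw [Payload.news, Finset.mem_singleton] at hm
      subst hm
      refine ⟨hrs, hre, fun q' hq' hF => ?_⟩
      obtain rfl := Change.leave.inj hq'
      exact ⟨_, hlt.le, i, hi, (horig hF).2, rfl⟩
    | _ => exact hentries hm

omit hD hα in
lemma genuine_initial {q : ID} {c : Change ID} (hc : c ∈ ((R.view q).state 0).changes) (t : ℝ) :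
    Genuine P R c t := by
  rw [(hR.timedView q).init] at hc
  simp only [initState] at hc
  split_ifs at hc
  · simp only [Finset.mem_union, Finset.mem_image] at hc
    rcases hc with ⟨x, hx, rfl⟩ | ⟨x, hx, rfl⟩ <;>
      exact ⟨hR.servers_initially x hx, .inl (.inl hx), by simp⟩
  · simp at hc

omit hD hα in
lemma genuine_of_state {T : ℝ}
    (ih : ∀ r i, P.isClient r = false → R.HasStep r i → (R.view r).time i < T →
      ∀ x ∈ (R.view r).out i, ∀ c ∈ x.2.entries, Genuine P R c ((R.view r).time i))
    {q : ID} {k : ℕ} (hq : q ∉ R.F) (hk : (k : ℕ∞) ≤ (R.view q).len)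
    (hT : ∀ i < k, (R.view q).time i ≤ T) {c : Change ID}
    (hc : c ∈ ((R.view q).state k).changes) : Genuine P R c T := by
  rcases exists_first_change hc with h | ⟨j, hj, h1, h2⟩
  · exact genuine_initial hR h T
  · have hj' : R.HasStep q j := lt_of_lt_of_le (by exact_mod_cast hj) hk
    exact (genuine_of_added hR ih hq hj' (hT j hj) h2 h1).mono (hT j hj)

/-- Entries are authentic in all messages sent by servers, -/
lemma genuine_of_out : ∀ p k, P.isClient p = false → R.HasStep p k →
    ∀ x ∈ (R.view p).out k, ∀ c ∈ x.2.entries, Genuine P R c ((R.view p).time k) := by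
  refine server_induction hR hD hα fun p k hp hk ih x hx c hc => ?_
  by_cases hF : p ∈ R.F
  -- A Byzantine sender can only pass on signed entries. If the subject is correct, the entry was in
  -- the subject's own state by now, and what that state contains came by strictly earlier messages.
  · rcases (hR.unforgeable p hF k hk x hx).1 c hc with ⟨h1, h2⟩ | ⟨h1, k', h2, h3, h4⟩
    · exact ⟨hR.byzantine_server _ h1, h2, fun q hq hqF => by subst hq; exact absurd h1 hqF⟩
    · exact genuine_of_state hR ih h1 h2 h3 h4
  · have hx' := hx
    rw [out_eq hR hF hk] at hx'
    have h := entries_subset_of_origin (origin_of_mem_out hx') hc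
    rw [← state_succ hR hF hk] at h
    refine genuine_of_state hR ih hF (hasStep_succ_le hk) (fun i hi => ?_) h
    exact time_le hR hk (Nat.lt_succ_iff.1 hi)

/-- and in the states of all correct nodes. -/
lemma genuine {p : ID} (hp : p ∉ R.F) {k : ℕ} (hk : R.HasStep p k) {c : Change ID}
    (hc : c ∈ ((R.view p).state k).changes) : Genuine P R c ((R.view p).time k) :=
  genuine_of_state hR (fun r i hr hi _ => genuine_of_out hR hD hα r i hr hi) hp hk.le
    (fun _ hi => time_le hR hk hi.le) hc

lemma genuine_succ {p : ID} (hp : p ∉ R.F) {k : ℕ} (hk : R.HasStep p k) {c : Change ID}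
    (hc : c ∈ ((R.view p).state (k + 1)).changes) : Genuine P R c ((R.view p).time k) :=
  genuine_of_state hR (fun r i hr hi _ => genuine_of_out hR hD hα r i hr hi) hp
    (hasStep_succ_le hk) (fun _ hi => time_le hR hk (Nat.lt_succ_iff.1 hi)) hc

/-- Hence the test for departed senders in `isValid` never suppresses messages of a correct server
that is still there. -/
lemma leave_notMem {p r : ID} (hp : p ∉ R.F) {k : ℕ} (hk : R.HasStep p k) (hr : r ∉ R.F)
    {t : ℝ} (ht : (R.view p).time k ≤ t) (hl : ¬ R.LeftBy r t) :
    .leave r ∉ ((R.view p).state k).changes := fun h =>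
  hl (((genuine hR hD hα hp hk h).left r rfl hr).mono ht)

end Authenticity

/-- The correct server that `c` is about announces `c` at time `τ`; what is known about the servers
in the system initially counts as announced at all times before `0`. -/
inductive Announced (P : Params ID) (R : Run ID V) : Change ID → ℝ → Prop
  | initial {r : ID} {τ : ℝ} : r ∈ R.S₀ → r ∉ R.F → τ < 0 → Announced P R (.enter r) τ
  | enter {r : ID} {τ : ℝ} : P.isClient r = false → r ∉ R.F → R.Occurs r .enter τ →
      Announced P R (.enter r) τ
  | leave {r : ID} {τ : ℝ} : P.isClient r = false → r ∉ R.F → R.Occurs r .leave τ →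
      Announced P R (.leave r) τ

/-- If `c` says that a server has entered, then this server has not left by time `t`. -/
def Fresh (R : Run ID V) (c : Change ID) (t : ℝ) : Prop := ∀ r, c = .enter r → ¬ R.LeftBy r t

lemma Fresh.mono {R : Run ID V} {c : Change ID} {t u : ℝ} (h : Fresh R c u) (htu : t ≤ u) :
    Fresh R c t := fun r hr hl => h r hr (hl.mono htu)

/-- `c` is in `Server_Changes` at `p` after the steps up to time `t`. -/
def KnownBy (R : Run ID V) (p : ID) (c : Change ID) (t : ℝ) : Prop :=
  ∃ j : ℕ, (j : ℕ∞) ≤ (R.view p).len ∧ (∀ i < j, (R.view p).time i ≤ t) ∧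
    c ∈ ((R.view p).state j).changes

/-! ### How announcements spread -/

section Exchange

variable {P : Params ID} {D α : ℝ} {NSmin : ℕ} {R : Run ID V} (hR : IsExecution P D α NSmin R)
include hR

open Run

lemma KnownBy.mem {p : ID} {c : Change ID} {t : ℝ} (h : KnownBy R p c t) (hp : p ∉ R.F) {k : ℕ}
    (hk : R.HasStep p k) (ht : t < (R.view p).time k) : c ∈ ((R.view p).state k).changes := by
  obtain ⟨j, hj, hjt, hc⟩ := h
  have hjk : j ≤ k := by
    by_contra hkj
    exact absurd (hjt k (not_le.1 hkj)) (not_le.2 ht)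
  exact changes_mono hR hp hjk hk.le hc

lemma knownBy_of_step {p : ID} {c : Change ID} {k : ℕ} {t : ℝ} (hk : R.HasStep p k)
    (ht : (R.view p).time k ≤ t) (hc : c ∈ ((R.view p).state (k + 1)).changes) :
    KnownBy R p c t :=
  ⟨k + 1, hasStep_succ_le hk,
    fun _ hi => (time_le hR hk (Nat.lt_succ_iff.1 hi)).trans ht, hc⟩

lemma mem_of_informs {p r : ID} {m : Payload ID V} {k : ℕ} (hp : p ∉ R.F) (hk : R.HasStep p k)
    (hT : (R.view p).trigger k = .receive r m) (hm : m.Informs P p)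
    (hv : ((R.view p).state k).isValid r m = true) {c : Change ID} (hc : c ∈ m.news r) :
    c ∈ ((R.view p).state (k + 1)).changes := by
  rw [state_succ hR hp hk, hT]
  exact news_subset_step hm hv hc

lemma knownBy_of_serverInfo {p s : ID} {i : ℕ} {C : Finset (Change ID)} {c : Change ID}
    (hp : P.isClient p = true) (hi : R.HasStep s i)
    (ho : (.clients, .serverInfo C) ∈ (R.view s).out i) (hc : c ∈ C)
    (ha : ∀ t, (R.view s).time i ≤ t → t ≤ (R.view s).time i + D → R.ActiveAt p t) :
    KnownBy R p c ((R.view s).time i + D) := by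
  obtain ⟨k, hk, hT, -, ht⟩ := exists_receive hR hi ho (q := p) hp ha
  exact knownBy_of_step hR hk ht (mem_of_informs hR (client_correct hR hp) hk hT
    (m := .serverInfo C) hp (by simp [isValid, Payload.label]) (by simpa [Payload.news,
      Payload.entries] using hc))

variable (hD : 0 < D) (hα : 0 < α)
include hD hα

/-- A correct server that is there when `c` is announced learns `c` within time `D` and passes it on
within another `D`. -/
lemma exists_relay {c : Change ID} {τ : ℝ} (hc : Announced P R c τ) {s : ID}
    (hs : P.isClient s = false) (hsF : s ∉ R.F) (hse : R.EnteredBy s τ)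
    (hsl : ¬ R.LeftBy s (τ + D)) (hfr : Fresh R c (τ + D)) :
    c ∈ ((R.view s).state 0).changes ∨
    ∃ i, R.HasStep s i ∧ (R.view s).time i ≤ τ + D ∧ c ∈ ((R.view s).state (i + 1)).changes ∧
      ∀ p, p ∉ R.F → ¬ R.LeftBy s ((R.view s).time i + D) →
        (∀ t, (R.view s).time i ≤ t → t ≤ (R.view s).time i + D → R.ActiveAt p t) →
        KnownBy R p c ((R.view s).time i + D) := by
  have hact : ∀ t, τ ≤ t → t ≤ τ + D → R.ActiveAt s t := fun t h1 h2 =>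
    activeAt_server hR hs (hse.mono h1) fun h => hsl (h.mono h2)
  cases hc with
  | @initial r _ hr hrF hτ =>
    left
    have hsi : R.Initially s := by
      rcases hse with h | ⟨u, hu, h⟩
      · exact h
      · exact absurd (occurs_nonneg hR h) (by linarith)
    rw [(hR.timedView s).init]
    simp [initState, hsi, hr]
  | @enter r _ hrs hrF ho =>
    right
    obtain ⟨i₀, hi₀, hT₀, rfl⟩ := ho
    have hout := (server_enter_out (s := (R.view r).state i₀) hrs).1
    rw [← hT₀, ← out_eq hR hrF hi₀] at hout
    obtain ⟨k, hk, hT, -, hkt⟩ := exists_receive hR hi₀ hout (q := s) hs hact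
    -- This is where `Fresh` is needed: had `r` left, `s` might know it already and discard the
    -- enter message.
    obtain ⟨j, hjk, m', hT', hm', hv⟩ := exists_valid_receive hR hsF hk hT (l := .enter) rfl
      (.inr (leave_notMem hR hD hα hsF hk hrF hkt (hfr r rfl)))
    have hj := hk.of_le hjk
    cases m' <;> simp [Payload.label] at hm'
    have hout' := server_receive_enter_out hs hv
    rw [← hT', ← out_eq hR hsF hj, ← state_succ hR hsF hj] at hout'
    have hmem : .enter r ∈ ((R.view s).state (j + 1)).changes :=
      mem_of_informs hR hsF hj hT' hs hv (by simp [Payload.news])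
    refine ⟨j, hj, (time_le hR hk hjk).trans hkt, hmem, fun p hp hsl' ha => ?_⟩
    by_cases hpc : P.isClient p = true
    · exact knownBy_of_serverInfo hR hpc hj hout'.2 hmem ha
    · simp only [Bool.not_eq_true] at hpc
      obtain ⟨C, K, ho⟩ := hout'.1
      obtain ⟨v, hvs, hTv, -, hvt⟩ := exists_receive hR hj ho (q := p) hpc ha
      -- The echo is broadcast, so `p` learns from it although the answer is meant for `r`. An
      -- earlier echo about `r` from `s` may be the one processed, but every such echo of a correct
      -- server contains `enter r`.
      obtain ⟨v', hvv', m'', hT'', hm'', hval⟩ := exists_valid_receive hR hp hvs hTv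
        (l := .enterEcho r) rfl (.inr (leave_notMem hR hD hα hp hvs hsF hvt hsl'))
      have hv' := hvs.of_le hvv'
      cases m'' <;> simp [Payload.label] at hm''
      subst hm''
      obtain ⟨_, _, ⟨-, -, -, -, hC⟩, -⟩ := receive_origin hR hsF hv' hT''
      exact knownBy_of_step hR hv' ((time_le hR hvs hvv').trans hvt)
        (mem_of_informs hR hp hv' hT'' hpc hval (by simpa [Payload.news, Payload.entries] using hC))
  | @leave r _ hrs hrF ho =>
    right
    obtain ⟨i₀, hi₀, hT₀, rfl⟩ := ho
    have hout := (server_leave_out (s := (R.view r).state i₀) hrs).1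
    rw [← hT₀, ← out_eq hR hrF hi₀] at hout
    obtain ⟨k, hk, hT, -, hkt⟩ := exists_receive hR hi₀ hout (q := s) hs hact
    obtain ⟨j, hjk, m', hT', hm', hv⟩ := exists_valid_receive hR hsF hk hT (l := .leave) rfl
      (.inl rfl)
    have hj := hk.of_le hjk
    cases m' <;> simp [Payload.label] at hm'
    have hout' := server_receive_leave_out hs hv
    rw [← hT', ← out_eq hR hsF hj, ← state_succ hR hsF hj] at hout'
    have hmem : .leave r ∈ ((R.view s).state (j + 1)).changes :=
      mem_of_informs hR hsF hj hT' hs hv (by simp [Payload.news])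
    refine ⟨j, hj, (time_le hR hk hjk).trans hkt, hmem, fun p hp hsl' ha => ?_⟩
    by_cases hpc : P.isClient p = true
    · exact knownBy_of_serverInfo hR hpc hj hout'.2 hmem ha
    · simp only [Bool.not_eq_true] at hpc
      obtain ⟨v, hvs, hTv, -, hvt⟩ := exists_receive hR hj hout'.1 (q := p) hpc ha
      obtain ⟨v', hvv', m'', hT'', hm'', hval⟩ := exists_valid_receive hR hp hvs hTv
        (l := .leaveEcho r) rfl (.inr (leave_notMem hR hD hα hp hvs hsF hvt hsl'))
      have hv' := hvs.of_le hvv'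
      cases m'' <;> simp [Payload.label] at hm''
      subst hm''
      exact knownBy_of_step hR hv' ((time_le hR hvs hvv').trans hvt)
        (mem_of_informs hR hp hv' hT'' hpc hval (by simp [Payload.news, Payload.entries]))

/-- A correct node that is there when `c` is announced learns `c` within time `D`. -/
lemma knownBy_of_announced {c : Change ID} {τ : ℝ} (hc : Announced P R c τ) {p : ID}
    (hp : p ∉ R.F) (hpe : R.EnteredBy p τ)
    (ha : ∀ t, τ ≤ t → t ≤ τ + D → R.ActiveAt p t) (hfr : Fresh R c (τ + D)) :
    KnownBy R p c (τ + D) := by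
  by_cases hpc : P.isClient p = true
  · cases hc with
    | @initial r _ hr hrF hτ =>
      have hpi : R.Initially p := by
        rcases hpe with h | ⟨u, hu, h⟩
        · exact h
        · exact absurd (occurs_nonneg hR h) (by linarith)
      refine ⟨0, by simp, by simp, ?_⟩
      rw [(hR.timedView p).init]
      simp [initState, hpi, hr]
    | @enter r _ hrs hrF ho =>
      obtain ⟨i₀, hi₀, hT₀, rfl⟩ := ho
      have hout := (server_enter_out (s := (R.view r).state i₀) hrs).2
      rw [← hT₀, ← out_eq hR hrF hi₀, ← state_succ hR hrF hi₀] at hout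
      exact knownBy_of_serverInfo hR hpc hi₀ hout.1 hout.2 ha
    | @leave r _ hrs hrF ho =>
      obtain ⟨i₀, hi₀, hT₀, rfl⟩ := ho
      have hout := (server_leave_out (s := (R.view r).state i₀) hrs).2
      rw [← hT₀, ← out_eq hR hrF hi₀, ← state_succ hR hrF hi₀] at hout
      exact knownBy_of_serverInfo hR hpc hi₀ hout.1 hout.2 ha
  · simp only [Bool.not_eq_true] at hpc
    rcases exists_relay hR hD hα hc hpc hp hpe
      (ha (τ + D) (by linarith) le_rfl).1.2 hfr with h | ⟨i, hi, ht, hmem, -⟩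
    · exact ⟨0, by simp, by simp, h⟩
    · exact knownBy_of_step hR hi ht hmem

/-! ### Enter messages and their echoes -/

omit hD hα in
/-- Where an echo to `p` from a correct server comes from. -/
lemma echo_origin {p s : ID} (hp : p ∉ R.F) (hs : s ∉ R.F) {v : ℕ} (hv : R.HasStep p v)
    {C : Finset (Change ID)} {K : Finset (Entry ID V)} {j : Bool}
    (hT : (R.view p).trigger v = .receive s (echoMsg P p C K j)) :
    ∃ w, R.HasStep s w ∧ P.isClient s = false ∧ ¬ R.Initially p ∧
      (R.view s).trigger w = .receive p (if P.isClient p then .enterClient else .enter) ∧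
      C = ((R.view s).state (w + 1)).changes ∧ j = ((R.view s).state w).isJoined ∧
      (R.view p).time 0 < (R.view s).time w ∧ (R.view s).time w ≤ (R.view p).time 0 + D ∧
      (R.view s).time w < (R.view p).time v ∧ (R.view p).time v ≤ (R.view s).time w + D := by
  obtain ⟨w, hw, ho, h1, h2⟩ := receive_origin hR hs hv hT
  have key : P.isClient s = false ∧
      (R.view s).trigger w = .receive p (if P.isClient p then .enterClient else .enter) ∧
      C = ((R.view s).state (w + 1)).changes ∧ j = ((R.view s).state w).isJoined := by
    unfold echoMsg at ho
    split_ifs at ho ⊢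
    · exact ho
    · exact ⟨ho.1, ho.2.1, ho.2.2.1, ho.2.2.2.1⟩
  obtain ⟨k1, k2, k3, k4⟩ := key
  obtain ⟨i, hi, ho', h3, h4⟩ := receive_origin hR hp hw k2
  have hTi : (R.view p).trigger i = .enter := by
    split_ifs at ho'
    exacts [ho', ho'.2]
  obtain ⟨rfl, hini⟩ := (occurs_enter_iff hR hi).1 hTi
  exact ⟨w, hw, k1, hini, k2, k3, k4, h3, h4, h1, h2⟩

/-- A correct server that is there when `p` enters answers with an echo, which `p` processes. -/
lemma exists_echo {p s : ID} (hp : p ∉ R.F) (hpi : ¬ R.Initially p) (hp0 : R.HasStep p 0)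
    (hs : P.isClient s = false) (hsF : s ∉ R.F) (hse : R.EnteredBy s ((R.view p).time 0))
    (hsl : ¬ R.LeftBy s ((R.view p).time 0 + 2 * D))
    (ha : ∀ t, (R.view p).time 0 ≤ t → t ≤ (R.view p).time 0 + 2 * D → R.ActiveAt p t) :
    ∃ w v, R.HasStep s w ∧ (R.view p).time 0 < (R.view s).time w ∧
      (R.view s).time w ≤ (R.view p).time 0 + D ∧
      R.HasStep p v ∧ (R.view s).time w < (R.view p).time v ∧
      (R.view p).time v ≤ (R.view s).time w + D ∧
      IsEcho P p ((R.view p).trigger v) ((R.view p).state v) s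
        ((R.view s).state (w + 1)).changes ((R.view s).state w).isJoined := by
  set hello : Payload ID V := if P.isClient p then .enterClient else .enter with hhello
  have hello' : hello = .enter ∨ hello = .enterClient := by rw [hhello]; split_ifs <;> simp
  have hTp : (R.view p).trigger 0 = .enter := (occurs_enter_iff hR hp0).2 ⟨rfl, hpi⟩
  have hout : (.servers, hello) ∈ (R.view p).out 0 := by
    rw [out_eq hR hp hp0, hTp, hhello]
    split_ifs with hpc
    · exact client_enter_out hpc
    · exact (server_enter_out (by simpa using hpc)).1
  obtain ⟨w, hw, hTw, hw1, hw2⟩ := exists_receive hR hp0 hout (q := s) hs fun t h1 h2 =>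
    activeAt_server hR hs (hse.mono h1) fun h => hsl (h.mono (by linarith))
  have hecho : ∃ d C K, d.BroadcastTo P p ∧
      (d, echoMsg P p C K ((R.view s).state w).isJoined) ∈ (R.view s).out w := by
    rw [out_eq hR hsF hw, hTw, hhello]
    unfold echoMsg
    split_ifs with hpc
    · obtain ⟨C, K, h⟩ := server_receive_enterClient_out (s := (R.view s).state w) hs hpc
      exact ⟨.clients, C, K, hpc, h⟩
    -- The answer is only given to a valid enter message: it is the first one because `p` sends only
    -- one, and `p` is not known to have left because it is still there.
    · have hv : ((R.view s).state w).isValid p .enter = true := by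
        rw [isValid_of_label rfl, mem_heard_iff hR hsF hw.le]
        refine ⟨?_, .inr (leave_notMem hR hD hα hsF hw hp hw2
          (ha _ (by linarith) (by linarith)).1.2)⟩
        rintro ⟨j, hj, m, hTj, hm⟩
        cases m <;> simp [Payload.label] at hm
        rw [hhello, if_neg hpc] at hTw
        exact absurd (receive_enter_unique hR hp (.inl rfl) (hw.of_le hj.le) hw hTj hTw) hj.ne
      obtain ⟨⟨C, K, h⟩, -⟩ := server_receive_enter_out hs hv
      exact ⟨.servers, C, K, by simpa [Dest.BroadcastTo] using hpc, h⟩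
  obtain ⟨d, C, K, hd, ho⟩ := hecho
  obtain ⟨v, hv, hTv, hv1, hv2⟩ := exists_receive hR hw ho (q := p) hd fun t h1 h2 =>
    ha t (by linarith) (by linarith)
  have hlab : ∀ C (K : Finset (Entry ID V)) j, (echoMsg P p C K j).label =
      some (if P.isClient p then .enterClientEcho p else .enterEcho p) := by
    intro C K j; unfold echoMsg; split_ifs <;> rfl
  obtain ⟨v', hvv', m', hT', hm', hval⟩ := exists_valid_receive hR hp hv hTv (hlab _ _ _)
    (.inr (leave_notMem hR hD hα hp hv hsF hv2 fun h => hsl (h.mono (by linarith))))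
  have hv' := hv.of_le hvv'
  obtain ⟨C', K', j', rfl⟩ : ∃ C' K' j', m' = echoMsg P p C' K' j' := by
    unfold echoMsg
    split_ifs at hm' ⊢ <;> cases m' <;> simp [Payload.label] at hm' <;> subst hm' <;>
      exact ⟨_, _, _, rfl⟩
  obtain ⟨w', hw', -, -, hTw', rfl, rfl, -, -, h1, -⟩ := echo_origin hR hp hsF hv' hT'
  -- The echo that is processed may be received before the one found above, but it too answers the
  -- only announcement of `p`, so it was sent in the same step `w`.
  obtain rfl : w = w' := receive_enter_unique hR hp hello' hw hw' hTw hTw'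
  exact ⟨w, v', hw, hw1, hw2, hv', h1, (time_le hR hv hvv').trans hv2, K', hT', hval⟩

end Exchange

/-! ### Counting echoes: the variables of the join protocol as cardinalities -/

lemma echoMsg_inj {P : Params ID} {p : ID} {C C' : Finset (Change ID)}
    {K K' : Finset (Entry ID V)} {j j' : Bool} (h : echoMsg P p C K j = echoMsg P p C' K' j') :
    C = C' ∧ K = K' ∧ j = j' := by
  unfold echoMsg at h
  split_ifs at h <;> simp_all

lemma echoMsg_label {P : Params ID} {p : ID} (C : Finset (Change ID))
    (K : Finset (Entry ID V)) (j : Bool) : (echoMsg P p C K j).label =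
      some (if P.isClient p then .enterClientEcho p else .enterEcho p) := by
  unfold echoMsg; split_ifs <;> rfl

namespace Run

/-- In step `i`, `p` processes an echo from `s` with entries `C` and joined-flag `j`. -/
def EchoAt (R : Run ID V) (P : Params ID) (p : ID) (i : ℕ) (s : ID) (C : Finset (Change ID))
    (j : Bool) : Prop :=
  IsEcho P p ((R.view p).trigger i) ((R.view p).state i) s C j

/-- The senders of the echoes processed before step `k`. -/
def echoers (R : Run ID V) (P : Params ID) (p : ID) (k : ℕ) : Set ID :=
  {s | ∃ i < k, ∃ C j, R.EchoAt P p i s C j}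

/-- The senders of the echoes with positive joined-flag processed before step `k`. -/
def joinedEchoers (R : Run ID V) (P : Params ID) (p : ID) (k : ℕ) : Set ID :=
  {s | ∃ i < k, ∃ C, R.EchoAt P p i s C true}

/-- The value that `join_bound` gets if it is set in a step before step `k`. -/
def JoinBound (R : Run ID V) (P : Params ID) (p : ID) (k : ℕ) (x : ℝ) : Prop :=
  ∃ i < k, ∃ s C j, R.EchoAt P p i s C j ∧ P.f < (R.joinedEchoers P p (i + 1)).ncard ∧
    x = P.γ * (presentIn (((R.view p).state i).changes ∪ C)).card

/-- How the variables of the join protocol are related before step `k`. -/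
def JoinVars (R : Run ID V) (P : Params ID) (p : ID) (k : ℕ) : Prop :=
  ((R.view p).state k).echoCounter = (R.echoers P p k).ncard ∧
  (((R.view p).state k).joinBound = 0 ∧
      ((R.view p).state k).echoFromJoinedCounter = (R.joinedEchoers P p k).ncard ∧
      ((R.joinedEchoers P p k).ncard ≤ P.f ∨ R.JoinBound P p k 0) ∨
    ((R.view p).state k).joinBound ≠ 0 ∧ R.JoinBound P p k ((R.view p).state k).joinBound)

lemma JoinBound.mono {R : Run ID V} {P : Params ID} {p : ID} {k l : ℕ} {x : ℝ}
    (h : R.JoinBound P p k x) (hkl : k ≤ l) : R.JoinBound P p l x :=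
  let ⟨i, hi, h⟩ := h
  ⟨i, hi.trans_le hkl, h⟩

lemma EchoAt.unique {R : Run ID V} {P : Params ID} {p : ID} {i : ℕ} {s s' : ID}
    {C C' : Finset (Change ID)} {j j' : Bool} (h : R.EchoAt P p i s C j)
    (h' : R.EchoAt P p i s' C' j') : s = s' ∧ C = C' ∧ j = j' := by
  obtain ⟨K, h1, -⟩ := h
  obtain ⟨K', h2, -⟩ := h'
  rw [h1] at h2
  obtain ⟨rfl, h3⟩ := Trigger.receive.inj h2
  obtain ⟨h4, -, h5⟩ := echoMsg_inj h3
  exact ⟨rfl, h4, h5⟩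

lemma echoers_succ {R : Run ID V} {P : Params ID} {p : ID} {k : ℕ} {s : ID}
    {C : Finset (Change ID)} {j : Bool} (h : R.EchoAt P p k s C j) :
    R.echoers P p (k + 1) = insert s (R.echoers P p k) := by
  ext s'
  simp only [echoers, Set.mem_ofPred_eq, Set.mem_insert_iff]
  constructor
  · rintro ⟨i, hi, C', j', h'⟩
    rcases Nat.lt_succ_iff_lt_or_eq.1 hi with hi | rfl
    exacts [.inr ⟨i, hi, C', j', h'⟩, .inl (h'.unique h).1]
  · rintro (rfl | ⟨i, hi, h'⟩)
    exacts [⟨k, Nat.lt_succ_self k, C, j, h⟩, ⟨i, hi.trans (Nat.lt_succ_self k), h'⟩]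

lemma joinedEchoers_succ {R : Run ID V} {P : Params ID} {p : ID} {k : ℕ} {s : ID}
    {C : Finset (Change ID)} {j : Bool} (h : R.EchoAt P p k s C j) :
    R.joinedEchoers P p (k + 1) =
      if j = true then insert s (R.joinedEchoers P p k) else R.joinedEchoers P p k := by
  ext s'
  simp only [joinedEchoers, Set.mem_ofPred_eq]
  split_ifs with hj
  · subst hj
    simp only [Set.mem_insert_iff, Set.mem_ofPred_eq]
    constructor
    · rintro ⟨i, hi, C', h'⟩
      rcases Nat.lt_succ_iff_lt_or_eq.1 hi with hi | rfl
      exacts [.inr ⟨i, hi, C', h'⟩, .inl (h'.unique h).1]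
    · rintro (rfl | ⟨i, hi, h'⟩)
      exacts [⟨k, Nat.lt_succ_self k, C, h⟩, ⟨i, hi.trans (Nat.lt_succ_self k), h'⟩]
  · simp only [Set.mem_ofPred_eq]
    constructor
    · rintro ⟨i, hi, C', h'⟩
      rcases Nat.lt_succ_iff_lt_or_eq.1 hi with hi | rfl
      exacts [⟨i, hi, C', h'⟩, absurd (h.unique h').2.2 hj]
    · rintro ⟨i, hi, h'⟩
      exact ⟨i, hi.trans (Nat.lt_succ_self k), h'⟩

lemma echoers_succ_of_not {R : Run ID V} {P : Params ID} {p : ID} {k : ℕ}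
    (h : ∀ s C j, ¬ R.EchoAt P p k s C j) :
    R.echoers P p (k + 1) = R.echoers P p k ∧
      R.joinedEchoers P p (k + 1) = R.joinedEchoers P p k := by
  constructor <;> ext s' <;> simp only [echoers, joinedEchoers, Set.mem_ofPred_eq]
  · constructor
    · rintro ⟨i, hi, C', j', h'⟩
      rcases Nat.lt_succ_iff_lt_or_eq.1 hi with hi | rfl
      exacts [⟨i, hi, C', j', h'⟩, absurd h' (h _ _ _)]
    · rintro ⟨i, hi, h'⟩
      exact ⟨i, hi.trans (Nat.lt_succ_self k), h'⟩
  · constructor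
    · rintro ⟨i, hi, C', h'⟩
      rcases Nat.lt_succ_iff_lt_or_eq.1 hi with hi | rfl
      exacts [⟨i, hi, C', h'⟩, absurd h' (h _ _ _)]
    · rintro ⟨i, hi, h'⟩
      exact ⟨i, hi.trans (Nat.lt_succ_self k), h'⟩

lemma joinedEchoers_subset (R : Run ID V) (P : Params ID) (p : ID) (k : ℕ) :
    R.joinedEchoers P p k ⊆ R.echoers P p k := fun _ ⟨i, hi, C, h⟩ => ⟨i, hi, C, true, h⟩

lemma finite_echoers (R : Run ID V) (P : Params ID) (p : ID) (k : ℕ) :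
    (R.echoers P p k).Finite := by
  induction k with
  | zero => simp [echoers]
  | succ k ih =>
    by_cases h : ∃ s C j, R.EchoAt P p k s C j
    · obtain ⟨s, C, j, h⟩ := h
      rw [echoers_succ h]
      exact ih.insert s
    · push Not at h
      rw [(echoers_succ_of_not h).1]
      exact ih

lemma finite_joinedEchoers (R : Run ID V) (P : Params ID) (p : ID) (k : ℕ) :
    (R.joinedEchoers P p k).Finite :=
  (R.finite_echoers P p k).subset (R.joinedEchoers_subset P p k)

end Run

section JoinProtocol

variable {P : Params ID} {D α : ℝ} {NSmin : ℕ} {R : Run ID V} (hR : IsExecution P D α NSmin R)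
include hR

open Run

/-- Validity admits one echo per sender, so the counters count distinct servers. -/
lemma notMem_echoers {p : ID} (hp : p ∉ R.F) {k : ℕ} (hk : R.HasStep p k) {s : ID}
    {C : Finset (Change ID)} {j : Bool} (h : R.EchoAt P p k s C j) : s ∉ R.echoers P p k := by
  rintro ⟨i, hi, C', j', K', hT', -⟩
  obtain ⟨K, -, hv⟩ := h
  rw [isValid_of_label (echoMsg_label _ _ _), mem_heard_iff hR hp hk.le] at hv
  exact hv.1 ⟨i, hi, _, hT', echoMsg_label _ _ _⟩

/-- The condition for joining is tested right after each counted echo. Thus it holds when the node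
joins, and its failure is preserved as long as the node has not joined. -/
lemma joinVars_succ {p : ID} (hp : p ∉ R.F) {k : ℕ} (hk : R.HasStep p k)
    (hj : ((R.view p).state k).isJoined = false) (ih : R.JoinVars P p k) :
    R.JoinVars P p (k + 1) ∧ (((R.view p).state (k + 1)).isJoined = true →
      0 < ((R.view p).state (k + 1)).joinBound ∧
      ((R.view p).state (k + 1)).joinBound ≤ (R.echoers P p (k + 1)).ncard) ∧
      (((R.view p).state (k + 1)).isJoined = false →
        ((R.view p).state k).joinBound ≤ 0 ∨
          (R.echoers P p k).ncard < ((R.view p).state k).joinBound →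
        ((R.view p).state (k + 1)).joinBound ≤ 0 ∨
          (R.echoers P p (k + 1)).ncard < ((R.view p).state (k + 1)).joinBound) := by
  unfold JoinVars at ih ⊢
  obtain ⟨ih1, ih2⟩ := ih
  by_cases h : ∃ s C j, R.EchoAt P p k s C j
  · obtain ⟨s, C, j, h⟩ := h
    have hnot := notMem_echoers hR hp hk h
    have hnot' : s ∉ R.joinedEchoers P p k := fun h' => hnot (R.joinedEchoers_subset P p k h')
    have hA : (R.echoers P p (k + 1)).ncard = (R.echoers P p k).ncard + 1 := by
      rw [echoers_succ h, Set.ncard_insert_of_notMem hnot (R.finite_echoers P p k)]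
    have hB := joinedEchoers_succ h
    have hB' : j = true → (R.joinedEchoers P p (k + 1)).ncard =
        (R.joinedEchoers P p k).ncard + 1 := by
      intro hj
      rw [hB, if_pos hj, Set.ncard_insert_of_notMem hnot' (R.finite_joinedEchoers P p k)]
    have hcount : CountsEcho P j (((R.view p).state k).changes ∪ C) ((R.view p).state k)
        ((R.view p).state (k + 1)) := by
      obtain ⟨K, hT, hv⟩ := h
      rw [state_succ hR hp hk, hT]
      exact countsEcho_step hv hj
    obtain ⟨c1, c2, c3⟩ := hcount
    have hec : ((R.view p).state (k + 1)).echoCounter = (R.echoers P p (k + 1)).ncard := by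
      rw [c1, ih1, hA]
    rw [hec] at c3
    refine ⟨⟨hec, ?_⟩, fun hJ => (c3.1 hJ).symm, fun hJ _ => ?_⟩
    · rcases ih2 with ⟨h1, h2, h3⟩ | ⟨h1, h2⟩
      · by_cases hjt : j = true
        · rw [if_pos ⟨hjt, h1⟩, h2] at c2
          rw [hB' hjt]
          by_cases hf : P.f < (R.joinedEchoers P p k).ncard + 1
          · have hjb : R.JoinBound P p (k + 1)
                (P.γ * (presentIn (((R.view p).state k).changes ∪ C)).card) :=
              ⟨k, Nat.lt_succ_self k, s, C, j, h, by rwa [hB' hjt], rfl⟩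
            rw [if_pos hf] at c2
            rw [← c2.2] at hjb
            -- The code does not distinguish an assigned `join_bound` of value `0` from an
            -- unassigned one; it goes on counting joined echoes and assigns again. This is the
            -- reason for the alternative `JoinBound P p k 0` in `JoinVars`.
            by_cases h0 : ((R.view p).state (k + 1)).joinBound = 0
            · exact .inl ⟨h0, c2.1, .inr (by rwa [h0] at hjb)⟩
            · exact .inr ⟨h0, hjb⟩
          · rw [if_neg hf] at c2
            exact .inl ⟨c2.2, c2.1, .inl (not_lt.1 hf)⟩
        · rw [if_neg (fun h => hjt h.1)] at c2
          rw [hB, if_neg hjt]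
          exact .inl ⟨c2.2.trans h1, c2.1.trans h2, h3.imp_right (·.mono (Nat.le_succ k))⟩
      · rw [if_neg (fun h => h1 h.2)] at c2
        rw [c2.2]
        exact .inr ⟨h1, h2.mono (Nat.le_succ k)⟩
    · by_contra hc
      push Not at hc
      rw [c3.2 ⟨hc.2, hc.1⟩] at hJ
      simp at hJ
  · push Not at h
    obtain ⟨h1, h2, h3, h4, -⟩ := step_not_echo h
    rw [← state_succ hR hp hk] at h1 h2 h3 h4
    obtain ⟨e1, e2⟩ := echoers_succ_of_not h
    rw [h1, h2, h3, h4, e1, e2]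
    refine ⟨⟨ih1, ih2.imp (fun h => ⟨h.1, h.2.1, h.2.2.imp_right (·.mono (Nat.le_succ k))⟩)
      (fun h => ⟨h.1, h.2.mono (Nat.le_succ k)⟩)⟩, fun h => ?_, fun _ => id⟩
    rw [hj] at h
    simp at h

lemma joinVars {p : ID} (hp : p ∉ R.F) {k : ℕ} (hk : (k : ℕ∞) ≤ (R.view p).len)
    (hj : ((R.view p).state k).isJoined = false) :
    R.JoinVars P p k ∧ (((R.view p).state k).joinBound ≤ 0 ∨
      (R.echoers P p k).ncard < ((R.view p).state k).joinBound) := by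
  induction k with
  | zero =>
    unfold JoinVars
    rw [(hR.timedView p).init]
    simp [initState, echoers, joinedEchoers]
  | succ k ih =>
    have hk' : R.HasStep p k := lt_of_lt_of_le (by exact_mod_cast Nat.lt_succ_self k) hk
    have hj' : ((R.view p).state k).isJoined = false := by
      by_contra h
      rw [isJoined_mono hR hp (Nat.le_succ k) hk (by simpa using h)] at hj
      simp at hj
    obtain ⟨ih1, ih2⟩ := ih hk'.le hj'
    obtain ⟨h1, -, h3⟩ := joinVars_succ hR hp hk' hj' ih1
    exact ⟨h1, h3 hj ih2⟩

/-- A node that has joined did so after receiving as many echoes as `join_bound` requires. -/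
lemma joinBound_of_isJoined {p : ID} (hp : p ∉ R.F) (hpi : ¬ R.Initially p) {k : ℕ}
    (hk : (k : ℕ∞) ≤ (R.view p).len) (hj : ((R.view p).state k).isJoined = true) :
    ∃ x, R.JoinBound P p k x ∧ x ≤ (R.echoers P p k).ncard := by
  induction k with
  | zero =>
    rw [(hR.timedView p).init] at hj
    simp [initState, hpi] at hj
  | succ k ih =>
    have hk' : R.HasStep p k := lt_of_lt_of_le (by exact_mod_cast Nat.lt_succ_self k) hk
    have hsub : R.echoers P p k ⊆ R.echoers P p (k + 1) :=
      fun s ⟨i, hi, h⟩ => ⟨i, hi.trans (Nat.lt_succ_self k), h⟩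
    have hmono : ((R.echoers P p k).ncard : ℝ) ≤ (R.echoers P p (k + 1)).ncard := by
      exact_mod_cast Set.ncard_le_ncard hsub (R.finite_echoers P p (k + 1))
    cases hj' : ((R.view p).state k).isJoined
    · obtain ⟨h1, h2, -⟩ := joinVars_succ hR hp hk' hj' (joinVars hR hp hk'.le hj').1
      obtain ⟨h3, h4⟩ := h2 hj
      refine ⟨_, ?_, h4⟩
      rcases h1.2 with h | h
      · exact absurd h.1 h3.ne'
      · exact h.2
    · obtain ⟨x, h1, h2⟩ := ih hk'.le hj'
      exact ⟨x, h1.mono (Nat.le_succ k), h2.trans hmono⟩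

/-- A node that has not joined has not yet received as many echoes as required. -/
lemma joinBound_of_not_isJoined {p : ID} (hp : p ∉ R.F) {k : ℕ}
    (hk : (k : ℕ∞) ≤ (R.view p).len) (hj : ((R.view p).state k).isJoined = false)
    (hf : P.f < (R.joinedEchoers P p k).ncard) :
    ∃ x, R.JoinBound P p k x ∧ (x ≤ 0 ∨ (R.echoers P p k).ncard < x) := by
  obtain ⟨⟨-, h1⟩, h2⟩ := joinVars hR hp hk hj
  rcases h1 with ⟨-, -, h | h⟩ | ⟨-, h⟩
  · exact absurd hf (not_lt.2 h)
  · exact ⟨0, h, .inl le_rfl⟩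
  · exact ⟨_, h, h2⟩

/-- Among more than `f` nodes one is correct. -/
lemma exists_correct {S : Set ID} (hS : P.f < S.ncard) : ∃ s ∈ S, s ∉ R.F := by
  by_contra h
  push Not at h
  have : S.ncard ≤ R.F.card := by
    rw [← Set.ncard_coe_finset]
    exact Set.ncard_le_ncard h R.F.finite_toSet
  exact absurd (this.trans hR.byzantine_card) (not_le.2 hS)

end JoinProtocol

/-- In step `k`, node `p` was in the system initially, has joined, or has been in the system for
longer than `2 * D`. -/
def Ready (R : Run ID V) (D : ℝ) (p : ID) (k : ℕ) : Prop :=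
  R.Initially p ∨ ((R.view p).state k).isJoined = true ∨
    (R.view p).time 0 + 2 * D < (R.view p).time k

/-- In step `k`, node `p` knows all that was announced more than `2 * D` earlier. -/
def Informed (P : Params ID) (R : Run ID V) (D : ℝ) (p : ID) (k : ℕ) : Prop :=
  ∀ c τ, Announced P R c τ → τ + 2 * D < (R.view p).time k → Fresh R c ((R.view p).time k) →
    c ∈ ((R.view p).state k).changes

/-! ### What a node knows after `2 * D`, and why servers join -/

section Knowledge

variable {P : Params ID} {D α : ℝ} {NSmin : ℕ} {R : Run ID V} (hR : IsExecution P D α NSmin R)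
include hR

open Run

/-- Nothing happens before time `0`, so cutting a window off at `0` costs nothing. -/
lemma InBefore.of_max_zero {p : ID} {x : ℝ} (h : R.InBefore p (max 0 x)) : R.InBefore p x := by
  refine h.imp_right fun ⟨u, hu, ho⟩ => ⟨u, ?_, ho⟩
  rcases lt_max_iff.1 hu with h | h
  · exact absurd (occurs_nonneg hR ho) (not_le.2 h)
  · exact h

lemma ready_of_inBefore {p : ID} {x : ℝ} (h : R.InBefore p x) {k : ℕ}
    (hx : x + 2 * D ≤ (R.view p).time k) :
    R.Initially p ∨ (R.view p).time 0 + 2 * D < (R.view p).time k := by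
  refine h.imp_right ?_
  rintro ⟨u, hu, j, hj, hT, rfl⟩
  obtain ⟨rfl, -⟩ := (occurs_enter_iff hR hj).1 hT
  linarith

lemma EchoAt.subset {p s : ID} (hp : p ∉ R.F) {v k : ℕ} (hk : (k : ℕ∞) ≤ (R.view p).len)
    (hvk : v < k) {C : Finset (Change ID)} {j : Bool} (h : R.EchoAt P p v s C j) :
    C ⊆ ((R.view p).state k).changes := by
  have hv : R.HasStep p v := lt_of_lt_of_le (by exact_mod_cast hvk) hk
  obtain ⟨K, hT, hval⟩ := h
  intro c hc
  refine changes_mono hR hp hvk hk (mem_of_informs hR hp hv hT ?_ hval ?_)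
  · unfold echoMsg
    split_ifs with h
    · exact ⟨h, rfl⟩
    · simpa [Payload.Informs] using h
  · unfold echoMsg
    split_ifs <;> exact hc

lemma EchoAt.origin {p s : ID} (hp : p ∉ R.F) (hs : s ∉ R.F) {v : ℕ} (hv : R.HasStep p v)
    {C : Finset (Change ID)} {j : Bool} (h : R.EchoAt P p v s C j) :
    ∃ w, R.HasStep s w ∧ P.isClient s = false ∧
      C = ((R.view s).state (w + 1)).changes ∧ j = ((R.view s).state w).isJoined ∧
      (R.view p).time 0 < (R.view s).time w ∧ (R.view s).time w ≤ (R.view p).time 0 + D ∧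
      (R.view s).time w < (R.view p).time v := by
  obtain ⟨K, hT, -⟩ := h
  obtain ⟨w, h1, h2, -, -, h3, h4, h5, h6, h7, -⟩ := echo_origin hR hp hs hv hT
  exact ⟨w, h1, h2, h3, h4, h5, h6, h7⟩

variable (hD : 0 < D) (hα : 0 < α)
include hD hα

/-- What a server that answered the enter message of `p` learned at first hand also gets to `p`. -/
lemma mem_of_echo {p s : ID} (hp : p ∉ R.F) (hs : P.isClient s = false) (hsF : s ∉ R.F)
    {k v w : ℕ} (hk : R.HasStep p k) (hvk : v < k) (hw : R.HasStep s w)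
    (hpw : (R.view p).time 0 < (R.view s).time w) {j : Bool}
    (h : R.EchoAt P p v s ((R.view s).state (w + 1)).changes j) {c : Change ID} {τ : ℝ}
    (hc : Announced P R c τ) (hse : R.EnteredBy s τ) (hsl : ¬ R.LeftBy s (τ + 2 * D))
    (hτ : τ + 2 * D < (R.view p).time k) (hfr : Fresh R c ((R.view p).time k)) :
    c ∈ ((R.view p).state k).changes := by
  have hsub := EchoAt.subset hR hp hk.le hvk h
  rcases exists_relay hR hD hα hc hs hsF hse (fun h => hsl (h.mono (by linarith)))
    (hfr.mono (by linarith)) with h0 | ⟨i, hi, hit, hci, hrel⟩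
  · exact hsub (changes_mono hR hsF (Nat.zero_le _) (hasStep_succ_le hw) h0)
  -- If `s` learned `c` by the time it answered, the answer contains `c`. Otherwise `s` passes `c`
  -- on when `p` is already in the system, and `p` has it by time `τ + 2 * D`.
  · rcases le_or_gt i w with hiw | hiw
    · exact hsub (changes_mono hR hsF (Nat.succ_le_succ hiw) (hasStep_succ_le hw) hci)
    · have h1 := time_le hR hi hiw.le
      refine KnownBy.mem hR (hrel p hp (fun h => hsl (h.mono (by linarith))) fun t h2 h3 =>
        activeAt_of_step hR hk ?_ (by linarith)) hp hk (by linarith)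
      exact (enteredBy_time hR (hk.of_le (Nat.zero_le k))).mono (by linarith)

/-- The servers of the core are present in the view of a node which has processed an echo from an
informed server. -/
lemma mem_presentIn_of_core {p s : ID} (hp : p ∉ R.F) (hsF : s ∉ R.F) {i v w : ℕ}
    (hi : R.HasStep p i) (hvi : v ≤ i) (hit : (R.view p).time i ≤ (R.view p).time 0 + 2 * D)
    (hpw : (R.view p).time 0 < (R.view s).time w)
    (hwp : (R.view s).time w ≤ (R.view p).time 0 + D) (hw : R.HasStep s w)
    (hinf : Informed P R D s w) {j : Bool}
    (h : R.EchoAt P p v s ((R.view s).state (w + 1)).changes j) {s₁ : ID}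
    {C₁ : Finset (Change ID)} {j₁ : Bool} (h₁ : R.EchoAt P p i s₁ C₁ j₁) {r : ID}
    (hr : r ∈ coreSet P D R (max 0 ((R.view p).time 0 - 2 * D))) :
    r ∈ presentIn (((R.view p).state i).changes ∪ C₁) := by
  obtain ⟨hrc, hrF, hre, hrl⟩ := hr
  have hp0 := (hR.timedView p).nonneg 0 (hi.of_le (Nat.zero_le i))
  have hb := le_max_right 0 ((R.view p).time 0 - 2 * D)
  have hfr : Fresh R (.enter r) ((R.view s).time w) := by
    intro r' hr' hl
    obtain rfl := Change.enter.inj hr'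
    exact hrl (hl.mono (by linarith))
  have hmem : .enter r ∈ ((R.view s).state w).changes := by
    rcases InBefore.of_max_zero hR hre with hri | ⟨u, hu, ho⟩
    -- A server present from the start has no enter event; `-(2 * D)` serves as a fictitious time of
    -- announcement, more than `2 * D` before step `w`.
    · exact hinf _ (-(2 * D)) (.initial ((initially_server hR hrc).1 hri) hrF (by linarith))
        (by linarith) hfr
    · exact hinf _ u (.enter hrc hrF ho) (by linarith) hfr
  have hmem' := changes_mono hR hsF (Nat.le_succ w) (hasStep_succ_le hw) hmem
  rw [mem_presentIn]
  constructor
  -- The echo may be the very one processed in step `i`; its entries are then in `C₁`, not yet in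
  -- the state before step `i`.
  · rcases hvi.lt_or_eq with hvi | rfl
    · exact Finset.mem_union_left _ (EchoAt.subset hR hp hi.le hvi h hmem')
    · rw [← (h.unique h₁).2.1]
      exact Finset.mem_union_right _ hmem'
  · intro hl
    have hsub : ((R.view p).state i).changes ∪ C₁ ⊆ ((R.view p).state (i + 1)).changes :=
      Finset.union_subset (changes_mono hR hp (Nat.le_succ i) (hasStep_succ_le hi))
        (EchoAt.subset hR hp (hasStep_succ_le hi) (Nat.lt_succ_self i) h₁)
    exact hrl (((genuine_succ hR hD hα hp hi (hsub hl)).left r rfl hrF).mono (by linarith))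

variable (hN : 0 < NSmin) (hM : Margins α P.f NSmin P.γ P.β)
include hN hM

/-- If `p` entered at time `T`, after the announcement, it needs a correct server `s` that is there
from before `T - 2D` until `T + 2D` and answers it. If that answer comes more than `2D` after the
announcement, `s` knows `c` by induction. Otherwise the announcement falls after `T - 2D`, `s` hears
it at first hand, and `mem_of_echo` brings it to `p`. After `2D` in the system any core server will
do as `s`; before that, `s` is found among the echoes that made `p` join. -/
lemma informed_of_earlier {p : ID} (hp : p ∉ R.F) {k : ℕ} (hk : R.HasStep p k)
    (hrdy : Ready R D p k)
    (ih : ∀ q j, P.isClient q = false → R.HasStep q j →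
      (R.view q).time j < (R.view p).time k → q ∉ R.F → Ready R D q j → Informed P R D q j) :
    Informed P R D p k := by
  intro c τ hc hτ hfr
  have hk0 := hk.of_le (Nat.zero_le k)
  have hp0 := (hR.timedView p).nonneg 0 hk0
  by_cases hpe : R.EnteredBy p τ
  · exact KnownBy.mem hR (knownBy_of_announced hR hD hα hc hp hpe
      (fun t h1 h2 => activeAt_of_step hR hk (hpe.mono h1) (by linarith))
      (hfr.mono (by linarith))) hp hk (by linarith)
  have hpi : ¬ R.Initially p := fun h => hpe (.inl h)
  have hτp : τ < (R.view p).time 0 := by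
    by_contra h
    exact hpe ((enteredBy_time hR hk0).mono (not_lt.1 h))
  set b := max 0 ((R.view p).time 0 - 2 * D) with hb
  have hb0 : 0 ≤ b := le_max_left _ _
  have hb1 : (R.view p).time 0 - 2 * D ≤ b := le_max_right _ _
  have hb2 : b ≤ (R.view p).time 0 := max_le hp0 (by linarith)
  obtain ⟨Q, W, hQ, hW, hQf, hWQ, -⟩ := exists_core hR hD hα hN hM hb0
  by_cases hkt : (R.view p).time 0 + 2 * D < (R.view p).time k
  · obtain ⟨s, hs⟩ : Q.Nonempty := Finset.card_pos.1 (by omega)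
    obtain ⟨hsc, hsF, hse, hsl⟩ := (hQ s).1 hs
    have hse' := InBefore.of_max_zero hR hse
    obtain ⟨w, v, hw, hw1, hw2, hv, hv1, hv2, hecho⟩ := exists_echo hR hD hα hp hpi hk0 hsc hsF
      (hse.enteredBy.mono hb2) (fun h => hsl (h.mono (by linarith)))
      (fun t h1 h2 => activeAt_of_step hR hk ((enteredBy_time hR hk0).mono h1) (by linarith))
    have hvk : v < k := lt_of_time_lt hR hv (by linarith)
    rcases lt_or_ge (τ + 2 * D) ((R.view s).time w) with hwτ | hwτ
    · refine EchoAt.subset hR hp hk.le hvk hecho (changes_mono hR hsF (Nat.le_succ w)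
        (hasStep_succ_le hw) (ih s w hsc hw (by linarith) hsF ?_ c τ hc hwτ
          (hfr.mono (by linarith))))
      exact (ready_of_inBefore hR hse' (by linarith)).imp_right .inr
    · exact mem_of_echo hR hD hα hp hsc hsF hk hvk hw hw1 hecho hc
        (hse'.enteredBy.mono (by linarith)) (fun h => hsl (h.mono (by linarith))) hτ hfr
  · have hj : ((R.view p).state k).isJoined = true :=
      (hrdy.resolve_left hpi).resolve_right hkt
    -- When `join_bound` was set, more than `f` servers had answered as joined. One of them, `s₀`,
    -- is correct, hence informed by induction; if it answered more than `2 * D` after the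
    -- announcement, this already suffices.
    obtain ⟨x, ⟨i, hik, s₁, C₁, j₁, h₁, hf, rfl⟩, hx⟩ :=
      joinBound_of_isJoined hR hp hpi hk.le hj
    obtain ⟨s₀, ⟨v₀, hv₀, C₀, hecho⟩, hs₀F⟩ := exists_correct hR hf
    have hi := hk.of_le hik.le
    have hv₀i := Nat.lt_succ_iff.1 hv₀
    have hv₀k := hv₀i.trans_lt hik
    have hv₀s := hi.of_le hv₀i
    obtain ⟨w₀, hw₀, hs₀c, rfl, hj₀, g1, g2, g3⟩ := EchoAt.origin hR hp hs₀F hv₀s hecho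
    have hinf : Informed P R D s₀ w₀ := ih s₀ w₀ hs₀c hw₀
      (g3.trans_le (time_le hR hk hv₀k.le)) hs₀F (.inr (.inl hj₀.symm))
    rcases lt_or_ge (τ + 2 * D) ((R.view s₀).time w₀) with hwτ | hwτ
    · exact EchoAt.subset hR hp hk.le hv₀k hecho (changes_mono hR hs₀F (Nat.le_succ w₀)
        (hasStep_succ_le hw₀) (hinf c τ hc hwτ
          (hfr.mono (g3.le.trans (time_le hR hk hv₀k.le)))))
    have hQX : Q ⊆ presentIn (((R.view p).state i).changes ∪ C₁) := fun r hr =>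
      mem_presentIn_of_core hR hD hα hp hs₀F hi hv₀i
        ((time_le hR hk hik.le).trans (not_lt.1 hkt)) g1 g2 hw₀ hinf hecho h₁ ((hQ r).1 hr)
    -- The answer of `s₀` shows `p` the whole core, so `join_bound` is at least `γ * |Q|`. This
    -- exceeds the number of servers that are Byzantine or move within the window, so some echo came
    -- from a correct server that stays throughout.
    have hlt : ((W ∪ R.F).card : ℝ) < (R.echoers P p k).ncard := by
      have h1 : ((W ∪ R.F).card : ℝ) ≤ W.card + P.f := by
        exact_mod_cast (Finset.card_union_le _ _).trans (Nat.add_le_add_left hR.byzantine_card _)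
      have h2 : P.γ * (Q.card : ℝ) ≤
          P.γ * (presentIn (((R.view p).state i).changes ∪ C₁)).card :=
        mul_le_mul_of_nonneg_left (by exact_mod_cast Finset.card_le_card hQX) hM.gamma_pos.le
      linarith
    obtain ⟨s, ⟨v, hvk, C, j, hs⟩, hsW⟩ : ∃ s ∈ R.echoers P p k, s ∉ W ∪ R.F := by
      by_contra! hcon
      have : (R.echoers P p k).ncard ≤ (W ∪ R.F).card := by
        rw [← Set.ncard_coe_finset]
        exact Set.ncard_le_ncard hcon (W ∪ R.F).finite_toSet
      exact absurd hlt (not_lt.2 (by exact_mod_cast this))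
    rw [Finset.mem_union, not_or] at hsW
    obtain ⟨w, hw, hsc, rfl, -, e1, e2, -⟩ := EchoAt.origin hR hp hsW.2 (hk.of_le hvk.le) hs
    have hse : R.InBefore s ((R.view p).time 0 - 2 * D) := by
      refine InBefore.of_max_zero hR ((enteredBy_time hR hw).imp_right ?_)
      rintro ⟨u, hu, ho⟩
      refine ⟨u, ?_, ho⟩
      by_contra hbu
      exact hsW.1 (hW s u hsc (not_lt.1 hbu) (by linarith) (.inl ho))
    refine mem_of_echo hR hD hα hp hsc hsW.2 hk hvk hw e1 hs hc
      (hse.enteredBy.mono (by linarith)) ?_ hτ hfr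
    rintro ⟨u, hu, ho⟩
    rcases lt_or_ge u b with hub | hub
    · exact not_leave_of_step hR hw (u := b) (by linarith) ⟨u, hub.le, ho⟩
    · exact hsW.1 (hW s u hsc hub (by linarith) (.inr ho))

/-- Nodes that have joined or have been in the system for long enough know what was announced more
than `2 * D` earlier. -/
lemma informed {p : ID} (hp : p ∉ R.F) {k : ℕ} (hk : R.HasStep p k) (hrdy : Ready R D p k) :
    Informed P R D p k := by
  -- The induction settles servers. Clients need one more application of the same step, since it
  -- only refers to earlier steps of servers.
  have key := server_induction hR hD hα
    (motive := fun q j => q ∉ R.F → Ready R D q j → Informed P R D q j)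
    fun q j _ hj ih hq hrq => informed_of_earlier hR hD hα hN hM hq hj hrq ih
  exact informed_of_earlier hR hD hα hN hM hp hk hrdy fun q j h1 h2 _ => key q j h1 h2

/-- A correct server that has left early is known to have left. -/
lemma not_left_before {p r : ID} {k : ℕ} {C : Finset (Change ID)}
    (hinf : Informed P R D p k) (hC : ((R.view p).state k).changes ⊆ C) {x : ℝ}
    (hx : x + 2 * D ≤ (R.view p).time k) (hr : P.isClient r = false) (hrF : r ∉ R.F)
    (hl : .leave r ∉ C) : ¬ ∃ u < max 0 x, R.Occurs r .leave u := by
  rintro ⟨u, hu, ho⟩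
  have hu' : u < x := by
    rcases lt_max_iff.1 hu with h | h
    · exact absurd (occurs_nonneg hR ho) (not_le.2 h)
    · exact h
  exact hl (hC (hinf _ u (.leave hr hrF ho) (by linarith) (by simp [Fresh])))

/-- A correct server that has been in the system for longer than `2 * D` has joined. -/
lemma isJoined_of_server : ∀ p k, P.isClient p = false → R.HasStep p k → p ∉ R.F →
    (R.Initially p ∨ (R.view p).time 0 + 2 * D < (R.view p).time k) →
    ((R.view p).state k).isJoined = true := by
  refine server_induction hR hD hα fun p k hpc hk ih hp hrdy => ?_
  by_cases hpi : R.Initially p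
  · exact isJoined_of_initially hR hp hpi hk.le
  have hkt := hrdy.resolve_left hpi
  -- The first step later than `2 * D` after entering is used, so that every echo processed before
  -- it, and with it the setting of `join_bound`, lies within the window.
  have hex : ∃ k, (R.view p).time 0 + 2 * D < (R.view p).time k := ⟨k, hkt⟩
  obtain ⟨k', hk'k, hkt', hmin⟩ : ∃ k' ≤ k, (R.view p).time 0 + 2 * D < (R.view p).time k' ∧
      ∀ i < k', (R.view p).time i ≤ (R.view p).time 0 + 2 * D := by
    classical
    exact ⟨Nat.find hex, Nat.find_min' hex hkt, Nat.find_spec hex,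
      fun i hi => not_lt.1 (Nat.find_min hex hi)⟩
  have hk' := hk.of_le hk'k
  refine isJoined_mono hR hp hk'k hk.le ?_
  by_contra hj
  rw [Bool.not_eq_true] at hj
  have hk0 := hk.of_le (Nat.zero_le k)
  have hp0 := (hR.timedView p).nonneg 0 hk0
  set b := max 0 ((R.view p).time 0 - 2 * D) with hb
  have hb0 : 0 ≤ b := le_max_left _ _
  have hb1 : (R.view p).time 0 - 2 * D ≤ b := le_max_right _ _
  have hb2 : b ≤ (R.view p).time 0 := max_le hp0 (by linarith)
  obtain ⟨Q, W, hQ, -, hQf, -, hX⟩ := exists_core hR hD hα hN hM hb0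
  -- Core servers have been there for more than `2 * D` when they answer, so by induction they
  -- answer as joined servers.
  have hQe : (Q : Set ID) ⊆ R.joinedEchoers P p k' := by
    intro s hs
    obtain ⟨hsc, hsF, hse, hsl⟩ := (hQ s).1 hs
    obtain ⟨w, v, hw, hw1, hw2, hv, hv1, hv2, hecho⟩ := exists_echo hR hD hα hp hpi hk0 hsc hsF
      (hse.enteredBy.mono hb2) (fun h => hsl (h.mono (by linarith)))
      (fun t h1 h2 => activeAt_of_step hR hk ((enteredBy_time hR hk0).mono h1) (by linarith))
    rw [ih s w hsc hw (by linarith) hsF (ready_of_inBefore hR (InBefore.of_max_zero hR hse)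
      (by linarith))] at hecho
    exact ⟨v, lt_of_time_lt hR hv (by linarith), _, hecho⟩
  have hcard : Q.card ≤ (R.joinedEchoers P p k').ncard := by
    rw [← Set.ncard_coe_finset]
    exact Set.ncard_le_ncard hQe (finite_joinedEchoers R P p k')
  have hcard' : Q.card ≤ (R.echoers P p k').ncard := hcard.trans
    (Set.ncard_le_ncard (joinedEchoers_subset R P p k') (finite_echoers R P p k'))
  obtain ⟨x, ⟨i, hik, s₁, C₁, j₁, h₁, hf, rfl⟩, hx⟩ :=
    joinBound_of_not_isJoined hR hp hk'.le hj (by omega)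
  obtain ⟨s₀, ⟨v₀, hv₀, C₀, hecho⟩, hs₀F⟩ := exists_correct hR hf
  have hi := hk'.of_le hik.le
  have hv₀i := Nat.lt_succ_iff.1 hv₀
  obtain ⟨w₀, hw₀, hs₀c, rfl, hj₀, g1, g2, g3⟩ :=
    EchoAt.origin hR hp hs₀F (hi.of_le hv₀i) hecho
  have hinf : Informed P R D s₀ w₀ :=
    informed hR hD hα hN hM hs₀F hw₀ (.inr (.inl hj₀.symm))
  set X := presentIn (((R.view p).state i).changes ∪ C₁) with hXdef
  have hQX : Q ⊆ X := fun r hr => mem_presentIn_of_core hR hD hα hp hs₀F hi hv₀i (hmin i hik)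
    g1 g2 hw₀ hinf hecho h₁ ((hQ r).1 hr)
  -- A bound of `0` would never let `p` join, however many echoes arrive.
  have hpos : 0 < P.γ * (X.card : ℝ) := by
    refine mul_pos hM.gamma_pos ?_
    have := Finset.card_le_card hQX
    exact_mod_cast (show 0 < X.card by omega)
  have hsub : ((R.view s₀).state w₀).changes ⊆ ((R.view p).state i).changes ∪ C₁ := by
    refine (changes_mono hR hs₀F (Nat.le_succ w₀) (hasStep_succ_le hw₀)).trans ?_
    rcases hv₀i.lt_or_eq with h | rfl
    · exact (EchoAt.subset hR hp hi.le h hecho).trans Finset.subset_union_left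
    · rw [← (hecho.unique h₁).2.1]
      exact Finset.subset_union_right
  -- The answer of the informed server `s₀` has told `p` of all correct servers that left before
  -- `b`. So `X` satisfies the hypotheses of `exists_core`, and the echoes from the core alone meet
  -- the bound.
  have hle : P.γ * (X.card : ℝ) ≤ Q.card := by
    refine (hX X fun r hr => ?_).2
    obtain ⟨hr1, hr2⟩ := mem_presentIn.1 hr
    have hsub' : ((R.view p).state i).changes ∪ C₁ ⊆ ((R.view p).state (i + 1)).changes :=
      Finset.union_subset (changes_mono hR hp (Nat.le_succ i) (hasStep_succ_le hi))
        (EchoAt.subset hR hp (hasStep_succ_le hi) (Nat.lt_succ_self i) h₁)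
    have hg := genuine_succ hR hD hα hp hi (hsub' hr1)
    have := hmin i hik
    exact ⟨hg.server, hg.entered.mono (by linarith), fun hrF =>
      not_left_before hR hD hα hN hM hinf hsub (by linarith) hg.server hrF hr2⟩
  rcases hx with hx | hx
  · exact absurd hpos (not_lt.2 hx)
  · have : (Q.card : ℝ) ≤ (R.echoers P p k').ncard := by exact_mod_cast hcard'
    linarith

end Knowledge

/-! ### Phases of operations -/

/-- No operation is pending. -/
structure Idle (s : State ID V) : Prop where
  rp : s.rpPending = false
  wp : s.wpPending = false
  read : s.readPending = false
  write : s.writePending = false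

/-- The variables tell that the operation invoked by `T` is pending. -/
structure Pending (T : Trigger ID V) (s : State ID V) : Prop where
  excl : s.rpPending = true → s.wpPending = false
  flags : T = .read ∧ s.readPending = true ∧ s.writePending = false ∨
    (∃ v, T = .write v) ∧ s.readPending = false ∧ s.writePending = true

/-- Before step `i`, the operation invoked in step `k` is pending. -/
structure Busy (R : Run ID V) (p : ID) (k i : ℕ) : Prop where
  lt : k < i
  invocation : ((R.view p).trigger k).IsInvocation
  later : ∀ j, k < j → j < i → ¬ ((R.view p).trigger j).IsInvocation
  resp : ∀ j, k < j → j < i → (R.view p).resp j = none ∨ (R.view p).resp j = some .joined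
  pending : Pending ((R.view p).trigger k) ((R.view p).state i)

lemma Pending.of_samePhase {T : Trigger ID V} {s s' : State ID V} (h : Pending T s)
    (hs : SamePhase s s') : Pending T s' := by
  obtain ⟨⟨-, h1, h2⟩, h3, h4, -, -⟩ := hs
  obtain ⟨g1, g2⟩ := h
  constructor <;> simpa only [h1, h2, h3, h4]

lemma Pending.of_sameOp {T : Trigger ID V} {s s' : State ID V} (h : Pending T s)
    (hs : SameOp s s') (h1 : s'.rpPending = true → s'.wpPending = false) : Pending T s' :=
  ⟨h1, by rw [hs.read, hs.write]; exact h.flags⟩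

lemma CountsReply.unique {p : ID} {T : Trigger ID V} {s : State ID V} {r r' : ID}
    (h : CountsReply p T s r) (h' : CountsReply p T s r') : r = r' := by
  obtain ⟨K, h1, -⟩ := h
  obtain ⟨K', h2, -⟩ := h'
  rw [h1] at h2
  exact (Trigger.receive.inj h2).1

lemma CountsAck.unique {p : ID} {T : Trigger ID V} {s : State ID V} {r r' : ID}
    (h : CountsAck p T s r) (h' : CountsAck p T s r') : r = r' := by
  obtain ⟨h1, -⟩ := h
  obtain ⟨h2, -⟩ := h'
  rw [h1] at h2
  exact (Trigger.receive.inj h2).1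

/-- A counter that is incremented with each sender in `Q` is at least as large as `Q`. -/
lemma card_le_counter {A : ℕ → ID → Prop} (hA : ∀ i s s', A i s → A i s' → s = s') {c : ℕ → ℕ}
    {k j : ℕ} (hc : ∀ i, k < i → i < j → c i ≤ c (i + 1) ∧ ∀ s, A i s → c i + 1 ≤ c (i + 1))
    (Q : Finset ID) (hQ : ∀ s ∈ Q, ∃ i, k < i ∧ i < j ∧ A i s) : Q.card ≤ c j := by
  induction j generalizing Q with
  | zero =>
    rw [Finset.eq_empty_of_forall_notMem (s := Q) fun s hs => by
      obtain ⟨i, -, hi, -⟩ := hQ s hs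
      exact absurd hi (Nat.not_lt_zero i)]
    simp
  | succ j ih =>
    have ih' := ih fun i h1 h2 => hc i h1 (h2.trans (Nat.lt_succ_self j))
    by_cases h : ∃ s ∈ Q, k < j ∧ A j s
    · obtain ⟨s, hs, hkj, hAs⟩ := h
      have h1 := ih' (Q.erase s) fun s' hs' => by
        obtain ⟨hne, hs'⟩ := Finset.mem_erase.1 hs'
        obtain ⟨i, hi1, hi2, hi3⟩ := hQ s' hs'
        rcases Nat.lt_succ_iff_lt_or_eq.1 hi2 with hi2 | rfl
        · exact ⟨i, hi1, hi2, hi3⟩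
        · exact absurd (hA _ _ _ hi3 hAs) hne
      have h2 := (hc j hkj (Nat.lt_succ_self j)).2 s hAs
      rw [Finset.card_erase_of_mem hs] at h1
      omega
    · push Not at h
      rcases Q.eq_empty_or_nonempty with rfl | ⟨s₀, hs₀⟩
      · simp
      have hkj : k < j := by
        obtain ⟨i, hi1, hi2, hi3⟩ := hQ s₀ hs₀
        rcases Nat.lt_succ_iff_lt_or_eq.1 hi2 with hi2 | rfl
        · omega
        · exact absurd hi3 (h s₀ hs₀ hi1)
      refine (ih' Q fun s hs => ?_).trans (hc j hkj (Nat.lt_succ_self j)).1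
      obtain ⟨i, hi1, hi2, hi3⟩ := hQ s hs
      rcases Nat.lt_succ_iff_lt_or_eq.1 hi2 with hi2 | rfl
      · exact ⟨i, hi1, hi2, hi3⟩
      · exact absurd hi3 (h s hs hi1)

/-- A phase that ends when the counter reaches the bound ends once all members of a sufficiently
large set `Q` have been counted. -/
lemma exists_phase_end {pend : ℕ → Prop} {A : ℕ → ID → Prop}
    (hA : ∀ i s s', A i s → A i s' → s = s') {c : ℕ → ℕ} {b : ℕ → ℝ} {k M : ℕ} (hkM : k < M)
    (h0 : pend (k + 1)) (hc0 : c (k + 1) = 0)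
    (hstep : ∀ i, k < i → i ≤ M → (∀ j, k < j → j ≤ i → pend j) → pend (i + 1) →
      b (i + 1) = b i ∧ c i ≤ c (i + 1) ∧ (c (i + 1) = c i ∨ (c (i + 1) : ℝ) < b i) ∧
      ∀ s, A i s → c i + 1 ≤ c (i + 1))
    (Q : Finset ID) (hQ0 : Q.Nonempty) (hQb : b (k + 1) ≤ Q.card)
    (hQ : ∀ s ∈ Q, ∃ i, k < i ∧ i ≤ M ∧ ((∀ j, k < j → j ≤ i → pend j) → A i s)) :
    ∃ m, k < m ∧ m ≤ M ∧ (∀ j, k < j → j ≤ m → pend j) ∧ ¬ pend (m + 1) := by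
  by_cases hend : ∀ j, k < j → j ≤ M + 1 → pend j
  · exfalso
    -- The bound is tested only when the counter is raised, so a counter still at `0` need not be
    -- below it. That case is excluded in the end by the nonemptiness of `Q`.
    have hinv : ∀ j, k < j → j ≤ M + 1 → b j = b (k + 1) ∧ (c j = 0 ∨ (c j : ℝ) < b (k + 1)) := by
      intro j hkj
      induction j, hkj using Nat.le_induction with
      | base => exact fun _ => ⟨rfl, .inl hc0⟩
      | succ j hkj ih =>
        intro hj
        obtain ⟨h1, h2⟩ := ih (by omega)
        obtain ⟨g1, -, g2, -⟩ := hstep j hkj (by omega) (fun j' h4 h5 => hend j' h4 (by omega))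
          (hend _ (by omega) hj)
        refine ⟨g1.trans h1, ?_⟩
        rw [h1] at g2
        rcases g2 with g2 | g2
        · rwa [g2]
        · exact .inr g2
    have hcard : Q.card ≤ c (M + 1) := by
      refine card_le_counter hA (k := k) (fun i h1 h2 => ?_) Q fun s hs => ?_
      · obtain ⟨-, h3, -, h4⟩ := hstep i h1 (by omega) (fun j h3 h4 => hend j h3 (by omega))
          (hend _ (by omega) h2)
        exact ⟨h3, h4⟩
      · obtain ⟨i, h1, h2, h3⟩ := hQ s hs
        exact ⟨i, h1, Nat.lt_succ_of_le h2, h3 fun j h4 h5 => hend j h4 (by omega)⟩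
    have hpos := Finset.card_pos.2 hQ0
    rcases (hinv (M + 1) (by omega) le_rfl).2 with h | h
    · omega
    · have : (Q.card : ℝ) ≤ c (M + 1) := by exact_mod_cast hcard
      linarith
  · push Not at hend
    classical
    obtain ⟨h1, h2, h3⟩ := Nat.find_spec hend
    have hmin := fun j => @Nat.find_min _ _ hend j
    set j := Nat.find hend
    have hj : j ≠ k + 1 := fun h => h3 (h ▸ h0)
    refine ⟨j - 1, by omega, by omega, fun i h4 h5 => ?_, ?_⟩
    · by_contra hc
      exact hmin i (by omega) ⟨h4, by omega, hc⟩
    · rwa [Nat.sub_add_cancel (by omega)]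

section Operations

variable {P : Params ID} {D α : ℝ} {NSmin : ℕ} {R : Run ID V} (hR : IsExecution P D α NSmin R)
include hR

open Run

lemma isClient_of_invocation {p : ID} {k : ℕ} (hk : R.HasStep p k)
    (hop : ((R.view p).trigger k).IsInvocation) : P.isClient p = true := by
  by_contra h
  exact ((hR.timedView p).server (by simpa using h) k hk).2 hop

lemma isJoined_of_invocation {p : ID} {k : ℕ} (hk : R.HasStep p k)
    (hop : ((R.view p).trigger k).IsInvocation) : ((R.view p).state k).isJoined = true := by
  have hp := client_correct hR (isClient_of_invocation hR hk hop)
  rcases hR.invoke_joined p k hk hop with h | ⟨i, hi, h⟩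
  · exact isJoined_of_initially hR hp h hk.le
  · have hi' := hk.of_le hi.le
    refine isJoined_mono hR hp hi hk.le ?_
    rw [resp_eq hR hp hi'] at h
    rw [state_succ hR hp hi']
    exact isJoined_of_resp h

/-- A further invocation would presuppose a matching response in between, but so far there has been
none, except possibly Joined. -/
lemma Busy.not_invocation {p : ID} {k i : ℕ} (h : Busy R p k i) (hi : R.HasStep p i) :
    ¬ ((R.view p).trigger i).IsInvocation := by
  intro hinv
  obtain ⟨n, hn, hkn, -, -, ⟨A, hA, hM⟩, -⟩ :=
    hR.invoke_sequential p k i h.lt hi h.invocation hinv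
  rcases h.resp n hkn hn with h | h <;> rw [h] at hA <;> simp at hA
  subst hA
  rcases hM with ⟨-, v, h⟩ | ⟨-, h⟩ <;> simp at h

/-- At each step of a client, either no operation is pending or one has been invoked before. -/
lemma idle_or_busy {p : ID} (hpc : P.isClient p = true) {i : ℕ}
    (hi : (i : ℕ∞) ≤ (R.view p).len) :
    Idle ((R.view p).state i) ∨ ∃ k, Busy R p k i := by
  have hp := client_correct hR hpc
  induction i with
  | zero =>
    left
    rw [(hR.timedView p).init]
    exact ⟨rfl, rfl, rfl, rfl⟩
  | succ i ih =>
    have hi' : R.HasStep p i := lt_of_lt_of_le (by exact_mod_cast Nat.lt_succ_self i) hi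
    have hstate := state_succ hR hp hi'
    have hresp := resp_eq hR hp hi'
    have extend : ∀ k, Busy R p k i → ¬ ((R.view p).trigger i).IsInvocation →
        ((R.view p).resp i = none ∨ (R.view p).resp i = some .joined) →
        Pending ((R.view p).trigger k) ((R.view p).state (i + 1)) → Busy R p k (i + 1) := by
      intro k hk h1 h2 h3
      refine ⟨hk.lt.trans (Nat.lt_succ_self i), hk.invocation, fun j hkj hj => ?_,
        fun j hkj hj => ?_, h3⟩
      · rcases Nat.lt_succ_iff_lt_or_eq.1 hj with hj | rfl
        exacts [hk.later j hkj hj, h1]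
      · rcases Nat.lt_succ_iff_lt_or_eq.1 hj with hj | rfl
        exacts [hk.resp j hkj hj, h2]
    by_cases hinv : ((R.view p).trigger i).IsInvocation
    · have hidle : Idle ((R.view p).state i) := by
        rcases ih hi'.le with h | ⟨k, hk⟩
        · exact h
        · exact absurd hinv (hk.not_invocation hR hi')
      obtain ⟨-, -, h2, -, -, -, h3⟩ := client_invocation (s := (R.view p).state i) hpc hinv
      rw [← hstate] at h2 h3
      refine .inr ⟨i, Nat.lt_succ_self i, hinv, fun j h4 h5 => by omega,
        fun j h4 h5 => by omega, fun _ => h2.trans hidle.wp, ?_⟩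
      rw [hidle.read, hidle.write] at h3
      exact h3
    by_cases hrep : ∃ r, CountsReply p ((R.view p).trigger i) ((R.view p).state i) r
    · obtain ⟨r, hrep⟩ := hrep
      have hrp : ((R.view p).state i).rpPending = true := hrep.choose_spec.2.2
      obtain ⟨h1, h2, h3⟩ := client_countsReply hpc hrep
      rw [← hstate] at h1 h3
      rw [← hresp] at h2
      rcases ih hi'.le with h | ⟨k, hk⟩
      · rw [h.rp] at hrp
        simp at hrp
      · have hwp := hk.pending.excl hrp
        refine .inr ⟨k, extend k hk hinv (.inl h2) (hk.pending.of_sameOp h1 ?_)⟩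
        split_ifs at h3 <;> simp [h3, hwp]
    by_cases hack : ∃ r, CountsAck p ((R.view p).trigger i) ((R.view p).state i) r
    · obtain ⟨r, hack⟩ := hack
      have hwp : ((R.view p).state i).wpPending = true := hack.2.2
      obtain ⟨-, h2, h3⟩ := client_countsAck hpc hack
      rw [← hstate] at h2 h3
      rw [← hresp] at h3
      rcases ih hi'.le with h | ⟨k, hk⟩
      · rw [h.wp] at hwp
        simp at hwp
      · have hrp : ((R.view p).state i).rpPending = false := by
          by_contra h
          rw [hk.pending.excl (by simpa using h)] at hwp
          simp at hwp
        by_cases hb : ((R.view p).state i).rwBound ≤ (((R.view p).state i).rwCounter + 1 : ℕ)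
        · rw [if_pos hb] at h3
          exact .inl ⟨h2.trans hrp, h3.1, h3.2.1, h3.2.2.1⟩
        · rw [if_neg hb] at h3
          exact .inr ⟨k, extend k hk hinv (.inl h3.2.1) (hk.pending.of_sameOp h3.1
            (fun h => by rw [h2, hrp] at h; simp at h))⟩
    · push Not at hrep hack
      obtain ⟨h1, h2⟩ := client_other hpc hinv hrep hack
      rw [← hstate] at h1
      rw [← hresp] at h2
      refine (ih hi'.le).imp (fun h => ?_) fun ⟨k, hk⟩ =>
        ⟨k, extend k hk hinv h2 (hk.pending.of_samePhase h1)⟩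
      exact ⟨h1.rp.trans h.rp, h1.wp.trans h.wp, h1.read.trans h.read, h1.write.trans h.write⟩

lemma idle_of_invocation {p : ID} {k : ℕ} (hk : R.HasStep p k)
    (hop : ((R.view p).trigger k).IsInvocation) : Idle ((R.view p).state k) := by
  rcases idle_or_busy hR (isClient_of_invocation hR hk hop) hk.le with h | ⟨i, hi⟩
  · exact h
  · exact absurd hop (hi.not_invocation hR hk)

/-- As long as phases follow each other, the operation invoked last is the pending one. -/
lemma busy_of_pending {p : ID} {k i : ℕ} (hki : k < i) (hi : (i : ℕ∞) ≤ (R.view p).len)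
    (hop : ((R.view p).trigger k).IsInvocation)
    (h : ∀ j, k < j → j ≤ i →
      ((R.view p).state j).rpPending = true ∨ ((R.view p).state j).wpPending = true) :
    Busy R p k i := by
  have hk : R.HasStep p k := lt_of_lt_of_le (by exact_mod_cast hki) hi
  rcases idle_or_busy hR (isClient_of_invocation hR hk hop) hi with hid | ⟨l, hl⟩
  · have := h i hki le_rfl
    rw [hid.rp, hid.wp] at this
    simp at this
  · have hkl : k ≤ l := by
      by_contra hc
      exact hl.later k (not_le.1 hc) hki hop
    rcases hkl.lt_or_eq with hkl | rfl
    · have hls : R.HasStep p l := lt_of_lt_of_le (by exact_mod_cast hl.lt) hi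
      have hid := idle_of_invocation hR hls hl.invocation
      have := h l hkl hl.lt.le
      rw [hid.rp, hid.wp] at this
      simp at this
    · exact hl

lemma tag_succ {p : ID} (hpc : P.isClient p = true) {i : ℕ} (hi : R.HasStep p i) :
    ((R.view p).trigger i).IsInvocation ∧
        ((R.view p).state (i + 1)).tag = ((R.view p).state i).tag + 1 ∨
      ¬ ((R.view p).trigger i).IsInvocation ∧
        ((R.view p).state (i + 1)).tag = ((R.view p).state i).tag := by
  rw [state_succ hR (client_correct hR hpc) hi]
  by_cases hinv : ((R.view p).trigger i).IsInvocation
  · exact .inl ⟨hinv, (client_invocation hpc hinv).1⟩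
  refine .inr ⟨hinv, ?_⟩
  by_cases hrep : ∃ r, CountsReply p ((R.view p).trigger i) ((R.view p).state i) r
  · exact (client_countsReply hpc hrep.choose_spec).1.tag
  by_cases hack : ∃ r, CountsAck p ((R.view p).trigger i) ((R.view p).state i) r
  · exact (client_countsAck hpc hack.choose_spec).1
  · push Not at hrep hack
    exact (client_other hpc hinv hrep hack).1.tag

lemma tag_mono {p : ID} (hpc : P.isClient p = true) {i k : ℕ} (hik : i ≤ k)
    (hk : (k : ℕ∞) ≤ (R.view p).len) :
    ((R.view p).state i).tag ≤ ((R.view p).state k).tag := by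
  induction k, hik using Nat.le_induction with
  | base => exact le_rfl
  | succ k _ ih =>
    have hk' : R.HasStep p k := lt_of_lt_of_le (by exact_mod_cast Nat.lt_succ_self k) hk
    have := ih hk'.le
    rcases tag_succ hR hpc hk' with h | h <;> omega

lemma Busy.tag_eq {p : ID} (hpc : P.isClient p = true) {k i : ℕ} (h : Busy R p k i)
    (hi : (i : ℕ∞) ≤ (R.view p).len) :
    ((R.view p).state i).tag = ((R.view p).state k).tag + 1 := by
  obtain ⟨hki, hop, hlater, -, -⟩ := h
  induction i, hki using Nat.le_induction with
  | base =>
    have hk : R.HasStep p k := lt_of_lt_of_le (by exact_mod_cast Nat.lt_succ_self k) hi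
    rcases tag_succ hR hpc hk with h | h
    exacts [h.2, absurd hop h.1]
  | succ i hki ih =>
    have hi' : R.HasStep p i := lt_of_lt_of_le (by exact_mod_cast Nat.lt_succ_self i) hi
    rcases tag_succ hR hpc hi' with h | h
    · exact absurd h.1 (hlater i hki (Nat.lt_succ_self i))
    · exact h.2.trans (ih hi'.le fun j h1 h2 => hlater j h1 (h2.trans (Nat.lt_succ_self i)))

lemma activeAt_of_later {p : ID} {k : ℕ} (hk : R.HasStep p k) {t u : ℝ}
    (hu : (R.view p).time k ≤ u) (hut : u ≤ t) (ha : R.ActiveAt p t) : R.ActiveAt p u :=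
  ⟨⟨(enteredBy_time hR hk).mono hu, fun h => ha.1.2 (LeftBy.mono h hut)⟩,
    fun ⟨v, hv, h⟩ => ha.2 ⟨v, hv.trans_le hut, h⟩⟩

variable (hD : 0 < D) (hα : 0 < α)
include hD hα

/-- The window of `exists_core` is taken around the start of the phase. The client is informed, so
its members are not correct servers that left more than `2D` ago, and `rw_bound` is at most `|Q|`.
The servers in `Q` have been there for more than `2D` at that time, so they have joined and answer.
-/
lemma exists_quorum (hN : 0 < NSmin) (hM : Margins α P.f NSmin P.γ P.β) {p : ID} (hp : p ∉ R.F)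
    {k : ℕ} (hk : R.HasStep p k) (hj : ((R.view p).state k).isJoined = true) :
    ∃ Q : Finset ID, Q.Nonempty ∧ P.β * ((R.view p).state k).members.card ≤ Q.card ∧
      ∀ s ∈ Q, P.isClient s = false ∧ s ∉ R.F ∧
        R.InBefore s ((R.view p).time k - 2 * D) ∧ ¬ R.LeftBy s ((R.view p).time k + 2 * D) ∧
        ∀ w, R.HasStep s w → (R.view p).time k ≤ (R.view s).time w →
          ((R.view s).state w).isJoined = true := by
  have hb1 : (R.view p).time k - 2 * D ≤ max 0 ((R.view p).time k - 2 * D) := le_max_right _ _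
  obtain ⟨Q, -, hQ, -, hQf, -, hX⟩ :=
    exists_core hR hD hα hN hM (le_max_left 0 ((R.view p).time k - 2 * D))
  refine ⟨Q, Finset.card_pos.1 (by omega), (hX _ fun s hs => ?_).1, fun s hs => ?_⟩
  · obtain ⟨h1, h2⟩ := State.mem_members.1 hs
    have hg := genuine hR hD hα hp hk h1
    exact ⟨hg.server, hg.entered.mono (by linarith), fun hsF =>
      not_left_before hR hD hα hN hM (informed hR hD hα hN hM hp hk (.inr (.inl hj)))
        subset_rfl (by linarith) hg.server hsF h2⟩
  · obtain ⟨h1, h2, h3, h4⟩ := (hQ s).1 hs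
    have h3' := InBefore.of_max_zero hR h3
    refine ⟨h1, h2, h3', fun h => h4 (h.mono (by linarith)), fun w hw hkw => ?_⟩
    exact isJoined_of_server hR hD hα hN hM s w h1 hw h2
      (ready_of_inBefore hR h3' (by linarith))

/-- A message to the servers is answered within `2 * D` by a server that stays. -/
lemma exists_response {p s : ID} (hpc : P.isClient p = true) {k : ℕ} (hk : R.HasStep p k)
    (ha : R.ActiveAt p ((R.view p).time k + 2 * D)) (hs : P.isClient s = false) (hsF : s ∉ R.F)
    (hse : R.InBefore s ((R.view p).time k - 2 * D))
    (hsl : ¬ R.LeftBy s ((R.view p).time k + 2 * D)) {m : Payload ID V}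
    (hm : (.servers, m) ∈ (R.view p).out k) {l : Label ID}
    (hl : ∀ w, R.HasStep s w → (R.view p).time k ≤ (R.view s).time w →
      (R.view s).trigger w = .receive p m →
      ∃ m', (.clients, m') ∈ (R.view s).out w ∧ m'.label = some l) :
    ∃ v m', R.HasStep p v ∧ (R.view p).time v ≤ (R.view p).time k + 2 * D ∧
      (R.view p).trigger v = .receive s m' ∧ m'.label = some l ∧
      ((R.view p).state v).isValid s m' = true := by
  have hp := client_correct hR hpc
  obtain ⟨w, hw, hTw, hw1, hw2⟩ := exists_receive hR hk hm (q := s) hs fun t h1 h2 =>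
    activeAt_server hR hs (hse.enteredBy.mono (by linarith)) fun h => hsl (h.mono (by linarith))
  obtain ⟨m', hm', hlab⟩ := hl w hw hw1.le hTw
  obtain ⟨v, hv, hTv, hv1, hv2⟩ := exists_receive hR hw hm' (q := p) hpc fun t h1 h2 =>
    activeAt_of_later hR hk (by linarith) (by linarith) ha
  obtain ⟨v', hvv', m'', hT', hlab', hval⟩ := exists_valid_receive hR hp hv hTv hlab
    (.inr (leave_notMem hR hD hα hp hv hsF hv2 fun h => hsl (h.mono (by linarith))))
  exact ⟨v', m'', hv.of_le hvv', (time_le hR hv hvv').trans (by linarith), hT', hlab', hval⟩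

variable (hN : 0 < NSmin) (hM : Margins α P.f NSmin P.γ P.β)
include hN hM

/-- The read phase ends within `2 * D`. -/
lemma exists_readPhase {p : ID} {k : ℕ} (hk : R.HasStep p k)
    (hop : ((R.view p).trigger k).IsInvocation)
    (ha : R.ActiveAt p ((R.view p).time k + 2 * D)) :
    ∃ m, R.ReadPhase p k m ∧ (R.view p).time m ≤ (R.view p).time k + 2 * D := by
  have hpc := isClient_of_invocation hR hk hop
  have hp := client_correct hR hpc
  obtain ⟨i1, i2, i3, i4, i5, i6, -⟩ := client_invocation (s := (R.view p).state k) hpc hop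
  rw [← state_succ hR hp hk] at i1 i2 i3 i4 i5
  rw [← out_eq hR hp hk] at i6
  obtain ⟨Q, hQ0, hQβ, hQ⟩ :=
    exists_quorum hR hD hα hN hM hp hk (isJoined_of_invocation hR hk hop)
  have hresp : ∀ s ∈ Q, ∃ v, k < v ∧ R.HasStep p v ∧
      (R.view p).time v ≤ (R.view p).time k + 2 * D ∧
      ∃ K, (R.view p).trigger v = .receive s (.reply K (((R.view p).state k).tag + 1) p) ∧
        ((R.view p).state v).isValid s
          (.reply K (((R.view p).state k).tag + 1) p : Payload ID V) = true := by
    intro s hs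
    obtain ⟨q1, q2, q3, q4, q5⟩ := hQ s hs
    obtain ⟨v, m', hv, hvt, hTv, hlab, hval⟩ := exists_response hR hD hα hpc hk ha q1 q2 q3 q4 i6
      (l := .reply p (((R.view p).state k).tag + 1)) fun w hw hkw hT => by
        obtain ⟨K, hK⟩ := server_receive_query_out (s := (R.view s).state w)
          (rt := ((R.view p).state k).tag + 1) q1 hpc (q5 w hw hkw)
        rw [← hT, ← out_eq hR q2 hw] at hK
        exact ⟨_, hK, rfl⟩
    cases m' <;> simp [Payload.label] at hlab
    rw [hlab.1, hlab.2] at hTv hval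
    refine ⟨v, ?_, hv, hvt, _, hTv, hval⟩
    obtain ⟨w, hw, ho, hwv, -⟩ := receive_origin hR q2 hv hTv
    obtain ⟨i, hi, ⟨-, hinv, htag⟩, hiw, -⟩ := receive_origin hR hp hw ho
    -- Tags only grow, so a query with the new tag is not sent before step `k`, and any reply to it
    -- arrives after step `k`.
    have hki : k ≤ i := by
      by_contra hc
      have h1 : ((R.view p).state (i + 1)).tag ≤ _ := tag_mono hR hpc (not_le.1 hc) hk.le
      rcases tag_succ hR hpc hi with h | h
      · omega
      · exact h.1 hinv
    exact hki.trans_lt (lt_of_time_lt hR hi (hiw.trans hwv))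
  choose! v hv using hresp
  -- Step `v s₁` is the last of the receipts from `Q`; the phase is followed up to it.
  obtain ⟨s₁, hs₁, hmax⟩ := Q.exists_max_image v hQ0
  obtain ⟨hkM, hMs, hMt, -⟩ := hv s₁ hs₁
  have hbusy : ∀ i, k < i → i ≤ v s₁ →
      (∀ j, k < j → j ≤ i → ((R.view p).state j).rpPending = true) → Busy R p k i :=
    fun i hki hiM hpend => busy_of_pending hR hki (hMs.of_le hiM).le hop fun j h1 h2 =>
      .inl (hpend j h1 h2)
  have hstep : ∀ i, k < i → i ≤ v s₁ →
      (∀ j, k < j → j ≤ i → ((R.view p).state j).rpPending = true) →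
      (((R.view p).state (i + 1)).rpPending ≠ true →
        ((R.view p).state (i + 1)).wpPending = true) ∧
      (((R.view p).state (i + 1)).rpPending = true →
        ((R.view p).state (i + 1)).rwBound = ((R.view p).state i).rwBound ∧
        ((R.view p).state i).rwCounter ≤ ((R.view p).state (i + 1)).rwCounter ∧
        (((R.view p).state (i + 1)).rwCounter = ((R.view p).state i).rwCounter ∨
          (((R.view p).state (i + 1)).rwCounter : ℝ) < ((R.view p).state i).rwBound) ∧
        ∀ r, CountsReply p ((R.view p).trigger i) ((R.view p).state i) r →
          ((R.view p).state i).rwCounter + 1 ≤ ((R.view p).state (i + 1)).rwCounter) := by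
    intro i hki hiM hpend
    have hi := hMs.of_le hiM
    have hrp := hpend i hki le_rfl
    have hstate := state_succ hR hp hi
    by_cases hrep : ∃ r, CountsReply p ((R.view p).trigger i) ((R.view p).state i) r
    · obtain ⟨r, hrep⟩ := hrep
      obtain ⟨-, -, h⟩ := client_countsReply hpc hrep
      rw [← hstate] at h
      split_ifs at h with hb
      · exact ⟨fun _ => h.2.1, fun h' => by rw [h.1] at h'; simp at h'⟩
      · refine ⟨fun h' => absurd h.1 h', fun _ => ⟨h.2.2.2, by omega, .inr ?_,
          fun _ _ => h.2.2.1.ge⟩⟩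
        rw [h.2.2.1]
        exact not_le.1 hb
    · push Not at hrep
      have hinv : ¬ ((R.view p).trigger i).IsInvocation := fun h => by
        rw [(idle_of_invocation hR hi h).rp] at hrp
        simp at hrp
      have hack : ∀ r, ¬ CountsAck p ((R.view p).trigger i) ((R.view p).state i) r := by
        intro r h
        have := h.2.2
        rw [(hbusy i hki hiM hpend).pending.excl hrp] at this
        simp at this
      obtain ⟨h1, -⟩ := client_other hpc hinv hrep hack
      rw [← hstate] at h1
      exact ⟨fun h => absurd (h1.rp.trans hrp) h, fun _ => ⟨h1.rwBound, h1.rwCounter.ge,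
        .inl h1.rwCounter, fun r hr => absurd hr (hrep r)⟩⟩
  obtain ⟨m, hkm, hmM, hm1, hm2⟩ := exists_phase_end
    (pend := fun i => ((R.view p).state i).rpPending = true)
    (A := fun i s => CountsReply p ((R.view p).trigger i) ((R.view p).state i) s)
    (c := fun i => ((R.view p).state i).rwCounter) (b := fun i => ((R.view p).state i).rwBound)
    (fun i s s' h h' => h.unique h') hkM i2 i4
    (fun i h1 h2 h3 h4 => (hstep i h1 h2 h3).2 h4) Q hQ0 (i5.trans_le hQβ) fun s hs => by
      obtain ⟨h1, h2, -, K, h3, h4⟩ := hv s hs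
      have h5 := hmax s hs
      refine ⟨v s, h1, h5, fun hpend => ⟨K, ?_, ?_, hpend _ h1 le_rfl⟩⟩ <;>
        rwa [(hbusy _ h1 h5 hpend).tag_eq hR hpc h2.le]
  exact ⟨m, ⟨hop, hkm, hMs.of_le hmM, hm1, by simpa using hm2, (hstep m hkm hmM hm1).1 hm2⟩,
    (time_le hR hMs hmM).trans hMt⟩

/-- The write phase ends within `2 * D`, and with it the operation. -/
lemma exists_writePhase {p : ID} {k m : ℕ} (hph : R.ReadPhase p k m)
    (ha : R.ActiveAt p ((R.view p).time m + 2 * D)) :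
    ∃ n, R.WritePhase p m n ∧ R.Completes p k n ∧
      (R.view p).time n ≤ (R.view p).time m + 2 * D := by
  obtain ⟨hop, hkm, hm, hrp, hrp', hwp'⟩ := hph
  have hk := hm.of_le hkm.le
  have hpc := isClient_of_invocation hR hk hop
  have hp := client_correct hR hpc
  have hjk := isJoined_of_invocation hR hk hop
  have hjoined : ∀ i, k ≤ i → (i : ℕ∞) ≤ (R.view p).len →
      ((R.view p).state i).isJoined = true := fun i h1 h2 => isJoined_mono hR hp h1 h2 hjk
  have hbusy_m := busy_of_pending hR hkm hm.le hop fun j h1 h2 => .inl (hrp j h1 h2)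
  have htag := hbusy_m.tag_eq hR hpc hm.le
  have hrpm := hrp m hkm le_rfl
  obtain ⟨i1, i2, x, i3⟩ : ((R.view p).state (m + 1)).rwCounter = 0 ∧
      ((R.view p).state (m + 1)).rwBound = P.β * ((R.view p).state m).members.card ∧
      ∃ x, (.servers, .update x ((R.view p).state m).tag) ∈ (R.view p).out m := by
    rw [state_succ hR hp hm] at hrp' hwp' ⊢
    rw [out_eq hR hp hm]
    by_cases hrep : ∃ r, CountsReply p ((R.view p).trigger m) ((R.view p).state m) r
    · obtain ⟨r, hrep⟩ := hrep
      obtain ⟨-, -, h⟩ := client_countsReply hpc hrep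
      split_ifs at h with hb
      · exact ⟨h.2.2.1, h.2.2.2.1, h.2.2.2.2⟩
      · rw [h.1] at hrp'
        simp at hrp'
    · push Not at hrep
      exfalso
      have hack : ∀ r, ¬ CountsAck p ((R.view p).trigger m) ((R.view p).state m) r := by
        intro r h
        have := h.2.2
        rw [hbusy_m.pending.excl hrpm] at this
        simp at this
      have hinv : ¬ ((R.view p).trigger m).IsInvocation := fun h => by
        rw [(idle_of_invocation hR hm h).rp] at hrpm
        simp at hrpm
      rw [(client_other hpc hinv hrep hack).1.rp, hrpm] at hrp'
      simp at hrp'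
  obtain ⟨Q, hQ0, hQβ, hQ⟩ := exists_quorum hR hD hα hN hM hp hm (hjoined m hkm.le hm.le)
  have hresp : ∀ s ∈ Q, ∃ v, m < v ∧ R.HasStep p v ∧
      (R.view p).time v ≤ (R.view p).time m + 2 * D ∧
      (R.view p).trigger v = .receive s (.ack ((R.view p).state m).tag p) ∧
      ((R.view p).state v).isValid s
        (.ack ((R.view p).state m).tag p : Payload ID V) = true := by
    intro s hs
    obtain ⟨q1, q2, q3, q4, q5⟩ := hQ s hs
    obtain ⟨v, m', hv, hvt, hTv, hlab, hval⟩ := exists_response hR hD hα hpc hm ha q1 q2 q3 q4 i3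
      (l := .ack p ((R.view p).state m).tag) fun w hw hkw hT => by
        have h := server_receive_update_out (s := (R.view s).state w) (x := x)
          (wt := ((R.view p).state m).tag) q1 hpc (q5 w hw hkw)
        rw [← hT, ← out_eq hR q2 hw] at h
        exact ⟨_, h, rfl⟩
    cases m' <;> simp [Payload.label] at hlab
    rw [hlab.1, hlab.2] at hTv hval
    refine ⟨v, ?_, hv, hvt, hTv, hval⟩
    obtain ⟨w, hw, ⟨x', ho⟩, hwv, -⟩ := receive_origin hR q2 hv hTv
    obtain ⟨i, hi, ⟨-, -, hrpi, htagi, -⟩, hiw, -⟩ := receive_origin hR hp hw ho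
    -- An update with this tag is sent only after step `k` has raised the tag, and only in a step
    -- that ends a read phase; the read phase is pending up to step `m`.
    have hmi : m ≤ i := by
      by_contra hc
      have hki : k < i := by
        by_contra hik
        have := tag_mono hR hpc (not_lt.1 hik) hk.le
        omega
      rw [hrp (i + 1) (by omega) (by omega)] at hrpi
      simp at hrpi
    exact hmi.trans_lt (lt_of_time_lt hR hi (hiw.trans hwv))
  choose! v hv using hresp
  obtain ⟨s₁, hs₁, hmax⟩ := Q.exists_max_image v hQ0
  obtain ⟨hmM, hMs, hMt, -⟩ := hv s₁ hs₁
  have hbusy : ∀ i, m < i → i ≤ v s₁ →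
      (∀ j, m < j → j ≤ i → ((R.view p).state j).wpPending = true) → Busy R p k i :=
    fun i hmi hiM hpend => busy_of_pending hR (hkm.trans hmi) (hMs.of_le hiM).le hop
      fun j h1 h2 => (le_or_gt j m).imp (hrp j h1) fun h => hpend j h h2
  have hstep : ∀ i, m < i → i ≤ v s₁ →
      (∀ j, m < j → j ≤ i → ((R.view p).state j).wpPending = true) →
      (((R.view p).state (i + 1)).wpPending ≠ true →
        (∃ r, (R.view p).trigger i = .receive r (.ack ((R.view p).state i).tag p)) ∧
        (R.view p).resp i = if ((R.view p).state i).readPending then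
          some (.returned ((R.view p).state i).temp)
        else if ((R.view p).state i).writePending then some .acked else none) ∧
      (((R.view p).state (i + 1)).wpPending = true →
        ((R.view p).state (i + 1)).rwBound = ((R.view p).state i).rwBound ∧
        ((R.view p).state i).rwCounter ≤ ((R.view p).state (i + 1)).rwCounter ∧
        (((R.view p).state (i + 1)).rwCounter = ((R.view p).state i).rwCounter ∨
          (((R.view p).state (i + 1)).rwCounter : ℝ) < ((R.view p).state i).rwBound) ∧
        ∀ r, CountsAck p ((R.view p).trigger i) ((R.view p).state i) r →
          ((R.view p).state i).rwCounter + 1 ≤ ((R.view p).state (i + 1)).rwCounter) := by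
    intro i hmi hiM hpend
    have hi := hMs.of_le hiM
    have hwp := hpend i hmi le_rfl
    have hstate := state_succ hR hp hi
    have hresp := resp_eq hR hp hi
    by_cases hack : ∃ r, CountsAck p ((R.view p).trigger i) ((R.view p).state i) r
    · obtain ⟨r, hack⟩ := hack
      obtain ⟨-, -, h⟩ := client_countsAck hpc hack
      rw [← hstate, ← hresp] at h
      by_cases hb : ((R.view p).state i).rwBound ≤ (((R.view p).state i).rwCounter + 1 : ℕ)
      · rw [if_pos hb] at h
        exact ⟨fun _ => ⟨⟨r, hack.1⟩, h.2.2.2⟩, fun h' => by rw [h.1] at h'; simp at h'⟩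
      · rw [if_neg hb] at h
        refine ⟨fun h' => absurd h.2.2.1 h', fun _ => ⟨h.2.2.2.2, by omega, .inr ?_,
          fun _ _ => h.2.2.2.1.ge⟩⟩
        rw [h.2.2.2.1]
        exact not_le.1 hb
    · push Not at hack
      have hinv : ¬ ((R.view p).trigger i).IsInvocation := fun h => by
        rw [(idle_of_invocation hR hi h).wp] at hwp
        simp at hwp
      have hrep : ∀ r, ¬ CountsReply p ((R.view p).trigger i) ((R.view p).state i) r := by
        rintro r ⟨-, -, -, h⟩
        rw [(hbusy i hmi hiM hpend).pending.excl h] at hwp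
        simp at hwp
      obtain ⟨h1, -⟩ := client_other hpc hinv hrep hack
      rw [← hstate] at h1
      exact ⟨fun h => absurd (h1.wp.trans hwp) h, fun _ => ⟨h1.rwBound, h1.rwCounter.ge,
        .inl h1.rwCounter, fun r hr => absurd hr (hack r)⟩⟩
  obtain ⟨n, hmn, hnM, hn1, hn2⟩ := exists_phase_end
    (pend := fun i => ((R.view p).state i).wpPending = true)
    (A := fun i s => CountsAck p ((R.view p).trigger i) ((R.view p).state i) s)
    (c := fun i => ((R.view p).state i).rwCounter) (b := fun i => ((R.view p).state i).rwBound)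
    (fun i s s' h h' => h.unique h') hmM hwp' i1
    (fun i h1 h2 h3 h4 => (hstep i h1 h2 h3).2 h4) Q hQ0 (i2.trans_le hQβ) fun s hs => by
      obtain ⟨h1, h2, -, h3, h4⟩ := hv s hs
      have h5 := hmax s hs
      have h6 : (∀ j, m < j → j ≤ v s → ((R.view p).state j).wpPending = true) →
          ((R.view p).state (v s)).tag = ((R.view p).state m).tag := fun hpend =>
        ((hbusy _ h1 h5 hpend).tag_eq hR hpc h2.le).trans htag.symm
      refine ⟨v s, h1, h5, fun hpend => ⟨?_, ?_, hpend _ h1 le_rfl⟩⟩ <;> rwa [h6 hpend]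
  have hn := hMs.of_le hnM
  obtain ⟨⟨r, hTn⟩, hrn⟩ := (hstep n hmn hnM hn1).1 hn2
  have hb := hbusy n hmn hnM hn1
  refine ⟨n, ⟨hmn, hn, hn1, by simpa using hn2⟩, ⟨hkm.trans hmn, hn, hop, ?_, fun i h1 h2 => ?_,
    fun i h1 h2 => ?_⟩, (time_le hR hMs hnM).trans hMt⟩
  · rcases hb.pending.flags with ⟨h1, h2, -⟩ | ⟨h1, h2, h3⟩
    · rw [h2, if_pos rfl] at hrn
      exact ⟨_, hrn, .inl ⟨h1, _, rfl⟩⟩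
    · rw [h2, h3] at hrn
      exact ⟨_, hrn, .inr ⟨h1, rfl⟩⟩
  · rcases h2.lt_or_eq with h2 | rfl
    · have hi := hn.of_le h2.le
      have h3 := hb.later i h1 h2
      have h4 : (R.view p).trigger i ≠ .enter := fun h => by
        have := ((occurs_enter_iff hR hi).1 h).1
        omega
      have h5 := fun h => (not_le.2 h2) (le_of_halt hR hn hi h)
      cases hT : (R.view p).trigger i with
      | receive r m => exact ⟨r, m, rfl⟩
      | enter => exact absurd hT h4
      | leave => exact absurd (.inl hT) h5
      | crash => exact absurd (.inr hT) h5
      | read => exact absurd (.inl hT) h3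
      | write v => exact absurd (.inr ⟨v, hT⟩) h3
    · exact ⟨r, _, hTn⟩
  · have hi := hn.of_le h2.le
    -- The only response possible before the end is Joined, but the client had joined before the
    -- invocation.
    refine (hb.resp i h1 h2).resolve_right fun h => ?_
    rw [resp_eq hR hp hi] at h
    exact (isJoined_step_of_isJoined (hjoined i h1.le hi.le)).2 h

end Operations

end ABCC

theorem mainTheorem3 {ID V : Type*} [LinearOrder ID] [DecidableEq V]
    (P : ABCC.Params ID) (D α : ℝ) (NSmin : ℕ)
    (hD : 0 < D) (hα : 0 < α) (hf : 1 ≤ P.f) (hN : 0 < NSmin)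
    (hP : ABCC.Constraints α P.f NSmin P.γ P.β)
    (R : ABCC.Run ID V) (hR : ABCC.IsExecution P D α NSmin R)
    (p : ID) (k : ℕ) (hk : R.HasStep p k) (hop : ((R.view p).trigger k).IsInvocation) :
    -- the read phase terminates within time `2D`
    (R.ActiveAt p ((R.view p).time k + 2 * D) →
      ∃ m, R.ReadPhase p k m ∧ (R.view p).time m ≤ (R.view p).time k + 2 * D) ∧
    -- the write phase terminates within time `2D`, and the operation is then complete
    (∀ m, R.ReadPhase p k m → R.ActiveAt p ((R.view p).time m + 2 * D) →
      ∃ n, R.WritePhase p m n ∧ R.Completes p k n ∧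
        (R.view p).time n ≤ (R.view p).time m + 2 * D) ∧
    -- if the client remains active, the operation completes
    ((∀ t, (R.view p).time k ≤ t → R.ActiveAt p t) →
      ∃ m n, R.ReadPhase p k m ∧ R.WritePhase p m n ∧ R.Completes p k n ∧
        (R.view p).time m ≤ (R.view p).time k + 2 * D ∧
        (R.view p).time n ≤ (R.view p).time m + 2 * D) := by
  have hM := hP.margins hα hf hN
  have hread := ABCC.exists_readPhase hR hD hα hN hM hk hop
  have hwrite := fun m h => ABCC.exists_writePhase hR hD hα hN hM (p := p) (k := k) (m := m) h
  refine ⟨hread, hwrite, fun h => ?_⟩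
  obtain ⟨m, hm, hmt⟩ := hread (h _ (by linarith))
  obtain ⟨n, hn, hc, hnt⟩ := hwrite m hm (h _ (by
    linarith [ABCC.time_le hR hm.2.2.1 hm.2.1.le]))
  exact ⟨m, n, hm, hn, hc, hmt, hnt⟩
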